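/- Let $X$ be a compact connected Riemann surface, $p$ an odd prime, $f:X\to X$ a holomorphic automorphism of order $p$, $X^f$ its fixed point set, and $\zeta$ a primitive $p$-th root of unity. For a holomorphic vector bundle $V$ on $X$, an $\langle f\rangle$-equivariant structure on $V$ is given by its generator, an isomorphism $f_V:V\to f^*V$ (a lift of $f$ to $V$) with $f_V^p=\mathrm{Id}$. Let $\Lambda\to X$ be a holomorphic line bundle of odd degree with an $\langle f\rangle$-equivariant structure $f_\Lambda$. For $x\in X^f$ let $\alpha_x$ be the scalar by which $f_\Lambda$ acts on $\Lambda_x$; it is a $p$-th root of unity, and $\sqrt{\alpha_x}=\alpha_x^{(p+1)/2}$ denotes its unique square root among the $p$-th roots of unity. A Higgs bundle $(E,\Phi)$ is a rank two holomorphic vector bundle $E$ with $\Phi\in H^0(X,\mathrm{End}_0(E)\otimes K_X)$; it is stable if $\deg L<\tfrac12\deg E$ for every $\Phi$-invariant holomorphic line subbundle $L\subset E$. Its pullback $f^*(E,\Phi)$ is $f^*E$ with the Higgs field $w\mapsto\Phi_{f(x)}(df_x(w))$, $w\in T_xX$. Let $\mathcal M$ be the moduli space of isomorphism classes of stable Higgs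 bundles with $\det E\cong\Lambda$, and $\mathcal M^f$ the set of classes fixed by $f^*$. Let $(E,\Phi)$ be a Higgs bundle with isomorphism class $\mathcal E\in\mathcal M^f$. (1) There is a unique $\langle f\rangle$-equivariant structure $f_E$ on $E$ whose generator is an isomorphism of Higgs bundles $(E,\Phi)\to f^*(E,\Phi)$ and for which $\det E$, with the induced action, is $\langle f\rangle$-equivariantly isomorphic to $\Lambda$. (2) Let $D_E$ be the set of $x\in X^f$ at which the eigenvalues of $f_E(x):E_x\to E_x$ are distinct. For each $x\in D_E$ there is a unique $i_x\in\{1,\dots,(p-1)/2\}$ such that these eigenvalues are $\sqrt{\alpha_x}\,\zeta^{i_x}$ and $\sqrt{\alpha_x}\,\zeta^{-i_x}$. Let $F_x\subset E_x$ be the $\sqrt{\alpha_x}\,\zeta^{-i_x}$-eigenspace of $f_E(x)$ and let $F=\{F_x\}_{x\in D_E}$. Then $D_E$ is finite, each $F_x$ is a line, and $(E,F,\Phi,f_E)$ is an $\langle f\rangle$-equivariant quasi-parabolic Higgs bundle on $(X,D_E)$; that is, $f_E$ induces an isomorphism $(E,F,\Phi)\to f^*(E,F,\Phi)$, where $f^*(F)_x=F_{f(x)}$.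 (3) The isomorphism class of $(E,F,\Phi,f_E)$ depends only on $\mathcal E$: if $(E',\Phi')$ is a Higgs bundle with isomorphism class $\mathcal E$, with equivariant structure $f_{E'}$ and flags $F'$ obtained in the same way, then $D_E=D_{E'}$ and there is an isomorphism $E\to E'$ that intertwines $\Phi$ with $\Phi'$, intertwines $f_E$ with $f_{E'}$ and maps $F$ to $F'$. -/

import Mathlib

open Bundle Topology
open scoped Manifold ContDiff

universe u v

noncomputable section

/-! ## Holomorphic vector bundles on a Riemann surface -/

/-- A holomorphic vector bundle of rank `r` on the Riemann surface `X` (over `ℂ`, the class `C^ω`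
of analytic transition functions is the class of holomorphic ones). -/
structure HolomorphicBundle (X : Type u) [TopologicalSpace X] [ChartedSpace ℂ X] (r : ℕ) where
  fiber : X → Type v
  [addCommGroup : ∀ x, AddCommGroup (fiber x)]
  [module : ∀ x, Module ℂ (fiber x)]
  [topologicalSpace : ∀ x, TopologicalSpace (fiber x)]
  [totalTopologicalSpace : TopologicalSpace (TotalSpace (Fin r → ℂ) fiber)]
  [fiberBundle : FiberBundle (Fin r → ℂ) fiber]
  [vectorBundle : VectorBundle ℂ (Fin r → ℂ) fiber]
  [holomorphic : ContMDiffVectorBundle ω (Fin r → ℂ) fiber 𝓘(ℂ, ℂ)]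

attribute [instance] HolomorphicBundle.addCommGroup HolomorphicBundle.module
  HolomorphicBundle.topologicalSpace HolomorphicBundle.totalTopologicalSpace
  HolomorphicBundle.fiberBundle HolomorphicBundle.vectorBundle HolomorphicBundle.holomorphic

/-- The automorphisms (biholomorphic self-maps) of the Riemann surface `X`. -/
abbrev Automorphism (X : Type u) [TopologicalSpace X] [ChartedSpace ℂ X] :=
  Diffeomorph 𝓘(ℂ, ℂ) 𝓘(ℂ, ℂ) X X ω

/-- The linear identification of two fibres over points that are equal. -/
def fiberCast {X : Type u} (E : X → Type v) [∀ x, AddCommGroup (E x)] [∀ x, Module ℂ (E x)]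
    {y x : X} (h : y = x) : E y ≃ₗ[ℂ] E x :=
  h ▸ LinearEquiv.refl ℂ (E y)

theorem fiberCast_comp_apply {X : Type u} (E : X → Type v) [∀ x, AddCommGroup (E x)]
    [∀ x, Module ℂ (E x)] (f : X → X) (s : ∀ x, E (f x)) {x y : X} (h : x = y)
    (h₂ : f x = f y) : fiberCast E h₂ (s x) = s y := by
  subst h
  rfl

theorem mk_fiberCast {X : Type u} (F : Type*) (E : X → Type v) [∀ x, AddCommGroup (E x)]
    [∀ x, Module ℂ (E x)] {x y : X} (h : x = y) (e : E x) :
    TotalSpace.mk' F y (fiberCast E h e) = TotalSpace.mk' F x e := by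
  subst h
  rfl

variable {X : Type u} [TopologicalSpace X] [ChartedSpace ℂ X]

namespace HolomorphicBundle

variable {r r₂ : ℕ}

/-- `s` is a holomorphic section of `V` over the subset `U`. -/
def IsHolomorphicSection (V : HolomorphicBundle.{u, v} X r) (s : ∀ x, V.fiber x) (U : Set X) :
    Prop :=
  ContMDiffOn 𝓘(ℂ, ℂ) (𝓘(ℂ, ℂ).prod 𝓘(ℂ, Fin r → ℂ)) ω
    (fun x => TotalSpace.mk' (Fin r → ℂ) x (s x)) U

/-- A fibrewise linear map is holomorphic if it maps local holomorphic sections to local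
holomorphic sections. -/
def IsHolomorphicMap (V : HolomorphicBundle.{u, v} X r) (W : HolomorphicBundle.{u, v} X r₂)
    (φ : ∀ x, V.fiber x →ₗ[ℂ] W.fiber x) : Prop :=
  ∀ U : Set X, IsOpen U → ∀ s : ∀ x, V.fiber x, V.IsHolomorphicSection s U →
    W.IsHolomorphicSection (fun x => φ x (s x)) U

/-- Isomorphisms of holomorphic vector bundles (covering the identity of `X`). -/
structure Iso (V W : HolomorphicBundle.{u, v} X r) where
  toEquiv : ∀ x, V.fiber x ≃ₗ[ℂ] W.fiber x
  holomorphic : V.IsHolomorphicMap W fun x => (toEquiv x).toLinearMap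
  holomorphic_symm : W.IsHolomorphicMap V fun x => (toEquiv x).symm.toLinearMap

/-- The pullback bundle `f^* V`, with fibre `V_{f(x)}` at `x`. -/
def pullback (V : HolomorphicBundle.{u, v} X r) (f : Automorphism X) :
    HolomorphicBundle.{u, v} X r :=
  let g : ContMDiffMap 𝓘(ℂ, ℂ) 𝓘(ℂ, ℂ) X X ω := ⟨f, f.contMDiff⟩
  { fiber := fun x => V.fiber (f x)
    addCommGroup := fun x => V.addCommGroup (f x)
    module := fun x => V.module (f x)
    topologicalSpace := fun x => V.topologicalSpace (f x)
    totalTopologicalSpace := Pullback.TotalSpace.topologicalSpace (Fin r → ℂ) V.fiber f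
    fiberBundle := FiberBundle.pullback g
    vectorBundle := VectorBundle.pullback (𝕜 := ℂ) (F := Fin r → ℂ) (E := V.fiber) g
    holomorphic := ContMDiffVectorBundle.pullback (Fin r → ℂ) V.fiber 𝓘(ℂ, ℂ) g }

/-- A section of `f^* V` is holomorphic if and only if it is holomorphic as a map to `V`. -/
theorem isHolomorphicSection_pullback_iff (V : HolomorphicBundle.{u, v} X r)
    (f : Automorphism X) (s : ∀ x, V.fiber (f x)) (U : Set X) :
    (V.pullback f).IsHolomorphicSection s U ↔
      ContMDiffOn 𝓘(ℂ, ℂ) (𝓘(ℂ, ℂ).prod 𝓘(ℂ, Fin r → ℂ)) ω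
        (fun x => TotalSpace.mk' (Fin r → ℂ) (E := V.fiber) (f x) (s x)) U := by
  unfold IsHolomorphicSection ContMDiffOn
  refine forall₂_congr fun x hx => ?_
  rw [contMDiffWithinAt_totalSpace, contMDiffWithinAt_totalSpace]
  have h1 : ContMDiffWithinAt 𝓘(ℂ, ℂ) 𝓘(ℂ, ℂ) ω (fun x : X => x) U x := contMDiffWithinAt_id
  have h2 : ContMDiffWithinAt 𝓘(ℂ, ℂ) 𝓘(ℂ, ℂ) ω (fun x : X => f x) U x :=
    f.contMDiff.contMDiffAt.contMDiffWithinAt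
  exact and_congr (iff_of_true h1 h2) Iff.rfl

/-! ### Degrees -/

/-- The local expression of a section of `V` near `x₀`, in the preferred chart of `X` and the
preferred trivialization of `V` at `x₀`. -/
def localExpr (V : HolomorphicBundle.{u, v} X r) (s : ∀ x, V.fiber x) (x₀ : X) (z : ℂ) :
    Fin r → ℂ :=
  (trivializationAt (Fin r → ℂ) V.fiber x₀).linearMapAt ℂ ((chartAt ℂ x₀).symm z)
    (s ((chartAt ℂ x₀).symm z))

/-- The isomorphism `⋀^r (ℂ^r) → ℂ` given by the determinant. -/
def detCoord (r : ℕ) : ⋀[ℂ]^r (Fin r → ℂ) →ₗ[ℂ] ℂ :=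
  exteriorPower.alternatingMapLinearEquiv
    (Matrix.detRowAlternating : (Fin r → ℂ) [⋀^Fin r]→ₗ[ℂ] ℂ)

/-- The local expression near `x₀` of a section of the determinant line bundle `⋀^r V`. -/
def detLocalExpr (V : HolomorphicBundle.{u, v} X r) (s : ∀ x, ⋀[ℂ]^r (V.fiber x)) (x₀ : X)
    (z : ℂ) : ℂ :=
  detCoord r (exteriorPower.map r
    ((trivializationAt (Fin r → ℂ) V.fiber x₀).linearMapAt ℂ ((chartAt ℂ x₀).symm z))
    (s ((chartAt ℂ x₀).symm z)))

/-- `V` has degree `d`: its determinant line bundle has a meromorphic section, not identically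
zero, whose divisor of zeros and poles has degree `d`. (On a compact Riemann surface such a
section exists and `d` does not depend on it.) -/
def HasDegree (V : HolomorphicBundle.{u, v} X r) (d : ℤ) : Prop :=
  ∃ s : ∀ x, ⋀[ℂ]^r (V.fiber x),
    (∀ x, MeromorphicAt (V.detLocalExpr s x) (chartAt ℂ x x)) ∧
    (∀ x, meromorphicOrderAt (V.detLocalExpr s x) (chartAt ℂ x x) ≠ ⊤) ∧
    ∑ᶠ x, (meromorphicOrderAt (V.detLocalExpr s x) (chartAt ℂ x x)).untop₀ = d

/-- A holomorphic line subbundle of `V`: locally it is spanned by a nowhere vanishing holomorphic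
section of `V`. -/
def IsLineSubbundle (V : HolomorphicBundle.{u, v} X r) (L : ∀ x, Submodule ℂ (V.fiber x)) :
    Prop :=
  ∀ x₀, ∃ U : Set X, IsOpen U ∧ x₀ ∈ U ∧ ∃ s : ∀ x, V.fiber x, V.IsHolomorphicSection s U ∧
    ∀ x ∈ U, s x ≠ 0 ∧ L x = Submodule.span ℂ {s x}

/-- The line subbundle `L` of `V` has degree `d`: it has a meromorphic section, not identically
zero, whose divisor has degree `d`. Since a local frame of `L` is a nowhere vanishing section of
`V`, the order of a section of `L` at a point is its order as a section of `V`. -/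
def HasLineSubbundleDegree (V : HolomorphicBundle.{u, v} X r)
    (L : ∀ x, Submodule ℂ (V.fiber x)) (d : ℤ) : Prop :=
  ∃ s : ∀ x, V.fiber x, (∀ x, s x ∈ L x) ∧
    (∀ x, MeromorphicAt (V.localExpr s x) (chartAt ℂ x x)) ∧
    (∀ x, meromorphicOrderAt (V.localExpr s x) (chartAt ℂ x x) ≠ ⊤) ∧
    ∑ᶠ x, (meromorphicOrderAt (V.localExpr s x) (chartAt ℂ x x)).untop₀ = d

/-! ### Equivariant structures -/

/-- The map of total spaces, covering `f`, that belongs to a map `V → f^* V`. -/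
def totalMap (V : HolomorphicBundle.{u, v} X r) (f : Automorphism X) (φ : V.Iso (V.pullback f))
    (e : TotalSpace (Fin r → ℂ) V.fiber) : TotalSpace (Fin r → ℂ) V.fiber :=
  ⟨f e.1, φ.toEquiv e.1 e.2⟩

/-- An `⟨f⟩`-equivariant structure on `V`, where `f` has order `p`, given by its generator: an
isomorphism `V → f^* V`, that is a lift of `f` to `V`, whose `p`-th power is the identity. -/
structure EquivariantStructure (f : Automorphism X) (p : ℕ) (V : HolomorphicBundle.{u, v} X r)
    extends V.Iso (V.pullback f) where
  iterate_eq : (V.totalMap f toIso)^[p] = id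

/-- The action of a lift of `f` on the fibre over a fixed point `x` of `f`. -/
def EquivariantStructure.atFixed {f : Automorphism X} {p : ℕ} {V : HolomorphicBundle.{u, v} X r}
    (a : EquivariantStructure f p V) {x : X} (hx : f x = x) : Module.End ℂ (V.fiber x) :=
  (fiberCast V.fiber hx).toLinearMap ∘ₗ (a.toEquiv x).toLinearMap

/-- The scalar `α_x` by which a lift of `f` to a line bundle acts on the fibre over the fixed
point `x` (an endomorphism of a line is multiplication by its determinant). -/
def EquivariantStructure.scalarAt {f : Automorphism X} {p : ℕ} {L : HolomorphicBundle.{u, v} X 1}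
    (a : EquivariantStructure f p L) {x : X} (hx : f x = x) : ℂ :=
  LinearMap.det (a.atFixed hx)

/-- For `p` odd and `α ^ p = 1`, the square root of `α` that is again a `p`-th root of unity. -/
def sqrtRootOfUnity (p : ℕ) (α : ℂ) : ℂ := α ^ ((p + 1) / 2)

/-! ### The determinant line bundle -/

/-- An isomorphism of holomorphic line bundles from `det V = ⋀² V` to `L`. Holomorphic sections
of `⋀² V` are locally generated by the `s ∧ t` with `s`, `t` holomorphic sections of `V`. -/
structure DetIso (V : HolomorphicBundle.{u, v} X 2) (L : HolomorphicBundle.{u, v} X 1) where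
  toEquiv : ∀ x, ⋀[ℂ]^2 (V.fiber x) ≃ₗ[ℂ] L.fiber x
  holomorphic : ∀ U : Set X, IsOpen U → ∀ s t : ∀ x, V.fiber x, V.IsHolomorphicSection s U →
    V.IsHolomorphicSection t U →
    L.IsHolomorphicSection (fun x => toEquiv x (exteriorPower.ιMulti ℂ 2 ![s x, t x])) U

/-- `det V`, with the action induced by `a`, is `⟨f⟩`-equivariantly isomorphic to `L` with the
action `b`. -/
def DetEquivariantlyIso {f : Automorphism X} {p : ℕ} {V : HolomorphicBundle.{u, v} X 2}
    {L : HolomorphicBundle.{u, v} X 1} (a : EquivariantStructure f p V)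
    (b : EquivariantStructure f p L) : Prop :=
  ∃ h : DetIso V L, ∀ x, ∀ e : ⋀[ℂ]^2 (V.fiber x),
    h.toEquiv (f x) (exteriorPower.map 2 (a.toEquiv x).toLinearMap e) = b.toEquiv x (h.toEquiv x e)

end HolomorphicBundle

/-! ## Higgs bundles -/

/-- A holomorphic vector field on the subset `U`. -/
def IsHolomorphicVectorField [IsManifold 𝓘(ℂ, ℂ) ω X]
    (w : ∀ x : X, TangentSpace 𝓘(ℂ, ℂ) x) (U : Set X) :
    Prop :=
  ContMDiffOn 𝓘(ℂ, ℂ) (𝓘(ℂ, ℂ).prod 𝓘(ℂ, ℂ)) ω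
    (fun x => TotalSpace.mk' ℂ (E := (TangentSpace 𝓘(ℂ, ℂ) : X → Type)) x (w x)) U

/-- A rank two Higgs bundle with trace-free Higgs field: `Φ` is a holomorphic section of
`End₀(E) ⊗ K`, that is, a holomorphic one-form with values in the trace-free endomorphisms. -/
structure HiggsBundle (X : Type u) [TopologicalSpace X] [ChartedSpace ℂ X] [IsManifold 𝓘(ℂ, ℂ) ω X]
    extends HolomorphicBundle.{u, v} X 2 where
  Φ : ∀ x : X, TangentSpace 𝓘(ℂ, ℂ) x →ₗ[ℂ] Module.End ℂ (fiber x)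
  Φ_holomorphic : ∀ U : Set X, IsOpen U → ∀ w : ∀ x : X, TangentSpace 𝓘(ℂ, ℂ) x,
    IsHolomorphicVectorField w U → ∀ s : ∀ x, fiber x,
    toHolomorphicBundle.IsHolomorphicSection s U →
    toHolomorphicBundle.IsHolomorphicSection (fun x => Φ x (w x) (s x)) U
  Φ_trace : ∀ x w, LinearMap.trace ℂ (fiber x) (Φ x w) = 0

variable [IsManifold 𝓘(ℂ, ℂ) ω X]

namespace HiggsBundle

/-- The bundle isomorphism `φ` intertwines the Higgs fields. -/
def IsHiggsIso (E₁ E₂ : HiggsBundle.{u, v} X)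
    (φ : E₁.toHolomorphicBundle.Iso E₂.toHolomorphicBundle) : Prop :=
  ∀ x, ∀ w : TangentSpace 𝓘(ℂ, ℂ) x, ∀ e : E₁.fiber x,
    φ.toEquiv x (E₁.Φ x w e) = E₂.Φ x w (φ.toEquiv x e)

/-- `E₁` and `E₂` have the same isomorphism class. -/
def IsIsomorphic (E₁ E₂ : HiggsBundle.{u, v} X) : Prop :=
  ∃ φ : E₁.toHolomorphicBundle.Iso E₂.toHolomorphicBundle, E₁.IsHiggsIso E₂ φ

/-- The pullback `f^*(E, Φ)`: the bundle `f^* E` with Higgs field `w ↦ Φ_{f(x)} (df_x w)`. -/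
def pullback (E : HiggsBundle.{u, v} X) (f : Automorphism X) : HiggsBundle.{u, v} X where
  toHolomorphicBundle := E.toHolomorphicBundle.pullback f
  Φ := fun x => (E.Φ (f x)).comp (mfderiv 𝓘(ℂ, ℂ) 𝓘(ℂ, ℂ) f x).toLinearMap
  Φ_trace := fun x w => E.Φ_trace (f x) (mfderiv 𝓘(ℂ, ℂ) 𝓘(ℂ, ℂ) f x w)
  Φ_holomorphic := by
    intro U hU w hw s hs
    replace hs := (E.isHolomorphicSection_pullback_iff f s U).1 hs
    refine (E.isHolomorphicSection_pullback_iff f _ U).2 ?_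
    have hsymm : ContMDiffOn 𝓘(ℂ, ℂ) 𝓘(ℂ, ℂ) ω f.symm (f.symm ⁻¹' U) :=
      f.symm.contMDiff.contMDiffOn
    have hV : IsOpen (f.symm ⁻¹' U) := hU.preimage f.symm.continuous
    let s₂ : ∀ y, E.fiber y := fun y =>
      fiberCast E.fiber (f.apply_symm_apply y) (s (f.symm y))
    let dw : ∀ x, TangentSpace 𝓘(ℂ, ℂ) (f x) := fun x => mfderiv 𝓘(ℂ, ℂ) 𝓘(ℂ, ℂ) f x (w x)
    let w₂ : ∀ y : X, TangentSpace 𝓘(ℂ, ℂ) y := fun y =>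
      fiberCast (TangentSpace 𝓘(ℂ, ℂ) : X → Type) (f.apply_symm_apply y) (dw (f.symm y))
    have hs₂ : E.IsHolomorphicSection s₂ (f.symm ⁻¹' U) := by
      refine (hs.comp hsymm fun y hy => hy).congr fun y _ => ?_
      exact mk_fiberCast _ E.fiber _ _
    have hw₂ : IsHolomorphicVectorField w₂ (f.symm ⁻¹' U) := by
      have h1 : ContMDiff (𝓘(ℂ, ℂ).prod 𝓘(ℂ, ℂ)) (𝓘(ℂ, ℂ).prod 𝓘(ℂ, ℂ)) ω
          (tangentMap 𝓘(ℂ, ℂ) 𝓘(ℂ, ℂ) f) :=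
        ContMDiff.contMDiff_tangentMap f.contMDiff le_rfl
      refine ((h1.comp_contMDiffOn hw).comp hsymm fun y hy => hy).congr fun y _ => ?_
      exact mk_fiberCast _ (TangentSpace 𝓘(ℂ, ℂ) : X → Type) _ _
    have key := E.Φ_holomorphic _ hV w₂ hw₂ s₂ hs₂
    refine (key.comp (f.contMDiff.contMDiffOn (s := U)) fun x hx => ?_).congr fun x _ => ?_
    · simpa using hx
    · have e1 : s₂ (f x) = s x :=
        fiberCast_comp_apply E.fiber f s (f.symm_apply_apply x) _
      have e2 : w₂ (f x) = dw x :=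
        fiberCast_comp_apply (TangentSpace 𝓘(ℂ, ℂ) : X → Type) f dw (f.symm_apply_apply x) _
      simp only [Function.comp_apply, e1, e2]
      rfl

/-- `(E, Φ)` is stable: every `Φ`-invariant line subbundle `L` satisfies
`deg L < deg E / 2` (both degrees exist and are unique on a compact Riemann surface). -/
def IsStable (E : HiggsBundle.{u, v} X) : Prop :=
  ∀ L : ∀ x, Submodule ℂ (E.fiber x), E.IsLineSubbundle L →
    (∀ x w, ∀ e ∈ L x, E.Φ x w e ∈ L x) →
    ∃ d₁ d : ℤ, E.HasLineSubbundleDegree L d₁ ∧ E.HasDegree d ∧ 2 * d₁ < d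

/-- The isomorphism class of `(E, Φ)` is a point of the moduli space of stable rank two Higgs
bundles with determinant `Λ`. -/
def MemModuli (E : HiggsBundle.{u, v} X) (Λ : HolomorphicBundle.{u, v} X 1) : Prop :=
  E.IsStable ∧ Nonempty (HolomorphicBundle.DetIso E.toHolomorphicBundle Λ)

/-- The isomorphism class of `(E, Φ)` is fixed by `f`, that is `(E, Φ) ≅ f^*(E, Φ)`. -/
def IsFixedBy (E : HiggsBundle.{u, v} X) (f : Automorphism X) : Prop :=
  E.IsIsomorphic (E.pullback f)

end HiggsBundle

/-! ## Quasi-parabolic structures -/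

open HolomorphicBundle

/-- A quasi-parabolic structure (with full flags `0 ⊂ F_x ⊂ V_x`) on a rank two bundle. Together
with a Higgs bundle with holomorphic Higgs field it makes up a quasi-parabolic Higgs bundle: all
residues are zero, hence nilpotent with respect to the flags. -/
structure QuasiParabolicStructure (V : HolomorphicBundle.{u, v} X 2) where
  marked : Set X
  finite : marked.Finite
  flag : ∀ x, x ∈ marked → Submodule ℂ (V.fiber x)
  finrank_flag : ∀ x hx, Module.finrank ℂ (flag x hx) = 1

namespace QuasiParabolicStructure

/-- The pulled back flags `(f^* F)_x = F_{f(x)}`. -/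
def pullback {V : HolomorphicBundle.{u, v} X 2} (P : QuasiParabolicStructure V)
    (f : Automorphism X) : QuasiParabolicStructure (V.pullback f) where
  marked := f ⁻¹' P.marked
  finite := P.finite.preimage f.injective.injOn
  flag := fun x hx => P.flag (f x) hx
  finrank_flag := fun x hx => P.finrank_flag (f x) hx

/-- The bundle isomorphism `φ` maps the flags of `P` to those of `Q`. -/
def IsFlagIso {V W : HolomorphicBundle.{u, v} X 2} (P : QuasiParabolicStructure V)
    (Q : QuasiParabolicStructure W) (φ : V.Iso W) : Prop :=
  P.marked = Q.marked ∧
    ∀ x hx hx₂, (P.flag x hx).map (φ.toEquiv x).toLinearMap = Q.flag x hx₂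

end QuasiParabolicStructure

/-- The lift `a` of `f` is an `⟨f⟩`-equivariant structure on the quasi-parabolic Higgs bundle
`(E, F, Φ)`, where `P` is the pair of `F` and the set of marked points: the marked points are fixed
by `f` and `a` induces an isomorphism `(E, F, Φ) → f^*(E, F, Φ)`. -/
structure IsEquivariantQuasiParabolic {f : Automorphism X} {p : ℕ} (E : HiggsBundle.{u, v} X)
    (P : QuasiParabolicStructure E.toHolomorphicBundle)
    (a : EquivariantStructure f p E.toHolomorphicBundle) : Prop where
  marked_subset : P.marked ⊆ {x | f x = x}
  isHiggsIso : E.IsHiggsIso (E.pullback f) a.toIso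
  isFlagIso : P.IsFlagIso (P.pullback f) a.toIso

/-- An `⟨f⟩`-equivariant quasi-parabolic Higgs bundle `(E, F, Φ, f_E)`. -/
structure EquivariantQuasiParabolicHiggsBundle (X : Type u) [TopologicalSpace X]
    [ChartedSpace ℂ X] [IsManifold 𝓘(ℂ, ℂ) ω X] (f : Automorphism X) (p : ℕ) where
  higgs : HiggsBundle.{u, v} X
  quasiParabolic : QuasiParabolicStructure higgs.toHolomorphicBundle
  lift : EquivariantStructure f p higgs.toHolomorphicBundle
  isEquivariant : IsEquivariantQuasiParabolic higgs quasiParabolic lift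

/-- Isomorphism of `⟨f⟩`-equivariant quasi-parabolic Higgs bundles. -/
def EquivariantQuasiParabolicHiggsBundle.IsIsomorphic {f : Automorphism X} {p : ℕ}
    (A B : EquivariantQuasiParabolicHiggsBundle.{u, v} X f p) : Prop :=
  ∃ φ : A.higgs.toHolomorphicBundle.Iso B.higgs.toHolomorphicBundle,
    A.higgs.IsHiggsIso B.higgs φ ∧ A.quasiParabolic.IsFlagIso B.quasiParabolic φ ∧
    ∀ x, ∀ e : A.higgs.fiber x,
      φ.toEquiv (f x) (A.lift.toEquiv x e) = B.lift.toEquiv x (φ.toEquiv x e)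

/-! ## The eigenspace flags -/

/-- The set `D_E` of fixed points `x` of `f` at which the lift `a` of `f` has two distinct
eigenvalues. -/
def distinctEigenvalueLocus {f : Automorphism X} {p : ℕ} {V : HolomorphicBundle.{u, v} X 2}
    (a : EquivariantStructure f p V) : Set X :=
  {x | ∃ hx : f x = x, ∃ μ₁ μ₂ : ℂ, μ₁ ≠ μ₂ ∧ (a.atFixed hx).HasEigenvalue μ₁ ∧
    (a.atFixed hx).HasEigenvalue μ₂}

/-- `i` is the exponent `i_x ∈ {1, …, (p - 1) / 2}` at the fixed point `x`: the eigenvalues of the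
lift `a` at `x` are exactly `√α_x ζ ^ i` and `√α_x ζ ^ (-i)`, where `α_x` is the scalar of the
lift `b` to a line bundle at `x`. -/
def IsEigenvalueExponent {f : Automorphism X} {p : ℕ} {V : HolomorphicBundle.{u, v} X 2}
    {L : HolomorphicBundle.{u, v} X 1} (ζ : ℂ) (a : EquivariantStructure f p V)
    (b : EquivariantStructure f p L) {x : X} (hx : f x = x) (i : ℕ) : Prop :=
  i ∈ Finset.Icc 1 ((p - 1) / 2) ∧ ∀ μ : ℂ, (a.atFixed hx).HasEigenvalue μ ↔
    μ = sqrtRootOfUnity p (b.scalarAt hx) * ζ ^ i ∨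
    μ = sqrtRootOfUnity p (b.scalarAt hx) * (ζ ^ i)⁻¹

/-- `P` is the quasi-parabolic structure with marked points `D_E` and with flag at `x` the
eigenspace of the lift `a` for the eigenvalue `√α_x ζ ^ (-i_x)`. -/
def IsEigenspaceFlag {f : Automorphism X} {p : ℕ} {V : HolomorphicBundle.{u, v} X 2}
    {L : HolomorphicBundle.{u, v} X 1} (ζ : ℂ) (a : EquivariantStructure f p V)
    (b : EquivariantStructure f p L) (P : QuasiParabolicStructure V) : Prop :=
  P.marked = distinctEigenvalueLocus a ∧
    ∀ x (hx : f x = x) (hm : x ∈ P.marked), ∃ i, IsEigenvalueExponent ζ a b hx i ∧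
      P.flag x hm =
        (a.atFixed hx).eigenspace (sqrtRootOfUnity p (b.scalarAt hx) * (ζ ^ i)⁻¹)

/-- `(E, F, Φ, f_E)` is an equivariant quasi-parabolic Higgs bundle such that `f_E` makes `det E`
equivariantly isomorphic to `L` with the lift `b`, and `F` consists of the eigenspace flags of
`f_E`. -/
def EquivariantQuasiParabolicHiggsBundle.IsEigenspaceBundle {f : Automorphism X} {p : ℕ}
    {L : HolomorphicBundle.{u, v} X 1} (A : EquivariantQuasiParabolicHiggsBundle.{u, v} X f p)
    (ζ : ℂ) (b : EquivariantStructure f p L) : Prop :=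
  DetEquivariantlyIso A.lift b ∧ IsEigenspaceFlag ζ A.lift b A.quasiParabolic

end

noncomputable section

open Filter Set

/-! ## Counting preimages near a point -/

/-! Everything rests on the fact that a stable Higgs bundle is simple (`IsStable.exists_eq_smul`).
Let `φ` be an endomorphism commuting with `Φ`. Its trace and determinant are holomorphic functions
on a compact connected surface, hence constant, so `(φ - a)(φ - b) = 0` for constants `a`, `b`. If
`φ` is not a scalar, then `φ - a` and `φ - b` are singular but not identically zero, and their
kernels extend over the isolated bad points to `Φ`-invariant line subbundles `L` and `L'`. Since `φ
- a` kills `L` and maps into `L'`, it induces a nonzero map `E/L → L'`, so `deg E ≤ deg L + deg L'`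
(`degree_le_of_rankOne`); stability says that both degrees on the right are less than `deg E / 2`.
The degree inequality rests in turn on the vanishing of the degree of the divisor of a meromorphic
function (`finsum_chartOrder_eq_zero`), proved by counting preimages: the number of solutions of `g
= c` is, up to isolated exceptions, independent of `c`; near `0` it counts zeros and near infinity
it counts poles.

Given an isomorphism `φ : E → f^* E`, its `p`-th iterate is an endomorphism of the Higgs bundle,
hence a nonzero scalar, and rescaling makes it the identity. The action induced on `det E` then
differs from that on `Λ` by a constant `k` with `k ^ p = 1`. With `p = 2m + 1`, multiplying the lift
by `k ^ m` multiplies the determinant action by `k ^ (2m)` and removes the discrepancy. Two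
normalized lifts differ by a constant `c` with `c ^ 2 = 1` and `c ^ p = 1`, so `c = 1`.

At a fixed point the eigenvalues are `p`-th roots of unity, and two distinct ones have product
`α_x`. Divided by the square root of `α_x` they become `ζ ^ j` and `ζ ^ (-j)`, and exactly one of
`j`, `p - j` is at most `(p - 1) / 2`. Eigenspaces are preserved by the lift, and the fixed points
are isolated, hence finite in number. For independence of the representative, both lifts are
transported to one bundle, where uniqueness identifies them; the resulting isomorphism intertwines
the lifts and therefore carries eigenspaces to eigenspaces. -/

theorem encard_setOf_pow_eq {n : ℕ} (hn : n ≠ 0) {c : ℂ} (hc : c ≠ 0) :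
    {w : ℂ | w ^ n = c}.encard = n := by
  classical
  obtain ⟨α, hα⟩ := IsAlgClosed.exists_pow_nat_eq c (Nat.pos_of_ne_zero hn)
  have hζ := Complex.isPrimitiveRoot_exp n hn
  have h1 := hζ.card_nthRoots c
  rw [if_pos ⟨α, hα⟩] at h1
  have h2 := Multiset.toFinset_card_of_nodup (hζ.nthRoots_nodup hc)
  have h3 : {w : ℂ | w ^ n = c} = ((Polynomial.nthRoots n c).toFinset : Set ℂ) := by
    ext w
    simp [Polynomial.mem_nthRoots (Nat.pos_of_ne_zero hn)]
  rw [h3, Set.encard_coe_eq_coe_finsetCard, h2, h1]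

/-- An analytic function that does not vanish at a point has an analytic `n`-th root there. -/
theorem AnalyticAt.exists_pow_eq {h : ℂ → ℂ} {z₀ : ℂ} (hh : AnalyticAt ℂ h z₀) (h0 : h z₀ ≠ 0)
    {n : ℕ} (hn : n ≠ 0) :
    ∃ r : ℂ → ℂ, AnalyticAt ℂ r z₀ ∧ r z₀ ≠ 0 ∧ ∀ᶠ z in 𝓝 z₀, r z ^ n = h z := by
  obtain ⟨α, hα⟩ := IsAlgClosed.exists_pow_nat_eq (h z₀) (Nat.pos_of_ne_zero hn)
  have hα0 : α ≠ 0 := by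
    rintro rfl
    exact h0 (by rw [← hα, zero_pow hn])
  -- Dividing by `h z₀` moves the value at `z₀` to `1`, where the principal logarithm is analytic;
  -- `α` restores the lost constant.
  have hq : AnalyticAt ℂ (fun z => h z / h z₀) z₀ := hh.div analyticAt_const h0
  have hq1 : h z₀ / h z₀ = 1 := div_self h0
  have hs : h z₀ / h z₀ ∈ Complex.slitPlane := by rw [hq1]; exact Complex.one_mem_slitPlane
  refine ⟨fun z => α * Complex.exp (Complex.log (h z / h z₀) / n), ?_, ?_, ?_⟩
  · exact analyticAt_const.mul ((hq.clog hs).div_const).cexp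
  · exact mul_ne_zero hα0 (Complex.exp_ne_zero _)
  · filter_upwards [hh.continuousAt.eventually_ne h0] with z hz
    rw [mul_pow, ← Complex.exp_nat_mul, mul_div_cancel₀ _ (Nat.cast_ne_zero.2 hn),
      Complex.exp_log (div_ne_zero hz h0), hα, mul_div_cancel₀ _ h0]

/-- Near a zero of order `n` a meromorphic function takes every small nonzero value exactly `n`
times; near any other point it does not take small nonzero values. -/
theorem MeromorphicAt.exists_encard_preimage_eq {F : ℂ → ℂ} {z₀ : ℂ} (hF : MeromorphicAt F z₀)
    (hord : meromorphicOrderAt F z₀ ≠ ⊤) {O : Set ℂ} (hO : O ∈ 𝓝 z₀) :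
    ∃ W ⊆ O, IsOpen W ∧ z₀ ∈ W ∧ ∀ᶠ c in 𝓝[≠] (0 : ℂ),
      {z ∈ W | F z = c}.encard = (meromorphicOrderAt F z₀).untop₀.toNat := by
  -- The value of a meromorphic function at `z₀` itself is arbitrary and could produce a spurious
  -- solution; this rules it out for small `c ≠ 0`.
  have hself : ∀ᶠ c in 𝓝[≠] (0 : ℂ), F z₀ ≠ c := by
    by_cases h : F z₀ = 0
    · filter_upwards [self_mem_nhdsWithin] with c hc
      rw [h]; exact fun h' => hc h'.symm
    · exact nhdsWithin_le_nhds ((continuousAt_id.eventually_ne (Ne.symm h)).mono fun c hc => hc.symm)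
  -- At a pole, or where the order is zero, `‖F‖` is bounded below on a punctured neighbourhood, so
  -- small values are not taken there.
  rcases le_or_gt (meromorphicOrderAt F z₀) 0 with h | h
  · have h2 : (meromorphicOrderAt F z₀).untop₀.toNat = 0 := by
      lift meromorphicOrderAt F z₀ to ℤ using hord with m
      simpa using h
    obtain ⟨ε, hε, hb⟩ : ∃ ε > 0, ∀ᶠ z in 𝓝[≠] z₀, ε ≤ ‖F z‖ := by
      rcases h.lt_or_eq with h | h
      · refine ⟨1, one_pos, ?_⟩
        have := tendsto_norm_atTop_iff_cobounded.2 (tendsto_cobounded_of_meromorphicOrderAt_neg h)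
        exact this.eventually_ge_atTop 1
      · obtain ⟨c, hc, hlim⟩ := tendsto_ne_zero_of_meromorphicOrderAt_eq_zero hF h
        refine ⟨‖c‖ / 2, by positivity, ?_⟩
        exact hlim.norm.eventually_const_le (half_lt_self (norm_pos_iff.2 hc))
    obtain ⟨W, hW, hWo, hz⟩ := eventually_nhds_iff.1
      ((eventually_nhdsWithin_iff.1 hb).and (eventually_mem_set.2 hO))
    refine ⟨W, fun z hz => (hW z hz).2, hWo, hz, ?_⟩
    filter_upwards [hself, nhdsWithin_le_nhds (Metric.ball_mem_nhds (0 : ℂ) hε)] with c hc hc2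
    rw [h2, Nat.cast_zero, Set.encard_eq_zero, Set.eq_empty_iff_forall_notMem]
    rintro z ⟨hzW, rfl⟩
    have hne : z ≠ z₀ := by rintro rfl; exact hc rfl
    have := (hW z hzW).1 hne
    simp at hc2
    linarith
  · obtain ⟨g, hg, hg0, hgF⟩ := (meromorphicOrderAt_ne_top_iff hF).1 hord
    obtain ⟨n, hn, hn0⟩ : ∃ n : ℕ, (meromorphicOrderAt F z₀).untop₀ = n ∧ n ≠ 0 := by
      lift meromorphicOrderAt F z₀ to ℤ using hord with m
      have h' : 0 < m := by exact_mod_cast h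
      exact ⟨m.toNat, by simp; omega, by omega⟩
    rw [hn] at hgF ⊢
    obtain ⟨r, hr, hr0, hrn⟩ := hg.exists_pow_eq hg0 hn0
    -- In the local coordinate `u` the function becomes `u ^ n`, so the solutions of `F = c` are the
    -- `n` roots of `w ^ n = c` pulled back by the inverse of `u`.
    set u : ℂ → ℂ := fun z => (z - z₀) * r z with hu
    have hu0 : u z₀ = 0 := by simp [hu]
    have hua : AnalyticAt ℂ u z₀ := (analyticAt_id.sub analyticAt_const).mul hr
    have hud : HasStrictDerivAt u (r z₀) z₀ := by
      have h1 : HasStrictDerivAt u (1 * r z₀ + (z₀ - z₀) * deriv r z₀) z₀ :=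
        HasStrictDerivAt.mul ((hasStrictDerivAt_id z₀).sub_const z₀) hr.hasStrictDerivAt
      rwa [one_mul, sub_self, zero_mul, add_zero] at h1
    have huf := hud.hasStrictFDerivAt_equiv hr0
    set e := huf.toOpenPartialHomeomorph u with he
    have hesrc : z₀ ∈ e.source := huf.mem_toOpenPartialHomeomorph_source
    have heu : ∀ z, e z = u z := fun z => rfl
    have hFu : ∀ᶠ z in 𝓝 z₀, z ≠ z₀ → F z = u z ^ n := by
      refine eventually_nhdsWithin_iff.1 (?_ : ∀ᶠ z in 𝓝[≠] z₀, F z = u z ^ n)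
      filter_upwards [hgF, nhdsWithin_le_nhds hrn] with z hz hz2
      rw [hz, hu, mul_pow, hz2]
      simp
    have h0t : (0 : ℂ) ∈ e.target := by
      have := e.map_source hesrc
      rwa [heu, hu0] at this
    have hsymm0 : e.symm 0 = z₀ := by
      rw [← hu0, ← heu, e.left_inv hesrc]
    have hpre : ∀ᶠ w in 𝓝 (0 : ℂ), w ∈ e.target ∧ e.symm w ∈ O ∧
        (e.symm w ≠ z₀ → F (e.symm w) = u (e.symm w) ^ n) := by
      have hc : Tendsto e.symm (𝓝 0) (𝓝 z₀) := by
        have := e.continuousAt_symm h0t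
        rwa [ContinuousAt, hsymm0] at this
      exact (eventually_mem_set.2 (e.open_target.mem_nhds h0t)).and ((hc.eventually hO).and (hc.eventually hFu))
    obtain ⟨ρ, hρ, hball⟩ := Metric.eventually_nhds_iff_ball.1 hpre
    refine ⟨e.source ∩ e ⁻¹' Metric.ball 0 ρ, ?_, ?_, ⟨hesrc, ?_⟩, ?_⟩
    · rintro z ⟨hz, hzb⟩
      have := (hball _ hzb).2.1
      rwa [e.left_inv hz] at this
    · exact e.isOpen_inter_preimage Metric.isOpen_ball
    · simp [heu, hu0, hρ]
    -- The bound `ρ ^ n` on `c` puts all `n`-th roots of `c` in the ball of radius `ρ`, where the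
    -- inverse of `u` is under control.
    · have hρn : 0 < ρ ^ n := by positivity
      filter_upwards [hself, self_mem_nhdsWithin,
        nhdsWithin_le_nhds (Metric.ball_mem_nhds (0 : ℂ) hρn)] with c hc hc0 hcρ
      have hc0 : c ≠ 0 := hc0
      have hset : {z ∈ e.source ∩ e ⁻¹' Metric.ball 0 ρ | F z = c} =
          e.symm '' {w : ℂ | w ^ n = c} := by
        have hsmall : ∀ w : ℂ, w ^ n = c → w ∈ Metric.ball (0 : ℂ) ρ := by
          rintro w rfl
          simp only [mem_ball_zero_iff, norm_pow] at hcρ ⊢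
          exact lt_of_pow_lt_pow_left₀ n hρ.le hcρ
        ext z
        constructor
        · rintro ⟨⟨hz, hzb⟩, hzc⟩
          have hne : z ≠ z₀ := by rintro rfl; exact hc hzc
          have := (hball _ hzb).2.2
          rw [e.left_inv hz] at this
          exact ⟨e z, by rw [mem_ofPred_eq, heu, ← this hne, hzc], e.left_inv hz⟩
        · rintro ⟨w, hw, rfl⟩
          obtain ⟨hwt, -, hwF⟩ := hball w (hsmall w hw)
          have hw' : u (e.symm w) = w := e.right_inv hwt
          have hne : e.symm w ≠ z₀ := by
            intro h'
            rw [h', hu0] at hw'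
            rw [mem_ofPred_eq, ← hw', zero_pow hn0] at hw
            exact hc0 hw.symm
          refine ⟨⟨e.map_target hwt, ?_⟩, ?_⟩
          · rw [mem_preimage, e.right_inv hwt]; exact hsmall w hw
          · rw [hwF hne, hw']; exact hw
      rw [hset, Set.InjOn.encard_image, encard_setOf_pow_eq hn0 hc0]
      · simp
      · refine e.symm.injOn.mono fun w hw => (hball w ?_).1
        rw [← hw] at hcρ
        simp only [mem_ball_zero_iff, norm_pow] at hcρ ⊢
        exact lt_of_pow_lt_pow_left₀ n hρ.le hcρ

/-! ## Isolated points -/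

/-- If near every point `P` either holds or fails on a punctured neighbourhood, then on a connected
space without isolated points one of the two alternatives holds everywhere. -/
theorem forall_eventually_or_forall_eventually_not {Y : Type*} [TopologicalSpace Y] [T1Space Y]
    [PreconnectedSpace Y] [∀ y : Y, (𝓝[≠] y).NeBot] {P : Y → Prop}
    (h : ∀ x, (∀ᶠ y in 𝓝[≠] x, P y) ∨ ∀ᶠ y in 𝓝[≠] x, ¬ P y) :
    (∀ x, ∀ᶠ y in 𝓝[≠] x, P y) ∨ ∀ x, ∀ᶠ y in 𝓝[≠] x, ¬ P y := by
  have hopen : ∀ Q : Y → Prop, IsOpen {x | ∀ᶠ y in 𝓝[≠] x, Q y} := by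
    intro Q
    rw [isOpen_iff_mem_nhds]
    intro x hx
    have h1 := eventually_eventually_nhdsWithin.2 hx
    rw [eventually_nhdsWithin_iff] at h1
    filter_upwards [h1] with y hy
    by_cases hyx : y = x
    · rw [hyx]; exact hx
    · have h2 := hy hyx
      have : 𝓝[≠] y ≤ 𝓝[≠] x ⊔ 𝓝 y := le_trans nhdsWithin_le_nhds le_sup_right
      -- For `y ≠ x` the punctured neighbourhood of `x` is, by the T1 property, a full neighbourhood
      -- of `y`.
      have h3 : 𝓝[≠] y ≤ 𝓝[{x}ᶜ] y := by
        rw [nhdsWithin_eq_nhds.2 (isOpen_compl_singleton.mem_nhds hyx)]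
        exact nhdsWithin_le_nhds
      exact h3 h2
  have hcompl : {x | ∀ᶠ y in 𝓝[≠] x, P y}ᶜ = {x | ∀ᶠ y in 𝓝[≠] x, ¬ P y} := by
    ext x
    refine ⟨fun hx => (h x).resolve_left hx, fun hx hx' => ?_⟩
    obtain ⟨y, hy1, hy2⟩ := ((show ∀ᶠ y in 𝓝[≠] x, ¬ P y from hx).and hx').exists
    exact hy1 hy2
  have hclopen : IsClopen {x | ∀ᶠ y in 𝓝[≠] x, P y} :=
    ⟨⟨by rw [hcompl]; exact hopen _⟩, hopen _⟩
  rcases isClopen_iff.1 hclopen with h0 | h0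
  · right
    intro x
    have : x ∈ {x | ∀ᶠ y in 𝓝[≠] x, P y}ᶜ := by rw [h0]; simp
    rwa [hcompl] at this
  · left
    intro x
    have : x ∈ {x | ∀ᶠ y in 𝓝[≠] x, P y} := by rw [h0]; trivial
    exact this

/-- An infinite subset of a compact space has an accumulation point. The finiteness of divisors and
of the fixed point set is deduced from this. -/
theorem Set.Finite.of_eventually_notMem {Y : Type*} [TopologicalSpace Y] [CompactSpace Y]
    {S : Set Y} (h : ∀ x, ∀ᶠ y in 𝓝[≠] x, y ∉ S) : S.Finite := by
  by_contra hS
  obtain ⟨x, hx⟩ := Set.Infinite.exists_accPt_principal hS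
  rw [accPt_iff_frequently_nhdsNE] at hx
  exact hx (h x)

end

noncomputable section
variable {X : Type u} [TopologicalSpace X] [ChartedSpace ℂ X]

open Filter Set

/-! ## Meromorphic functions on a Riemann surface -/

theorem OpenPartialHomeomorph.eventually_nhdsNE_iff {Y Z : Type*} [TopologicalSpace Y]
    [TopologicalSpace Z] (e : OpenPartialHomeomorph Y Z) {x : Y} (hx : x ∈ e.source)
    {P : Y → Prop} : (∀ᶠ y in 𝓝[≠] x, P y) ↔ ∀ᶠ z in 𝓝[≠] (e x), P (e.symm z) := by
  rw [eventually_nhdsWithin_iff, eventually_nhdsWithin_iff, ← e.map_nhds_eq hx, eventually_map]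
  refine eventually_congr ?_
  filter_upwards [e.open_source.mem_nhds hx] with y hy
  rw [e.left_inv hy, mem_compl_singleton_iff, mem_compl_singleton_iff, Ne, Ne,
    e.injOn.eq_iff hy hx]

theorem eventually_nhdsNE_chartAt_iff {x : X} {P : X → Prop} :
    (∀ᶠ y in 𝓝[≠] x, P y) ↔ ∀ᶠ z in 𝓝[≠] (chartAt ℂ x x), P ((chartAt ℂ x).symm z) :=
  (chartAt ℂ x).eventually_nhdsNE_iff (mem_chart_source ℂ x)

instance nhdsNE_neBot_of_chartedSpace_complex (x : X) : (𝓝[≠] x).NeBot := by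
  rw [neBot_iff]
  intro h
  have h1 : ∀ᶠ _ in 𝓝[≠] x, False := by rw [h]; trivial
  rw [eventually_nhdsNE_chartAt_iff] at h1
  exact h1.exists.elim fun _ => id

/-- The right-hand side does not mention `x`, so analyticity can be carried from the chart centred
at `x` to the chart centred at a nearby `y`. -/
theorem analyticAt_comp_chartAt_symm_iff [IsManifold 𝓘(ℂ, ℂ) ω X] {F : Type*}
    [NormedAddCommGroup F] [NormedSpace ℂ F] [CompleteSpace F] {g : X → F} {x y : X}
    (hy : y ∈ (chartAt ℂ x).source) :
    AnalyticAt ℂ (g ∘ (chartAt ℂ x).symm) (chartAt ℂ x y) ↔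
      ContMDiffAt 𝓘(ℂ, ℂ) 𝓘(ℂ, F) ω g y := by
  rw [contMDiffAt_iff_source_of_mem_source hy]
  simp only [mfld_simps, contMDiffWithinAt_univ, contMDiffAt_iff_contDiffAt]
  exact ⟨fun h => h.contDiffAt, fun h => h.analyticAt⟩

/-- The order of a function on a Riemann surface at a point, computed in the preferred chart. -/
def chartOrder (g : X → ℂ) (x : X) : WithTop ℤ :=
  meromorphicOrderAt (g ∘ (chartAt ℂ x).symm) (chartAt ℂ x x)

/-- A function on a Riemann surface (with arbitrary values at its poles) that is meromorphic. -/
def IsMeromorphicFunction (g : X → ℂ) : Prop :=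
  ∀ x, MeromorphicAt (g ∘ (chartAt ℂ x).symm) (chartAt ℂ x x)

namespace IsMeromorphicFunction

variable {g : X → ℂ}

theorem sub_const (hg : IsMeromorphicFunction g) (c : ℂ) :
    IsMeromorphicFunction fun x => g x - c :=
  fun x => (hg x).sub (MeromorphicAt.const c _)

theorem inv (hg : IsMeromorphicFunction g) : IsMeromorphicFunction fun x => (g x)⁻¹ :=
  fun x => (hg x).inv

theorem chartOrder_eq_top_iff {x : X} : chartOrder g x = ⊤ ↔ ∀ᶠ y in 𝓝[≠] x, g y = 0 := by
  rw [eventually_nhdsNE_chartAt_iff, chartOrder, meromorphicOrderAt_eq_top_iff]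
  rfl

theorem chartOrder_ne_top_iff (hg : IsMeromorphicFunction g) {x : X} :
    chartOrder g x ≠ ⊤ ↔ ∀ᶠ y in 𝓝[≠] x, g y ≠ 0 := by
  rw [eventually_nhdsNE_chartAt_iff, chartOrder,
    meromorphicOrderAt_ne_top_iff_eventually_ne_zero (hg x)]
  rfl

theorem chartOrder_inv {x : X} : chartOrder (fun y => (g y)⁻¹) x = -chartOrder g x :=
  meromorphicOrderAt_inv

/-- Near `x` the function is analytic and nonzero off `x`. The order at `y` is computed in the chart
of `y` rather than that of `x`, so analyticity passes through the chart-free `ContMDiffAt`. -/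
theorem eventually_chartOrder_eq_zero [IsManifold 𝓘(ℂ, ℂ) ω X] (hg : IsMeromorphicFunction g)
    {x : X} (hx : chartOrder g x ≠ ⊤) : ∀ᶠ y in 𝓝[≠] x, chartOrder g y = 0 := by
  have h1 := (hg.chartOrder_ne_top_iff).1 hx
  have h2 : ∀ᶠ y in 𝓝[≠] x, ContMDiffAt 𝓘(ℂ, ℂ) 𝓘(ℂ, ℂ) ω g y := by
    rw [eventually_nhdsNE_chartAt_iff]
    filter_upwards [(hg x).eventually_analyticAt, nhdsWithin_le_nhds
      ((chartAt ℂ x).open_target.mem_nhds (mem_chart_target ℂ x))] with z hz hzt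
    rw [← analyticAt_comp_chartAt_symm_iff ((chartAt ℂ x).map_target hzt),
      (chartAt ℂ x).right_inv hzt]
    exact hz
  filter_upwards [h1, h2] with y hy1 hy2
  have h3 := (analyticAt_comp_chartAt_symm_iff (mem_chart_source ℂ y)).2 hy2
  rw [chartOrder, h3.meromorphicOrderAt_eq, h3.analyticOrderAt_eq_zero.2]
  · rfl
  · simpa [(chartAt ℂ y).left_inv (mem_chart_source ℂ y)] using hy1

variable [IsManifold 𝓘(ℂ, ℂ) ω X] [CompactSpace X]

theorem finite_setOf_chartOrder_ne_zero (hg : IsMeromorphicFunction g)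
    (hord : ∀ x, chartOrder g x ≠ ⊤) : {x | chartOrder g x ≠ 0}.Finite :=
  Set.Finite.of_eventually_notMem fun x =>
    (hg.eventually_chartOrder_eq_zero (hord x)).mono fun _ hy hy2 => hy2 hy

variable [T2Space X]

/-- The number of zeros of a meromorphic function, counted with multiplicity. -/
def _root_.zeroCount (g : X → ℂ) : ℕ := ∑ᶠ x, (chartOrder g x).untop₀.toNat

/-- A meromorphic function takes every small nonzero value as often as it has zeros. -/
theorem eventually_encard_preimage_eq (hg : IsMeromorphicFunction g)
    (hord : ∀ x, chartOrder g x ≠ ⊤) :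
    ∀ᶠ c in 𝓝[≠] (0 : ℂ), {x | g x = c}.encard = zeroCount g := by
  set n : X → ℕ := fun x => (chartOrder g x).untop₀.toNat with hn
  set T : Set X := {x | n x ≠ 0} with hT
  have hTfin : T.Finite := by
    refine (hg.finite_setOf_chartOrder_ne_zero hord).subset fun x hx hx0 => hx ?_
    simp [hn, hx0]
  obtain ⟨U, hU, hUdisj⟩ := hTfin.t2_separation
  -- The local count in a chart, transported to the surface; being able to shrink into `O` is what
  -- later makes the neighbourhoods of distinct zeros disjoint.
  have hloc : ∀ x, ∀ O ∈ 𝓝 x, ∃ W ⊆ O, IsOpen W ∧ x ∈ W ∧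
      ∀ᶠ c in 𝓝[≠] (0 : ℂ), {y ∈ W | g y = c}.encard = n x := by
    intro x O hO
    set e := chartAt ℂ x with he
    have hxs : x ∈ e.source := mem_chart_source ℂ x
    have hO' : e.target ∩ e.symm ⁻¹' O ∈ 𝓝 (e x) := by
      refine inter_mem (e.open_target.mem_nhds (e.map_source hxs)) ?_
      refine (e.continuousAt_symm (e.map_source hxs)).preimage_mem_nhds ?_
      rwa [e.left_inv hxs]
    obtain ⟨W, hWO, hWo, hxW, hW⟩ := (hg x).exists_encard_preimage_eq (hord x) hO'
    refine ⟨e.source ∩ e ⁻¹' W, ?_, e.isOpen_inter_preimage hWo, ⟨hxs, hxW⟩, ?_⟩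
    · rintro y ⟨hy, hyW⟩
      have := (hWO hyW).2
      rwa [mem_preimage, e.left_inv hy] at this
    · filter_upwards [hW] with c hc
      refine Eq.trans ?_ hc
      have : {y ∈ e.source ∩ e ⁻¹' W | g y = c} =
          e.symm '' {z ∈ W | (g ∘ (chartAt ℂ x).symm) z = c} := by
        ext y
        constructor
        · rintro ⟨⟨hy, hyW⟩, hyc⟩
          exact ⟨e y, ⟨hyW, by rw [Function.comp_apply, ← he, e.left_inv hy, hyc]⟩, e.left_inv hy⟩
        · rintro ⟨z, ⟨hz, hzc⟩, rfl⟩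
          have hzt := (hWO hz).1
          exact ⟨⟨e.map_target hzt, by rwa [mem_preimage, e.right_inv hzt]⟩, hzc⟩
      rw [this, InjOn.encard_image]
      exact e.symm.injOn.mono fun z hz => (hWO hz.1).1
  choose! W hWU hWo hxW hW using fun x => hloc x (U x) ((hU x).2.mem_nhds (hU x).1)
  obtain ⟨t, ht⟩ := isCompact_univ.elim_nhds_subcover W fun x _ => (hWo x).mem_nhds (hxW x)
  -- Finitely many local counts hold simultaneously: the members of `t` cover the surface, and those
  -- of `T` carry the zeros.
  have hev : ∀ᶠ c in 𝓝[≠] (0 : ℂ), ∀ x ∈ (t : Set X) ∪ T, {y ∈ W x | g y = c}.encard = n x :=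
    (eventually_all_finite (t.finite_toSet.union hTfin)).2 fun x _ => hW x
  filter_upwards [hev] with c hc
  have hset : {x | g x = c} = ⋃ x ∈ T, {y ∈ W x | g y = c} := by
    ext y
    simp only [mem_iUnion]
    constructor
    · intro hy
      obtain ⟨x, hxt, hyx⟩ := mem_iUnion₂.1 (ht.2 (mem_univ y))
      refine ⟨x, ?_, hyx, hy⟩
      -- A covering set around a point that is not a zero contains no solution, so only the disjoint
      -- sets around `T` contribute.
      intro hx0
      have := hc x (Or.inl hxt)
      rw [hx0, Nat.cast_zero, encard_eq_zero] at this
      exact (this ▸ (⟨hyx, hy⟩ : y ∈ {y ∈ W x | g y = c}) : y ∈ (∅ : Set X))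
    · rintro ⟨x, -, -, hy⟩
      exact hy
  have hdisj : T.PairwiseDisjoint fun x => {y ∈ W x | g y = c} :=
    fun x hx y hy hxy => (hUdisj hx hy hxy).mono (fun z hz => hWU x hz.1) fun z hz => hWU y hz.1
  rw [hset, hTfin.encard_biUnion hdisj, finsum_mem_congr rfl fun x hx => hc x (Or.inr hx),
    ← Nat.cast_finsum_mem hTfin, zeroCount]
  congr 1
  exact finsum_mem_support n

/-- The degree of the divisor of a meromorphic function on a compact Riemann surface is zero. -/
theorem finsum_chartOrder_eq_zero [ConnectedSpace X] (hg : IsMeromorphicFunction g)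
    (hord : ∀ x, chartOrder g x ≠ ⊤) : ∑ᶠ x, (chartOrder g x).untop₀ = 0 := by
  -- In the degenerate case `g` equals a nonzero constant off a discrete set and all orders vanish.
  -- Otherwise every `g - c₀` has finite order everywhere, and the count applies around every value.
  by_cases hconst : ∃ c, ∃ x, chartOrder (fun y => g y - c) x = ⊤
  · obtain ⟨c, x, hx⟩ := hconst
    have hdich := forall_eventually_or_forall_eventually_not (P := fun y => g y - c = 0) fun y => by
      by_cases hy : chartOrder (fun y => g y - c) y = ⊤
      · exact Or.inl (chartOrder_eq_top_iff.1 hy)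
      · exact Or.inr ((hg.sub_const c).chartOrder_ne_top_iff.1 hy)
    have hall : ∀ y, ∀ᶠ z in 𝓝[≠] y, g z - c = 0 := by
      refine hdich.resolve_right fun h => ?_
      exact ((hg.sub_const c).chartOrder_ne_top_iff.2 (h x)) hx
    have hc : c ≠ 0 := by
      rintro rfl
      refine hord x (chartOrder_eq_top_iff.2 ((hall x).mono fun z hz => by simpa using hz))
    have : ∀ y, (chartOrder g y).untop₀ = 0 := by
      intro y
      have h1 : chartOrder g y = chartOrder (fun _ => c) y := by
        refine meromorphicOrderAt_congr ?_
        refine (eventually_nhdsNE_chartAt_iff.1 (hall y)).mono fun z hz => ?_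
        exact sub_eq_zero.1 hz
      have h2 : chartOrder (fun _ : X => c) y = 0 := by
        have := meromorphicOrderAt_const (𝕜 := ℂ) (chartAt ℂ y y) c
        rw [if_neg hc] at this
        exact this
      rw [h1, h2]
      rfl
    simp [this]
  · push Not at hconst
    have hM : ∀ c₀, ∀ᶠ c in 𝓝[≠] c₀, {x | g x = c}.encard = zeroCount fun x => g x - c₀ := by
      intro c₀
      have h1 := (hg.sub_const c₀).eventually_encard_preimage_eq (hconst c₀)
      have h2 : Tendsto (fun c => c - c₀) (𝓝[≠] c₀) (𝓝[≠] (0 : ℂ)) := by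
        refine tendsto_nhdsWithin_iff.2 ⟨?_, ?_⟩
        · have : Tendsto (fun c => c - c₀) (𝓝 c₀) (𝓝 (c₀ - c₀)) := tendsto_id.sub_const c₀
          rw [sub_self] at this
          exact this.mono_left nhdsWithin_le_nhds
        · filter_upwards [self_mem_nhdsWithin] with c hc
          exact sub_ne_zero.2 hc
      filter_upwards [h2.eventually h1] with c hc
      simpa [sub_left_inj] using hc
    -- For `c` near `c₀`, both zero counts equal the number of solutions of `g = c'` for a suitable
    -- `c'` close to `c`, so they agree.
    have hlc : IsLocallyConstant fun c₀ => zeroCount fun x => g x - c₀ := by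
      rw [IsLocallyConstant.iff_eventually_eq]
      intro c₀
      have h1 := eventually_eventually_nhdsWithin.2 (hM c₀)
      rw [eventually_nhdsWithin_iff] at h1
      filter_upwards [h1] with c hc
      by_cases hcc : c = c₀
      · rw [hcc]
      · have h2 : ∀ᶠ c' in 𝓝[≠] c, {x | g x = c'}.encard = zeroCount fun x => g x - c₀ := by
          have h3 := hc hcc
          rw [nhdsWithin_eq_nhds.2 (isOpen_compl_singleton.mem_nhds hcc)] at h3
          exact nhdsWithin_le_nhds h3
        obtain ⟨c', h3, h4⟩ := ((hM c).and h2).exists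
        exact_mod_cast h3.symm.trans h4
    -- The count for `1 / g` near `0`: for large values `c`, the number of solutions of `g = c` is
    -- the number of poles of `g`.
    have hinv := hg.inv.eventually_encard_preimage_eq fun x => by
      rw [chartOrder_inv]
      have := hord x
      lift chartOrder g x to ℤ using this with m
      exact WithTop.coe_ne_top
    obtain ⟨ε, hε, hεb⟩ := Metric.eventually_nhds_iff_ball.1 (eventually_nhdsWithin_iff.1 hinv)
    have hpole : zeroCount (fun x => (g x)⁻¹) = zeroCount g := by
      -- The inverse of `c₁` lies inside the disc of radius `ε` on which the count for `1 / g` is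
      -- valid. A generic `c` near `c₁` is counted in both ways, and connectedness of `ℂ` takes `c₁`
      -- to `0`.
      set c₁ : ℂ := ((ε / 2 : ℝ) : ℂ)⁻¹ with hc₁
      have hc₁0 : c₁ ≠ 0 := by
        rw [hc₁]
        exact inv_ne_zero (Complex.ofReal_ne_zero.2 (by positivity))
      have h1 : ∀ᶠ c in 𝓝 c₁, c ≠ 0 ∧ c⁻¹ ∈ Metric.ball (0 : ℂ) ε := by
        refine (continuousAt_id.eventually_ne hc₁0).and ?_
        refine eventually_mem_set.2 ((continuousAt_inv₀ hc₁0).preimage_mem_nhds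
          (Metric.isOpen_ball.mem_nhds ?_))
        rw [hc₁, inv_inv, mem_ball_zero_iff, Complex.norm_real, Real.norm_of_nonneg (by positivity)]
        exact half_lt_self hε
      obtain ⟨c, hc, hc0, hcε⟩ := ((hM c₁).and (nhdsWithin_le_nhds h1)).exists
      have h2 := hεb _ hcε (inv_ne_zero hc0)
      have h3 : {x | (g x)⁻¹ = c⁻¹} = {x | g x = c} := by
        ext x
        exact inv_inj
      rw [h3, hc] at h2
      have h4 := hlc.apply_eq_of_preconnectedSpace c₁ 0
      simp only [sub_zero] at h4
      rw [← h4]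
      exact_mod_cast h2.symm
    have hfin : (Function.support fun x => (chartOrder g x).untop₀).Finite :=
      (hg.finite_setOf_chartOrder_ne_zero hord).subset fun x hx hx0 => hx (by simp [hx0])
    -- An integer is its positive part minus the positive part of its negative, here zeros minus
    -- poles.
    have hsum : ∑ᶠ x, (chartOrder g x).untop₀ =
        (zeroCount g : ℤ) - zeroCount fun x => (g x)⁻¹ := by
      have hf1 : (Function.support fun x => (chartOrder g x).untop₀.toNat).Finite :=
        hfin.subset fun x hx hx0 => hx (by simp only [hx0, Int.toNat_zero])
      have hf2 : (Function.support fun x => (chartOrder (fun y => (g y)⁻¹) x).untop₀.toNat).Finite :=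
        hfin.subset fun x hx hx0 => hx (by
          simp only [chartOrder_inv, WithTop.untop₀_neg, hx0, neg_zero, Int.toNat_zero])
      have hcast : ∀ k : X → ℕ, ((∑ᶠ x, k x : ℕ) : ℤ) = ∑ᶠ x, (k x : ℤ) :=
        (Nat.castAddMonoidHom ℤ).map_finsum_of_injective Nat.cast_injective
      rw [zeroCount, zeroCount, hcast, hcast,
        ← finsum_sub_distrib (hf1.subset fun x hx hx0 => hx (by simp [hx0]))
          (hf2.subset fun x hx hx0 => hx (by simp [hx0]))]
      refine finsum_congr fun x => ?_
      rw [chartOrder_inv, WithTop.untop₀_neg]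
      omega
    rw [hsum, hpole, sub_self]

end IsMeromorphicFunction

end

noncomputable section
variable {X : Type u} [TopologicalSpace X] [ChartedSpace ℂ X]

open Filter Set

/-! ## Sections in local trivializations -/

namespace HolomorphicBundle

variable {r r₂ : ℕ} (V : HolomorphicBundle.{u, v} X r) (W : HolomorphicBundle.{u, v} X r₂)

/-- The domain of the preferred trivialization of `V` at `x₀`. -/
def trivDomain (x₀ : X) : Set X := (trivializationAt (Fin r → ℂ) V.fiber x₀).baseSet

/-- The coordinates of vectors of `V` in the preferred trivialization at `x₀`. -/
def coord (x₀ y : X) : V.fiber y →ₗ[ℂ] (Fin r → ℂ) :=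
  (trivializationAt (Fin r → ℂ) V.fiber x₀).linearMapAt ℂ y

/-- The vector of `V` with given coordinates in the preferred trivialization at `x₀`. -/
def ofCoord (x₀ y : X) : (Fin r → ℂ) →ₗ[ℂ] V.fiber y :=
  (trivializationAt (Fin r → ℂ) V.fiber x₀).symmₗ ℂ y

variable {V W} {x₀ y : X}

theorem isOpen_trivDomain : IsOpen (V.trivDomain x₀) :=
  (trivializationAt (Fin r → ℂ) V.fiber x₀).open_baseSet

theorem mem_trivDomain_self : x₀ ∈ V.trivDomain x₀ :=
  FiberBundle.mem_baseSet_trivializationAt' x₀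

theorem trivDomain_mem_nhds : V.trivDomain x₀ ∈ 𝓝 x₀ :=
  isOpen_trivDomain.mem_nhds mem_trivDomain_self

theorem coord_ofCoord (hy : y ∈ V.trivDomain x₀) (a : Fin r → ℂ) :
    V.coord x₀ y (V.ofCoord x₀ y a) = a :=
  (trivializationAt (Fin r → ℂ) V.fiber x₀).linearMapAt_symmₗ hy a

theorem ofCoord_coord (hy : y ∈ V.trivDomain x₀) (e : V.fiber y) :
    V.ofCoord x₀ y (V.coord x₀ y e) = e :=
  (trivializationAt (Fin r → ℂ) V.fiber x₀).symmₗ_linearMapAt hy e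

variable (V) in
/-- The fibre coordinates as a linear equivalence. -/
def coordEquiv (hy : y ∈ V.trivDomain x₀) : V.fiber y ≃ₗ[ℂ] (Fin r → ℂ) :=
  LinearEquiv.ofLinearMap (V.coord x₀ y) (V.ofCoord x₀ y) (LinearMap.ext (coord_ofCoord hy))
    (LinearMap.ext (ofCoord_coord hy))

theorem coord_injective (hy : y ∈ V.trivDomain x₀) : Function.Injective (V.coord x₀ y) :=
  (V.coordEquiv hy).injective

theorem coord_ne_zero (hy : y ∈ V.trivDomain x₀) {e : V.fiber y} (he : e ≠ 0) :
    V.coord x₀ y e ≠ 0 :=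
  (V.coordEquiv hy).map_ne_zero_iff.2 he

theorem ofCoord_ne_zero (hy : y ∈ V.trivDomain x₀) {a : Fin r → ℂ} (ha : a ≠ 0) :
    V.ofCoord x₀ y a ≠ 0 :=
  (V.coordEquiv hy).symm.map_ne_zero_iff.2 ha

instance finiteDimensional_fiber (y : X) : FiniteDimensional ℂ (V.fiber y) :=
  (V.coordEquiv (mem_trivDomain_self (x₀ := y))).symm.finiteDimensional

theorem finrank_fiber (y : X) : Module.finrank ℂ (V.fiber y) = r := by
  rw [(V.coordEquiv (mem_trivDomain_self (x₀ := y))).finrank_eq, Module.finrank_fin_fun]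

/-- The point `y` need not be the centre `x₀`, and the left-hand side does not involve `x₀`; applied
twice, this changes the trivialization. -/
theorem contMDiffAt_iff_coord {s : ∀ x, V.fiber x} (hy : y ∈ V.trivDomain x₀) :
    ContMDiffAt 𝓘(ℂ, ℂ) (𝓘(ℂ, ℂ).prod 𝓘(ℂ, Fin r → ℂ)) ω
      (fun x => TotalSpace.mk' (Fin r → ℂ) x (s x)) y ↔
    ContMDiffAt 𝓘(ℂ, ℂ) 𝓘(ℂ, Fin r → ℂ) ω (fun x => V.coord x₀ x (s x)) y := by
  rw [(trivializationAt (Fin r → ℂ) V.fiber x₀).contMDiffAt_section_iff hy]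
  refine EventuallyEq.contMDiffAt_iff ?_
  filter_upwards [isOpen_trivDomain.mem_nhds hy] with x hx
  exact (congrFun ((trivializationAt (Fin r → ℂ) V.fiber x₀).coe_linearMapAt_of_mem (R := ℂ) hx)
    (s x)).symm

theorem IsHolomorphicSection.contMDiffAt_coord {s : ∀ x, V.fiber x} {U : Set X}
    (hs : V.IsHolomorphicSection s U) (hU : IsOpen U) (hyU : y ∈ U) (hy : y ∈ V.trivDomain x₀) :
    ContMDiffAt 𝓘(ℂ, ℂ) 𝓘(ℂ, Fin r → ℂ) ω (fun x => V.coord x₀ x (s x)) y :=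
  (contMDiffAt_iff_coord hy).1 ((hs y hyU).contMDiffAt (hU.mem_nhds hyU))

theorem isHolomorphicSection_of_coord {s : ∀ x, V.fiber x} {U : Set X}
    (hUV : U ⊆ V.trivDomain x₀)
    (h : ∀ y ∈ U, ContMDiffAt 𝓘(ℂ, ℂ) 𝓘(ℂ, Fin r → ℂ) ω (fun x => V.coord x₀ x (s x)) y) :
    V.IsHolomorphicSection s U :=
  fun y hy => ((contMDiffAt_iff_coord (hUV hy)).2 (h y hy)).contMDiffWithinAt

theorem isHolomorphicSection_ofCoord {a : X → Fin r → ℂ} {U : Set X} (hUV : U ⊆ V.trivDomain x₀)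
    (h : ∀ y ∈ U, ContMDiffAt 𝓘(ℂ, ℂ) 𝓘(ℂ, Fin r → ℂ) ω a y) :
    V.IsHolomorphicSection (fun x => V.ofCoord x₀ x (a x)) U := by
  refine isHolomorphicSection_of_coord hUV fun y hy => (h y hy).congr_of_eventuallyEq ?_
  filter_upwards [isOpen_trivDomain.mem_nhds (hUV hy)] with x hx
  exact coord_ofCoord hx (a x)

theorem isHolomorphicSection_ofCoord_const (x₀ : X) (a : Fin r → ℂ) :
    V.IsHolomorphicSection (fun x => V.ofCoord x₀ x a) (V.trivDomain x₀) :=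
  isHolomorphicSection_ofCoord subset_rfl fun _ _ => contMDiffAt_const

/-- Holomorphy of a bundle map is defined through sections; testing it on sections with constant
coordinates gives holomorphic matrix columns. -/
theorem IsHolomorphicMap.contMDiffAt_coord {φ : ∀ x, V.fiber x →ₗ[ℂ] W.fiber x}
    (hφ : V.IsHolomorphicMap W φ) (a : Fin r → ℂ) (hy : y ∈ V.trivDomain x₀) {x₁ : X}
    (hy₁ : y ∈ W.trivDomain x₁) :
    ContMDiffAt 𝓘(ℂ, ℂ) 𝓘(ℂ, Fin r₂ → ℂ) ω
      (fun x => W.coord x₁ x (φ x (V.ofCoord x₀ x a))) y :=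
  (hφ _ isOpen_trivDomain _ (isHolomorphicSection_ofCoord_const x₀ a)).contMDiffAt_coord
    isOpen_trivDomain hy hy₁

theorem eventually_chartAt_symm_mem_trivDomain (x₀ : X) : ∀ᶠ z in 𝓝 (chartAt ℂ x₀ x₀),
    z ∈ (chartAt ℂ x₀).target ∧ (chartAt ℂ x₀).symm z ∈ V.trivDomain x₀ := by
  refine (eventually_mem_set.2 (chart_target_mem_nhds ℂ x₀)).and (eventually_mem_set.2 ?_)
  refine ((chartAt ℂ x₀).continuousAt_symm (mem_chart_target ℂ x₀)).preimage_mem_nhds ?_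
  rw [(chartAt ℂ x₀).left_inv (mem_chart_source ℂ x₀)]
  exact trivDomain_mem_nhds

/-- A meromorphic section is holomorphic and without zeros near every point, except possibly at the
point itself. -/
theorem eventually_of_meromorphicAt_localExpr [IsManifold 𝓘(ℂ, ℂ) ω X] {s : ∀ x, V.fiber x}
    (hs : MeromorphicAt (V.localExpr s x₀) (chartAt ℂ x₀ x₀))
    (hord : meromorphicOrderAt (V.localExpr s x₀) (chartAt ℂ x₀ x₀) ≠ ⊤) :
    ∀ᶠ y in 𝓝[≠] x₀, s y ≠ 0 ∧
      meromorphicOrderAt (V.localExpr s y) (chartAt ℂ y y) = 0 := by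
  rw [eventually_nhdsNE_chartAt_iff]
  filter_upwards [hs.eventually_analyticAt, nhdsWithin_le_nhds (eventually_chartAt_symm_mem_trivDomain (V := V) x₀),
    (meromorphicOrderAt_ne_top_iff_eventually_ne_zero hs).1 hord] with z hz ⟨hzt, hzd⟩ hz0
  set y := (chartAt ℂ x₀).symm z with hy
  have hyx : chartAt ℂ x₀ y = z := (chartAt ℂ x₀).right_inv hzt
  have hsy : s y ≠ 0 := by
    intro h0
    refine hz0 ?_
    rw [localExpr, ← hy, h0, map_zero]
  refine ⟨hsy, ?_⟩
  have h1 : AnalyticAt ℂ ((fun x => V.coord x₀ x (s x)) ∘ (chartAt ℂ x₀).symm)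
      (chartAt ℂ x₀ y) := by rw [hyx]; exact hz
  rw [analyticAt_comp_chartAt_symm_iff ((chartAt ℂ x₀).map_target hzt),
    ← contMDiffAt_iff_coord hzd, contMDiffAt_iff_coord (mem_trivDomain_self (x₀ := y)),
    ← analyticAt_comp_chartAt_symm_iff (mem_chart_source ℂ y)] at h1
  have h2 : AnalyticAt ℂ (V.localExpr s y) (chartAt ℂ y y) := h1
  rw [h2.meromorphicOrderAt_eq, h2.analyticOrderAt_eq_zero.2]
  · rfl
  · show V.coord y _ (s _) ≠ 0
    rw [(chartAt ℂ y).left_inv (mem_chart_source ℂ y)]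
    exact coord_ne_zero mem_trivDomain_self hsy

end HolomorphicBundle

/-! ## Rank two -/

/-- The determinant of a pair of vectors of `ℂ²`. -/
def planeDet (a b : Fin 2 → ℂ) : ℂ := a 0 * b 1 - a 1 * b 0

theorem planeDet_self (a : Fin 2 → ℂ) : planeDet a a = 0 := by unfold planeDet; ring

theorem planeDet_add_right (a b c : Fin 2 → ℂ) : planeDet a (b + c) = planeDet a b + planeDet a c := by
  simp only [planeDet, Pi.add_apply]; ring

theorem planeDet_smul_right (a b : Fin 2 → ℂ) (t : ℂ) : planeDet a (t • b) = t * planeDet a b := by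
  simp only [planeDet, Pi.smul_apply, smul_eq_mul]; ring

theorem planeDet_smul_left (a b : Fin 2 → ℂ) (t : ℂ) : planeDet (t • a) b = t * planeDet a b := by
  simp only [planeDet, Pi.smul_apply, smul_eq_mul]; ring

theorem mem_span_of_planeDet_eq_zero {a b : Fin 2 → ℂ} (ha : a ≠ 0) (h : planeDet a b = 0) :
    ∃ t : ℂ, b = t • a := by
  unfold planeDet at h
  by_cases h0 : a 0 = 0
  · have h1 : a 1 ≠ 0 := fun h1 => ha (by ext i; fin_cases i <;> simpa)
    refine ⟨b 1 / a 1, ?_⟩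
    have hb : b 0 = 0 := by
      rw [h0, zero_mul, zero_sub, neg_eq_zero] at h
      exact (mul_eq_zero.1 h).resolve_left h1
    ext i; fin_cases i
    · simp [hb, h0]
    · simp [h1]
  · refine ⟨b 0 / a 0, ?_⟩
    ext i; fin_cases i
    · simp [h0]
    · simp; field_simp; linear_combination h

theorem exists_planeDet_ne_zero {a : Fin 2 → ℂ} (ha : a ≠ 0) : ∃ b, planeDet a b ≠ 0 := by
  by_cases h0 : a 0 = 0
  · have h1 : a 1 ≠ 0 := fun h1 => ha (by ext i; fin_cases i <;> simpa)
    exact ⟨![1, 0], by simpa [planeDet]⟩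
  · exact ⟨![0, 1], by simpa [planeDet]⟩

theorem exists_planeDet_eq {a : Fin 2 → ℂ} (ha : a ≠ 0) (c : ℂ) : ∃ b, planeDet a b = c := by
  obtain ⟨b, hb⟩ := exists_planeDet_ne_zero ha
  exact ⟨(c / planeDet a b) • b, by rw [planeDet_smul_right, div_mul_cancel₀ _ hb]⟩

namespace HolomorphicBundle

theorem detCoord_map_ιMulti {M : Type*} [AddCommGroup M] [Module ℂ M] (g : M →ₗ[ℂ] (Fin 2 → ℂ))
    (a b : M) : detCoord 2 (exteriorPower.map 2 g (exteriorPower.ιMulti ℂ 2 ![a, b])) =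
      planeDet (g a) (g b) := by
  rw [exteriorPower.map_apply_ιMulti, detCoord, exteriorPower.alternatingMapLinearEquiv_apply_ιMulti]
  show Matrix.det (Matrix.of (g ∘ ![a, b])) = _
  rw [Matrix.det_fin_two]
  simp [planeDet]

/-- Source and target are one-dimensional, so it is enough to hit every scalar `c`, as the
determinant of `(1, 0)` and `(0, c)`. -/
theorem detCoord_injective : Function.Injective (detCoord 2) := by
  have h1 : Module.finrank ℂ (⋀[ℂ]^2 (Fin 2 → ℂ)) = 1 := by
    rw [exteriorPower.finrank_eq]; simp
  have h2 : Function.Surjective (detCoord 2) := by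
    intro c
    refine ⟨exteriorPower.map 2 LinearMap.id (exteriorPower.ιMulti ℂ 2 ![![1, 0], ![0, c]]), ?_⟩
    rw [detCoord_map_ιMulti]
    simp [planeDet]
  exact (LinearMap.injective_iff_surjective_of_finrank_eq_finrank (by simp [h1])).2 h2

variable {V : HolomorphicBundle.{u, v} X 2} {x₀ y : X}

variable (V) in
/-- The coordinate of the determinant line bundle in the preferred trivialization at `x₀`. -/
def wedgeCoord (x₀ y : X) : ⋀[ℂ]^2 (V.fiber y) →ₗ[ℂ] ℂ :=
  detCoord 2 ∘ₗ exteriorPower.map 2 (V.coord x₀ y)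

theorem wedgeCoord_ιMulti (a b : V.fiber y) :
    V.wedgeCoord x₀ y (exteriorPower.ιMulti ℂ 2 ![a, b]) =
      planeDet (V.coord x₀ y a) (V.coord x₀ y b) :=
  detCoord_map_ιMulti _ a b

theorem wedgeCoord_injective (hy : y ∈ V.trivDomain x₀) :
    Function.Injective (V.wedgeCoord x₀ y) := by
  refine detCoord_injective.comp (exteriorPower.map_injective (V.ofCoord x₀ y) ?_)
  exact LinearMap.ext (ofCoord_coord hy)

theorem contMDiffAt_planeDet {I : X → Fin 2 → ℂ} {J : X → Fin 2 → ℂ}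
    (hI : ContMDiffAt 𝓘(ℂ, ℂ) 𝓘(ℂ, Fin 2 → ℂ) ω I y)
    (hJ : ContMDiffAt 𝓘(ℂ, ℂ) 𝓘(ℂ, Fin 2 → ℂ) ω J y) :
    ContMDiffAt 𝓘(ℂ, ℂ) 𝓘(ℂ, ℂ) ω (fun x => planeDet (I x) (J x)) y := by
  rw [contMDiffAt_pi_space] at hI hJ
  exact ((hI 0).mul (hJ 1)).sub ((hI 1).mul (hJ 0))

/-- A meromorphic section of the determinant line bundle is holomorphic and without zeros near every
point, except possibly at the point itself. -/
theorem eventually_of_meromorphicAt_detLocalExpr [IsManifold 𝓘(ℂ, ℂ) ω X]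
    {s : ∀ x, ⋀[ℂ]^2 (V.fiber x)}
    (hs : MeromorphicAt (V.detLocalExpr s x₀) (chartAt ℂ x₀ x₀))
    (hord : meromorphicOrderAt (V.detLocalExpr s x₀) (chartAt ℂ x₀ x₀) ≠ ⊤) :
    ∀ᶠ y in 𝓝[≠] x₀, s y ≠ 0 ∧
      meromorphicOrderAt (V.detLocalExpr s y) (chartAt ℂ y y) = 0 := by
  rw [eventually_nhdsNE_chartAt_iff]
  filter_upwards [hs.eventually_analyticAt, nhdsWithin_le_nhds (eventually_chartAt_symm_mem_trivDomain (V := V) x₀),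
    (meromorphicOrderAt_ne_top_iff_eventually_ne_zero hs).1 hord] with z hz ⟨hzt, hzd⟩ hz0
  set y := (chartAt ℂ x₀).symm z with hy
  have hyx : chartAt ℂ x₀ y = z := (chartAt ℂ x₀).right_inv hzt
  have hsy : s y ≠ 0 := by
    intro h0
    refine hz0 ?_
    rw [detLocalExpr, ← hy, h0, map_zero, map_zero]
  refine ⟨hsy, ?_⟩
  have h1 : AnalyticAt ℂ ((fun x => V.wedgeCoord x₀ x (s x)) ∘ (chartAt ℂ x₀).symm)
      (chartAt ℂ x₀ y) := by rw [hyx]; exact hz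
  rw [analyticAt_comp_chartAt_symm_iff ((chartAt ℂ x₀).map_target hzt)] at h1
  -- Writing `s` as its `x₀`-coordinate times `a ∧ b` for the frame at `x₀` shows that the two
  -- determinant coordinates differ by the holomorphic factor `planeDet` of the frame.
  let a : ∀ x, V.fiber x := fun x => V.ofCoord x₀ x ![1, 0]
  let b : ∀ x, V.fiber x := fun x => V.ofCoord x₀ x ![0, 1]
  have ha := (isHolomorphicSection_ofCoord_const (V := V) x₀ ![1, 0]).contMDiffAt_coord
    isOpen_trivDomain hzd (mem_trivDomain_self (x₀ := y))
  have hb := (isHolomorphicSection_ofCoord_const (V := V) x₀ ![0, 1]).contMDiffAt_coord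
    isOpen_trivDomain hzd (mem_trivDomain_self (x₀ := y))
  have h3 : ContMDiffAt 𝓘(ℂ, ℂ) 𝓘(ℂ, ℂ) ω (fun x => V.wedgeCoord y x (s x)) y := by
    refine (h1.mul (contMDiffAt_planeDet ha hb)).congr_of_eventuallyEq ?_
    filter_upwards [isOpen_trivDomain.mem_nhds hzd] with x hx
    have h4 : s x = V.wedgeCoord x₀ x (s x) • exteriorPower.ιMulti ℂ 2 ![a x, b x] := by
      refine wedgeCoord_injective hx ?_
      rw [map_smul, wedgeCoord_ιMulti, coord_ofCoord hx, coord_ofCoord hx]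
      simp [planeDet]
    refine (congrArg (V.wedgeCoord y x) h4).trans ?_
    rw [map_smul, wedgeCoord_ιMulti]
    rfl
  have h2 : AnalyticAt ℂ (V.detLocalExpr s y) (chartAt ℂ y y) :=
    (analyticAt_comp_chartAt_symm_iff (mem_chart_source ℂ y)).2 h3
  rw [h2.meromorphicOrderAt_eq, h2.analyticOrderAt_eq_zero.2]
  · rfl
  · show V.wedgeCoord y _ (s _) ≠ 0
    rw [(chartAt ℂ y).left_inv (mem_chart_source ℂ y)]
    exact fun h => hsy (wedgeCoord_injective mem_trivDomain_self (by rw [h, map_zero]))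

end HolomorphicBundle

end

noncomputable section
variable {X : Type u} [TopologicalSpace X] [ChartedSpace ℂ X]

open Filter Set

/-! ## The degree inequality for an endomorphism of rank one -/

/-- The order of a vector-valued meromorphic function is the order of all its components in a
direction in which the leading coefficient does not vanish. -/
theorem MeromorphicAt.exists_leadingCoeff {F : Type*} [NormedAddCommGroup F] [NormedSpace ℂ F]
    {S : ℂ → F} {z₀ : ℂ} (hS : MeromorphicAt S z₀) (hord : meromorphicOrderAt S z₀ ≠ ⊤) :
    ∃ w : F, w ≠ 0 ∧ ∀ l : F →L[ℂ] ℂ, l w ≠ 0 → MeromorphicAt (fun z => l (S z)) z₀ ∧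
      meromorphicOrderAt (fun z => l (S z)) z₀ = meromorphicOrderAt S z₀ := by
  obtain ⟨T, hT, hT0, hST⟩ := (meromorphicOrderAt_ne_top_iff hS).1 hord
  refine ⟨T z₀, hT0, fun l hl => ?_⟩
  have hlS : (fun z => l (S z)) =ᶠ[𝓝[≠] z₀]
      fun z => (z - z₀) ^ (meromorphicOrderAt S z₀).untop₀ • l (T z) :=
    hST.mono fun z hz => by simp only [hz, map_smul]
  have hlT : AnalyticAt ℂ (fun z => l (T z)) z₀ := (l.analyticAt _).comp hT
  have hm : MeromorphicAt (fun z => l (S z)) z₀ :=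
    ((((MeromorphicAt.id z₀).sub (MeromorphicAt.const z₀ z₀)).zpow _).smul
      hlT.meromorphicAt).congr hlS.symm
  refine ⟨hm, ?_⟩
  rw [← WithTop.coe_untop₀_of_ne_top hord]
  exact (meromorphicOrderAt_eq_int_iff hm).2 ⟨_, hlT, hl, hlS⟩

namespace HolomorphicBundle

variable {V : HolomorphicBundle.{u, v} X 2} {x₀ y : X}

theorem exists_wedge_eq {a : V.fiber y} (ha : a ≠ 0) (w : ⋀[ℂ]^2 (V.fiber y)) :
    ∃ b, exteriorPower.ιMulti ℂ 2 ![a, b] = w := by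
  have hy := mem_trivDomain_self (V := V) (x₀ := y)
  obtain ⟨b, hb⟩ := exists_planeDet_eq (coord_ne_zero hy ha) (V.wedgeCoord y y w)
  refine ⟨V.ofCoord y y b, wedgeCoord_injective hy ?_⟩
  rw [wedgeCoord_ιMulti, coord_ofCoord hy, hb]

theorem exists_smul_eq_of_wedge_eq_zero {a b : V.fiber y} (ha : a ≠ 0)
    (h : exteriorPower.ιMulti ℂ 2 ![a, b] = 0) : ∃ t : ℂ, b = t • a := by
  have hy := mem_trivDomain_self (V := V) (x₀ := y)
  have h1 := congrArg (V.wedgeCoord y y) h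
  rw [wedgeCoord_ιMulti, map_zero] at h1
  obtain ⟨t, ht⟩ := mem_span_of_planeDet_eq_zero (coord_ne_zero hy ha) h1
  exact ⟨t, coord_injective hy (by rw [ht, map_smul])⟩

/-- Since `ψ` kills `s₁`, it factors through the quotient by `s₁`, which `e ↦ s₁ ∧ e` identifies
with the determinant line. The number `g` expresses the resulting map from that line to the line of
`s₂` in terms of `σ` and `s₂`. -/
theorem exists_rankOne_factor {ψ : Module.End ℂ (V.fiber y)} {s₁ s₂ : V.fiber y}
    {σ : ⋀[ℂ]^2 (V.fiber y)} (h₁ : s₁ ≠ 0) (hψ : ψ s₁ = 0)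
    (hrange : ∀ e, ∃ t : ℂ, ψ e = t • s₂) :
    ∃ g : ℂ, ∀ (e : V.fiber y) (c : ℂ), exteriorPower.ιMulti ℂ 2 ![s₁, e] = c • σ →
      ψ e = (c * g) • s₂ := by
  obtain ⟨b, hb⟩ := exists_wedge_eq h₁ σ
  obtain ⟨g, hg⟩ := hrange b
  refine ⟨g, fun e c he => ?_⟩
  have hlin : exteriorPower.ιMulti ℂ 2 ![s₁, e - c • b] = 0 := by
    have hy := mem_trivDomain_self (V := V) (x₀ := y)
    refine wedgeCoord_injective hy ?_
    have h2 := congrArg (V.wedgeCoord y y) he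
    rw [← hb, map_smul, wedgeCoord_ιMulti, wedgeCoord_ιMulti] at h2
    rw [wedgeCoord_ιMulti, map_zero, map_sub, map_smul, sub_eq_add_neg, planeDet_add_right,
      ← neg_smul, planeDet_smul_right, h2, smul_eq_mul]
    ring
  obtain ⟨t, ht⟩ := exists_smul_eq_of_wedge_eq_zero h₁ hlin
  have h3 : ψ (e - c • b) = 0 := by rw [ht, map_smul, hψ, smul_zero]
  rw [map_sub, map_smul, sub_eq_zero, hg, smul_smul] at h3
  exact h3

/-- The linear form `planeDet · b`. -/
def planeDetCLM (b : Fin 2 → ℂ) : (Fin 2 → ℂ) →L[ℂ] ℂ :=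
  b 1 • ContinuousLinearMap.proj 0 - b 0 • ContinuousLinearMap.proj 1

theorem planeDetCLM_apply (a b : Fin 2 → ℂ) : planeDetCLM b a = planeDet a b := by
  simp only [planeDetCLM, planeDet, sub_apply, smul_apply,
    ContinuousLinearMap.proj_apply, smul_eq_mul]
  ring

/-- Evaluating the defining relation of `g` on a constant vector `b` gives `A = (P / S) g Q` with
`A` a matrix coefficient of `ψ`. As `A` is holomorphic, its order is nonnegative, and this is the
inequality. -/
theorem chartOrder_rankOne_factor [IsManifold 𝓘(ℂ, ℂ) ω X]
    {ψ : ∀ x, Module.End ℂ (V.fiber x)} (hψ : V.IsHolomorphicMap V ψ) {x₀ : X}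
    (hψ0 : ∀ᶠ y in 𝓝[≠] x₀, ψ y ≠ 0)
    {s₁ s₂ : ∀ x, V.fiber x} {σ : ∀ x, ⋀[ℂ]^2 (V.fiber x)}
    (hker : ∀ᶠ y in 𝓝[≠] x₀, ψ y (s₁ y) = 0)
    (hrange : ∀ᶠ y in 𝓝[≠] x₀, ∀ e, ∃ t : ℂ, ψ y e = t • s₂ y)
    (h₁ : MeromorphicAt (V.localExpr s₁ x₀) (chartAt ℂ x₀ x₀))
    (h₁' : meromorphicOrderAt (V.localExpr s₁ x₀) (chartAt ℂ x₀ x₀) ≠ ⊤)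
    (h₂ : MeromorphicAt (V.localExpr s₂ x₀) (chartAt ℂ x₀ x₀))
    (h₂' : meromorphicOrderAt (V.localExpr s₂ x₀) (chartAt ℂ x₀ x₀) ≠ ⊤)
    (hσ : MeromorphicAt (V.detLocalExpr σ x₀) (chartAt ℂ x₀ x₀))
    (hσ' : meromorphicOrderAt (V.detLocalExpr σ x₀) (chartAt ℂ x₀ x₀) ≠ ⊤)
    {g : X → ℂ} (hg : ∀ᶠ y in 𝓝[≠] x₀, ∀ (e : V.fiber y) (c : ℂ),
      exteriorPower.ιMulti ℂ 2 ![s₁ y, e] = c • σ y → ψ y e = (c * g y) • s₂ y) :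
    MeromorphicAt (g ∘ (chartAt ℂ x₀).symm) (chartAt ℂ x₀ x₀) ∧ chartOrder g x₀ ≠ ⊤ ∧
      (meromorphicOrderAt (V.detLocalExpr σ x₀) (chartAt ℂ x₀ x₀)).untop₀ -
        (meromorphicOrderAt (V.localExpr s₁ x₀) (chartAt ℂ x₀ x₀)).untop₀ -
        (meromorphicOrderAt (V.localExpr s₂ x₀) (chartAt ℂ x₀ x₀)).untop₀ ≤
      (chartOrder g x₀).untop₀ := by
  set z₀ := chartAt ℂ x₀ x₀ with hz₀
  obtain ⟨w₁, hw₁, hw₁'⟩ := h₁.exists_leadingCoeff h₁'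
  obtain ⟨w₂, hw₂, hw₂'⟩ := h₂.exists_leadingCoeff h₂'
  -- The vector `b` and the index `i` avoid the leading coefficients' degenerate directions, so the
  -- scalar functions `P` and `Q` below have the orders of `s₁` and `s₂`.
  obtain ⟨b, hb⟩ := exists_planeDet_ne_zero hw₁
  obtain ⟨i, hi⟩ : ∃ i, w₂ i ≠ 0 := by
    by_contra! h
    exact hw₂ (funext h)
  set P : ℂ → ℂ := fun z => planeDetCLM b (V.localExpr s₁ x₀ z) with hP
  set Q : ℂ → ℂ := fun z => (ContinuousLinearMap.proj i : (Fin 2 → ℂ) →L[ℂ] ℂ)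
    (V.localExpr s₂ x₀ z) with hQ
  set S : ℂ → ℂ := V.detLocalExpr σ x₀ with hS
  set A : ℂ → ℂ := (fun y => V.coord x₀ y (ψ y (V.ofCoord x₀ y b)) i) ∘ (chartAt ℂ x₀).symm with hA
  obtain ⟨hPm, hPo⟩ := hw₁' (planeDetCLM b) (by rwa [planeDetCLM_apply])
  obtain ⟨hQm, hQo⟩ := hw₂' (ContinuousLinearMap.proj i) hi
  have hAa : AnalyticAt ℂ A z₀ := by
    rw [hA, hz₀, analyticAt_comp_chartAt_symm_iff (mem_chart_source ℂ x₀)]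
    exact contMDiffAt_pi_space.1
      (hψ.contMDiffAt_coord b mem_trivDomain_self mem_trivDomain_self) i
  have hP0 := (meromorphicOrderAt_ne_top_iff_eventually_ne_zero hPm).1 (by rwa [hPo])
  have hQ0 := (meromorphicOrderAt_ne_top_iff_eventually_ne_zero hQm).1 (by rwa [hQo])
  have hS0 := (meromorphicOrderAt_ne_top_iff_eventually_ne_zero hσ).1 hσ'
  have hdom := nhdsWithin_le_nhds (s := {z₀}ᶜ)
    (eventually_chartAt_symm_mem_trivDomain (V := V) x₀)
  rw [eventually_nhdsNE_chartAt_iff] at hψ0 hker hrange hg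
  have hfac : g ∘ (chartAt ℂ x₀).symm =ᶠ[𝓝[≠] z₀] A * S * P⁻¹ * Q⁻¹ := by
    filter_upwards [hP0, hQ0, hS0, hdom, hg] with z hPz hQz hSz ⟨_, hz⟩ hgz
    set y := (chartAt ℂ x₀).symm z with hy
    have h3 := hgz (V.ofCoord x₀ y b) (P z / S z) (by
      refine wedgeCoord_injective hz ?_
      rw [wedgeCoord_ιMulti, coord_ofCoord hz, map_smul, smul_eq_mul]
      have : V.wedgeCoord x₀ y (σ y) = S z := rfl
      rw [this, div_mul_cancel₀ _ hSz]
      exact (planeDetCLM_apply _ _).symm)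
    have h4 : A z = P z / S z * g y * Q z := by
      have := congrFun (congrArg (V.coord x₀ y) h3) i
      rw [map_smul] at this
      exact this
    simp only [Function.comp_apply, Pi.mul_apply, Pi.inv_apply, h4, ← hy]
    have hPz : P z ≠ 0 := hPz
    have hQz : Q z ≠ 0 := hQz
    field_simp
  -- Off `z₀` the vectors `s₁` and `b` span the fibre and `ψ` kills `s₁`; if `A` vanished, `ψ` would
  -- kill `b` too and be zero.
  have hA0 : ∀ᶠ z in 𝓝[≠] z₀, A z ≠ 0 := by
    filter_upwards [hP0, hQ0, hdom, hψ0, hker, hrange] with z hPz hQz ⟨_, hz⟩ hψz hkz hrz hAz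
    set y := (chartAt ℂ x₀).symm z with hy
    obtain ⟨t, ht⟩ := hrz (V.ofCoord x₀ y b)
    have ht0 : t = 0 := by
      have h5 : A z = t * Q z := by
        have := congrFun (congrArg (V.coord x₀ y) ht) i
        rw [map_smul] at this
        exact this
      rw [h5] at hAz
      exact (mul_eq_zero.1 hAz).resolve_right hQz
    rw [ht0, zero_smul] at ht
    refine hψz (LinearMap.ext fun e => ?_)
    have hPz' : planeDet (V.coord x₀ y (s₁ y)) b ≠ 0 := by
      rw [← planeDetCLM_apply]; exact hPz
    set c := planeDet (V.coord x₀ y (s₁ y)) (V.coord x₀ y e) /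
      planeDet (V.coord x₀ y (s₁ y)) b with hc
    have hs₁ : V.coord x₀ y (s₁ y) ≠ 0 := by
      intro h0
      rw [h0] at hPz'
      simp [planeDet] at hPz'
    obtain ⟨t', ht'⟩ := mem_span_of_planeDet_eq_zero (b := V.coord x₀ y e + (-c) • b) hs₁ (by
      rw [planeDet_add_right, planeDet_smul_right, hc]
      field_simp
      ring)
    have h6 : e = t' • s₁ y + c • V.ofCoord x₀ y b := by
      refine coord_injective hz ?_
      rw [map_add, map_smul, map_smul, ← ht', coord_ofCoord hz, add_assoc, ← add_smul,
        neg_add_cancel, zero_smul, add_zero]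
    rw [h6, map_add, map_smul, map_smul, ht, hkz, smul_zero, smul_zero, add_zero,
      LinearMap.zero_apply]
  have hAo := (meromorphicOrderAt_ne_top_iff_eventually_ne_zero hAa.meromorphicAt).2 hA0
  have hm : MeromorphicAt (A * S * P⁻¹ * Q⁻¹) z₀ :=
    ((hAa.meromorphicAt.mul hσ).mul hPm.inv).mul hQm.inv
  have hord : chartOrder g x₀ = meromorphicOrderAt A z₀ + meromorphicOrderAt S z₀ +
      -meromorphicOrderAt (V.localExpr s₁ x₀) z₀ + -meromorphicOrderAt (V.localExpr s₂ x₀) z₀ := by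
    rw [chartOrder, ← hz₀, meromorphicOrderAt_congr hfac,
      meromorphicOrderAt_mul ((hAa.meromorphicAt.mul hσ).mul hPm.inv) hQm.inv,
      meromorphicOrderAt_mul (hAa.meromorphicAt.mul hσ) hPm.inv,
      meromorphicOrderAt_mul hAa.meromorphicAt hσ, meromorphicOrderAt_inv, meromorphicOrderAt_inv,
      hPo, hQo]
  have hAnn := hAa.meromorphicOrderAt_nonneg
  refine ⟨hm.congr hfac.symm, ?_⟩
  rw [hord]
  lift meromorphicOrderAt A z₀ to ℤ using hAo with a
  lift meromorphicOrderAt S z₀ to ℤ using hσ' with c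
  lift meromorphicOrderAt (V.localExpr s₁ x₀) z₀ to ℤ using h₁' with d
  lift meromorphicOrderAt (V.localExpr s₂ x₀) z₀ to ℤ using h₂' with e
  have ha : 0 ≤ a := by exact_mod_cast hAnn
  have : (a : WithTop ℤ) + c + -d + -e = ((a + c + -d + -e : ℤ) : WithTop ℤ) := rfl
  rw [this]
  refine ⟨WithTop.coe_ne_top, ?_⟩
  simp only [WithTop.untop₀_coe]
  omega

/-- If `ψ` is an endomorphism of a rank two bundle `V` that is generically nonzero, kills the line
subbundle `L₁` and has image in the line subbundle `L₂`, then `deg V ≤ deg L₁ + deg L₂`. -/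
theorem degree_le_of_rankOne [IsManifold 𝓘(ℂ, ℂ) ω X] [T2Space X] [CompactSpace X]
    [ConnectedSpace X] {ψ : ∀ x, Module.End ℂ (V.fiber x)} (hψ : V.IsHolomorphicMap V ψ)
    {L₁ L₂ : ∀ x, Submodule ℂ (V.fiber x)}
    (h : ∀ x, ∀ᶠ y in 𝓝[≠] x, ψ y ≠ 0 ∧ L₁ y ≤ LinearMap.ker (ψ y) ∧ LinearMap.range (ψ y) ≤ L₂ y)
    (hL₂ : ∀ y, Module.finrank ℂ (L₂ y) = 1) {d₁ d₂ d : ℤ} (h₁ : V.HasLineSubbundleDegree L₁ d₁)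
    (h₂ : V.HasLineSubbundleDegree L₂ d₂) (hd : V.HasDegree d) : d ≤ d₁ + d₂ := by
  obtain ⟨s₁, hs₁L, hs₁, hs₁', rfl⟩ := h₁
  obtain ⟨s₂, hs₂L, hs₂, hs₂', rfl⟩ := h₂
  obtain ⟨σ, hσ, hσ', rfl⟩ := hd
  have ev₁ := fun x => eventually_of_meromorphicAt_localExpr (hs₁ x) (hs₁' x)
  have ev₂ := fun x => eventually_of_meromorphicAt_localExpr (hs₂ x) (hs₂' x)
  have evσ := fun x => eventually_of_meromorphicAt_detLocalExpr (hσ x) (hσ' x)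
  have hker : ∀ x, ∀ᶠ y in 𝓝[≠] x, ψ y (s₁ y) = 0 := fun x =>
    (h x).mono fun y hy => hy.2.1 (hs₁L y)
  have hrange : ∀ x, ∀ᶠ y in 𝓝[≠] x, ∀ e, ∃ t : ℂ, ψ y e = t • s₂ y := by
    intro x
    filter_upwards [h x, ev₂ x] with y hy hy₂ e
    have h3 := (finrank_eq_one_iff_of_nonzero' (⟨s₂ y, hs₂L y⟩ : L₂ y)
      (fun h0 => hy₂.1 (congrArg Subtype.val h0))).1 (hL₂ y)
    obtain ⟨t, ht⟩ := h3 ⟨ψ y e, hy.2.2 ⟨e, rfl⟩⟩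
    exact ⟨t, (congrArg Subtype.val ht).symm⟩
  have hex : ∀ y, ∃ g : ℂ, (s₁ y ≠ 0 ∧ ψ y (s₁ y) = 0 ∧
      ∀ e, ∃ t : ℂ, ψ y e = t • s₂ y) → ∀ (e : V.fiber y) (c : ℂ),
      exteriorPower.ιMulti ℂ 2 ![s₁ y, e] = c • σ y → ψ y e = (c * g) • s₂ y := by
    intro y
    by_cases hy : s₁ y ≠ 0 ∧ ψ y (s₁ y) = 0 ∧ ∀ e, ∃ t : ℂ, ψ y e = t • s₂ y
    · obtain ⟨g, hg⟩ := exists_rankOne_factor (σ := σ y) hy.1 hy.2.1 hy.2.2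
      exact ⟨g, fun _ => hg⟩
    -- A default at the exceptional points. They are isolated, and orders do not depend on the value
    -- at a single point.
    · exact ⟨0, fun h => absurd h hy⟩
  choose g hg using hex
  have hmain := fun x => chartOrder_rankOne_factor hψ ((h x).mono fun y hy => hy.1) (hker x)
    (hrange x) (hs₁ x) (hs₁' x) (hs₂ x) (hs₂' x) (hσ x) (hσ' x) (g := g) (by
      filter_upwards [ev₁ x, hker x, hrange x] with y h1 h3 h4
      exact hg y ⟨h1.1, h3, h4⟩)
  have hgm : IsMeromorphicFunction g := fun x => (hmain x).1
  have hgo : ∀ x, chartOrder g x ≠ ⊤ := fun x => (hmain x).2.1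
  have hsum := hgm.finsum_chartOrder_eq_zero hgo
  -- Additivity of `finsum` requires finite supports; an infinite support would give the default sum
  -- zero.
  have fin : ∀ {k : X → WithTop ℤ}, (∀ x, ∀ᶠ y in 𝓝[≠] x, k y = 0) →
      (Function.support fun x => (k x).untop₀).Finite := by
    intro k hk
    refine Set.Finite.of_eventually_notMem fun x => (hk x).mono fun y hy hy' => hy' ?_
    simp only [hy, WithTop.untop₀_zero]
  have f₁ := fin fun x => (ev₁ x).mono fun y hy => hy.2
  have f₂ := fin fun x => (ev₂ x).mono fun y hy => hy.2
  have fσ := fin fun x => (evσ x).mono fun y hy => hy.2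
  have fg := fin fun x => hgm.eventually_chartOrder_eq_zero (hgo x)
  have hσ1 := (fσ.union f₁).subset (Function.support_sub _ _)
  have hσ2 := (hσ1.union f₂).subset (Function.support_sub _ _)
  -- Summing the local inequalities and using that the orders of `g` sum to zero gives `0 ≤ d₁ + d₂
  -- - d`.
  have h4 := finsum_nonneg fun x => sub_nonneg.2 (hmain x).2.2
  rw [finsum_sub_distrib fg hσ2, finsum_sub_distrib hσ1 f₂, finsum_sub_distrib fσ f₁, hsum] at h4
  omega

end HolomorphicBundle

end

noncomputable section
variable {X : Type u} [TopologicalSpace X] [ChartedSpace ℂ X]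

open Filter Set

/-! ## Endomorphisms of rank two bundles -/

theorem exists_add_eq_mul_eq (t d : ℂ) : ∃ a b : ℂ, a + b = t ∧ a * b = d := by
  obtain ⟨s, hs⟩ := IsAlgClosed.exists_pow_nat_eq (t ^ 2 - 4 * d) two_pos
  exact ⟨(t + s) / 2, (t - s) / 2, by ring, by linear_combination (-1 / 4 : ℂ) * hs⟩

/-- Cayley–Hamilton for the factored characteristic polynomial, together with the fact that a root
`a` makes `f - a` singular. A double root `a = b` is allowed. -/
theorem Module.End.sub_smul_mul_sub_smul_eq_zero {M : Type*} [AddCommGroup M] [Module ℂ M]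
    (hM : Module.finrank ℂ M = 2) (f : Module.End ℂ M) {a b : ℂ}
    (htr : a + b = LinearMap.trace ℂ M f) (hdet : a * b = LinearMap.det f) :
    (f - a • 1) * (f - b • 1) = 0 ∧ LinearMap.det (f - a • 1) = 0 := by
  have : FiniteDimensional ℂ M := Module.finite_of_finrank_pos (by omega)
  let B := Module.finBasisOfFinrankEq ℂ M hM
  set A := LinearMap.toMatrix B B f with hA
  rw [LinearMap.trace_eq_matrix_trace ℂ B, ← hA, Matrix.trace_fin_two] at htr
  rw [← LinearMap.det_toMatrix B, ← hA, Matrix.det_fin_two] at hdet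
  have h1 : ∀ c : ℂ, LinearMap.toMatrix B B (f - c • 1) = A - c • 1 := by
    intro c
    rw [map_sub, map_smul, LinearMap.toMatrix_one]
  constructor
  · refine (LinearMap.toMatrix B B).injective ?_
    rw [LinearMap.toMatrix_mul, h1, h1, map_zero]
    ext i j
    fin_cases i <;> fin_cases j <;> simp [Matrix.mul_apply, Fin.sum_univ_two]
    · linear_combination A 0 0 * htr.symm - hdet.symm
    · linear_combination A 0 1 * htr.symm
    · linear_combination A 1 0 * htr.symm
    · linear_combination A 1 1 * htr.symm - hdet.symm
  · rw [← LinearMap.det_toMatrix B, h1, Matrix.det_fin_two]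
    simp
    linear_combination a * htr - hdet

namespace HolomorphicBundle

variable {r r₂ r₃ : ℕ}

section Sections

variable {V : HolomorphicBundle.{u, v} X r}

theorem IsHolomorphicSection.smul_add_smul {U : Set X} (hU : IsOpen U) {s t : ∀ x, V.fiber x}
    (hs : V.IsHolomorphicSection s U) (ht : V.IsHolomorphicSection t U) {a b : X → ℂ}
    (ha : ∀ y ∈ U, ContMDiffAt 𝓘(ℂ, ℂ) 𝓘(ℂ, ℂ) ω a y)
    (hb : ∀ y ∈ U, ContMDiffAt 𝓘(ℂ, ℂ) 𝓘(ℂ, ℂ) ω b y) :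
    V.IsHolomorphicSection (fun x => a x • s x + b x • t x) U := by
  intro y hy
  refine ((contMDiffAt_iff_coord (mem_trivDomain_self (x₀ := y))).2 ?_).contMDiffWithinAt
  have h1 := hs.contMDiffAt_coord hU hy (mem_trivDomain_self (x₀ := y))
  have h2 := ht.contMDiffAt_coord hU hy (mem_trivDomain_self (x₀ := y))
  have h3 := ((ha y hy).smul h1).add ((hb y hy).smul h2)
  refine h3.congr_of_eventuallyEq (Eventually.of_forall fun x => ?_)
  simp

theorem IsHolomorphicMap.sub_const_smul {φ : ∀ x, Module.End ℂ (V.fiber x)}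
    (hφ : V.IsHolomorphicMap V φ) (c : ℂ) :
    V.IsHolomorphicMap V fun x => φ x - c • (1 : Module.End ℂ (V.fiber x)) := by
  intro U hU s hs
  have h := (hφ U hU s hs).smul_add_smul hU hs (a := fun _ => 1) (b := fun _ => -c)
    (fun _ _ => contMDiffAt_const) fun _ _ => contMDiffAt_const
  have h' : ∀ x, (φ x - c • (1 : Module.End ℂ (V.fiber x))) (s x) =
      (1 : ℂ) • φ x (s x) + (-c) • s x := by
    intro x
    simp [sub_eq_add_neg]
  simpa only [h'] using h

end Sections

variable {V : HolomorphicBundle.{u, v} X 2} {x₀ y : X}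

/-- The columns of the matrix of an endomorphism in the preferred trivialization at `x₀`. -/
def columns (ψ : ∀ x, Module.End ℂ (V.fiber x)) (x₀ y : X) : Fin 2 → Fin 2 → ℂ :=
  fun j => V.coord x₀ y (ψ y (V.ofCoord x₀ y (Pi.single j 1)))

variable {ψ : ∀ x, Module.End ℂ (V.fiber x)}

theorem coord_apply_ofCoord (a : Fin 2 → ℂ) :
    V.coord x₀ y (ψ y (V.ofCoord x₀ y a)) =
      a 0 • columns ψ x₀ y 0 + a 1 • columns ψ x₀ y 1 := by
  have : a = a 0 • Pi.single 0 1 + a 1 • Pi.single 1 1 := by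
    ext i; fin_cases i <;> simp
  conv_lhs => rw [this]
  simp only [map_add, map_smul]
  rfl

theorem columns_eq_zero_iff (hy : y ∈ V.trivDomain x₀) : columns ψ x₀ y = 0 ↔ ψ y = 0 := by
  constructor
  · intro h
    ext e
    refine coord_injective hy ?_
    rw [← ofCoord_coord hy e, coord_apply_ofCoord, h]
    simp
  · intro h
    ext j i
    simp [columns, h]

theorem IsHolomorphicMap.contMDiffAt_columns (hψ : V.IsHolomorphicMap V ψ)
    (hy : y ∈ V.trivDomain x₀) :
    ContMDiffAt 𝓘(ℂ, ℂ) 𝓘(ℂ, Fin 2 → Fin 2 → ℂ) ω (columns ψ x₀) y :=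
  contMDiffAt_pi_space.2 fun _ => hψ.contMDiffAt_coord _ hy hy

theorem toMatrix'_conj_coord (hy : y ∈ V.trivDomain x₀) (i j : Fin 2) :
    LinearMap.toMatrix' ((V.coordEquiv hy).toLinearMap ∘ₗ ψ y ∘ₗ (V.coordEquiv hy).symm.toLinearMap)
      i j = columns ψ x₀ y j i := by
  rw [LinearMap.toMatrix'_apply]
  rfl

theorem det_eq_planeDet_columns (hy : y ∈ V.trivDomain x₀) :
    LinearMap.det (ψ y) = planeDet (columns ψ x₀ y 0) (columns ψ x₀ y 1) := by
  rw [← LinearMap.det_conj (ψ y) (V.coordEquiv hy), ← LinearMap.det_toMatrix', Matrix.det_fin_two]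
  simp only [toMatrix'_conj_coord, planeDet]
  ring

theorem trace_eq_columns (hy : y ∈ V.trivDomain x₀) :
    LinearMap.trace ℂ _ (ψ y) = columns ψ x₀ y 0 0 + columns ψ x₀ y 1 1 := by
  rw [← LinearMap.trace_conj' (ψ y) (V.coordEquiv hy),
    LinearMap.trace_eq_matrix_trace ℂ (Pi.basisFun ℂ (Fin 2)), Matrix.trace_fin_two]
  exact congrArg₂ _ (toMatrix'_conj_coord hy 0 0) (toMatrix'_conj_coord hy 1 1)

/-- The determinant is locally a polynomial in holomorphic matrix entries, and a holomorphic
function on a compact connected surface is constant. The same argument serves for the trace. -/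
theorem IsHolomorphicMap.exists_det_eq_const [IsManifold 𝓘(ℂ, ℂ) ω X] [CompactSpace X]
    [ConnectedSpace X] (hψ : V.IsHolomorphicMap V ψ) : ∃ d : ℂ, ∀ y, LinearMap.det (ψ y) = d := by
  have hc : ContMDiff 𝓘(ℂ, ℂ) 𝓘(ℂ, ℂ) ω fun y => LinearMap.det (ψ y) := by
    intro x
    have h := contMDiffAt_pi_space.1 (hψ.contMDiffAt_columns (mem_trivDomain_self (x₀ := x)))
    refine (contMDiffAt_planeDet (h 0) (h 1)).congr_of_eventuallyEq ?_
    filter_upwards [trivDomain_mem_nhds] with y hy using det_eq_planeDet_columns hy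
  have : IsManifold 𝓘(ℂ, ℂ) 1 X := IsManifold.of_le (n := ω) le_top
  obtain ⟨d, hd⟩ := (hc.mdifferentiable (by simp)).exists_eq_const_of_compactSpace
  exact ⟨d, congrFun hd⟩

theorem IsHolomorphicMap.exists_trace_eq_const [IsManifold 𝓘(ℂ, ℂ) ω X] [CompactSpace X]
    [ConnectedSpace X] (hψ : V.IsHolomorphicMap V ψ) :
    ∃ d : ℂ, ∀ y, LinearMap.trace ℂ _ (ψ y) = d := by
  have hc : ContMDiff 𝓘(ℂ, ℂ) 𝓘(ℂ, ℂ) ω fun y => LinearMap.trace ℂ _ (ψ y) := by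
    intro x
    have h := contMDiffAt_pi_space.1 (hψ.contMDiffAt_columns (mem_trivDomain_self (x₀ := x)))
    refine ((contMDiffAt_pi_space.1 (h 0) 0).add
      (contMDiffAt_pi_space.1 (h 1) 1)).congr_of_eventuallyEq ?_
    filter_upwards [trivDomain_mem_nhds] with y hy using trace_eq_columns hy
  have : IsManifold 𝓘(ℂ, ℂ) 1 X := IsManifold.of_le (n := ω) le_top
  obtain ⟨d, hd⟩ := (hc.mdifferentiable (by simp)).exists_eq_const_of_compactSpace
  exact ⟨d, congrFun hd⟩

theorem IsHolomorphicMap.analyticAt_columns [IsManifold 𝓘(ℂ, ℂ) ω X]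
    (hψ : V.IsHolomorphicMap V ψ) :
    AnalyticAt ℂ (columns ψ x₀ ∘ (chartAt ℂ x₀).symm) (chartAt ℂ x₀ x₀) :=
  (analyticAt_comp_chartAt_symm_iff (mem_chart_source ℂ x₀)).2
    (hψ.contMDiffAt_columns mem_trivDomain_self)

/-- A holomorphic endomorphism that is not identically zero is nonzero outside a discrete set. -/
theorem IsHolomorphicMap.eventually_ne_zero [IsManifold 𝓘(ℂ, ℂ) ω X] [T2Space X]
    [ConnectedSpace X] (hψ : V.IsHolomorphicMap V ψ) (hne : ∃ y, ψ y ≠ 0) :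
    ∀ x, ∀ᶠ y in 𝓝[≠] x, ψ y ≠ 0 := by
  refine (forall_eventually_or_forall_eventually_not (P := fun y => ψ y = 0) fun x => ?_).resolve_left
    fun h => ?_
  · have hdom := nhdsWithin_le_nhds (s := {chartAt ℂ x x}ᶜ)
      (eventually_chartAt_symm_mem_trivDomain (V := V) x)
    refine (hψ.analyticAt_columns (x₀ := x)).eventually_eq_zero_or_eventually_ne_zero.imp
      (fun h => eventually_nhdsNE_chartAt_iff.2 ?_) fun h => eventually_nhdsNE_chartAt_iff.2 ?_
    · filter_upwards [nhdsWithin_le_nhds h, hdom] with z hz hzd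
      exact (columns_eq_zero_iff hzd.2).1 hz
    · filter_upwards [h, hdom] with z hz hzd hz0
      exact hz ((columns_eq_zero_iff hzd.2).2 hz0)
  -- If `ψ` vanished on a punctured neighbourhood of every point, it would vanish at `y` by
  -- continuity.
  · obtain ⟨y, hy⟩ := hne
    refine hy ((columns_eq_zero_iff (mem_trivDomain_self (x₀ := y))).1 ?_)
    have h1 := (hψ.contMDiffAt_columns (mem_trivDomain_self (x₀ := y))).continuousAt
    have h2 : Tendsto (columns ψ y) (𝓝[≠] y) (𝓝 (columns ψ y y)) :=
      h1.tendsto.mono_left nhdsWithin_le_nhds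
    refine tendsto_nhds_unique_of_eventuallyEq h2 tendsto_const_nhds ?_
    filter_upwards [h y, nhdsWithin_le_nhds (trivDomain_mem_nhds (V := V))] with x hx hxd
    exact (columns_eq_zero_iff hxd).2 hx

/-! ## The line subbundle generated by the kernel -/

/-- Near every point, the kernel of a generically nonzero singular endomorphism contains a nowhere
vanishing holomorphic section. -/
theorem exists_kernel_frame [IsManifold 𝓘(ℂ, ℂ) ω X] (hψ : V.IsHolomorphicMap V ψ)
    (hdet : ∀ y, LinearMap.det (ψ y) = 0) (hne : ∀ᶠ y in 𝓝[≠] x₀, ψ y ≠ 0) :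
    ∃ U : Set X, IsOpen U ∧ x₀ ∈ U ∧ ∃ s : ∀ x, V.fiber x, V.IsHolomorphicSection s U ∧
      ∀ y ∈ U, s y ≠ 0 ∧ ψ y (s y) = 0 ∧ (y ≠ x₀ → ψ y ≠ 0) := by
  set e := chartAt ℂ x₀ with he
  set z₀ := e x₀ with hz₀
  have hA := hψ.analyticAt_columns (x₀ := x₀)
  have hdom := eventually_chartAt_symm_mem_trivDomain (V := V) x₀
  have hne' := eventually_nhdsNE_chartAt_iff.1 hne
  -- Dividing the matrix by the largest possible power of `z - z₀` leaves `B` with `B z₀ ≠ 0`; its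
  -- kernel continues the kernel of `ψ` across `x₀`.
  obtain ⟨n, B, hB, hB0, hAB⟩ := hA.exists_eventuallyEq_pow_smul_nonzero_iff.2 (by
    intro h
    obtain ⟨z, hz, hz1, hz2⟩ :=
      (hne'.and (nhdsWithin_le_nhds (h.and hdom))).exists
    exact hz ((columns_eq_zero_iff hz2.2).1 hz1))
  obtain ⟨j, i, hji⟩ : ∃ j i, B z₀ j i ≠ 0 := by
    by_contra! h
    exact hB0 (funext fun j => funext (h j))
  have hBan : ∀ j i, AnalyticAt ℂ (fun z => B z j i) z₀ := fun j i =>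
    ((ContinuousLinearMap.proj (R := ℂ) (φ := fun _ : Fin 2 => ℂ) i).comp
      (ContinuousLinearMap.proj (R := ℂ) (φ := fun _ : Fin 2 => Fin 2 → ℂ) j)).analyticAt _ |>.comp hB
  -- Row `i` of `B` turned by a right angle: row `i` kills it identically, the other row up to `±
  -- det B`, and it can vanish at `z₀` only if row `i` does.
  set k : ℂ → Fin 2 → ℂ := fun z => ![-B z 1 i, B z 0 i] with hk
  have hkan : AnalyticAt ℂ k z₀ := by
    refine AnalyticAt.pi fun l => ?_
    fin_cases l
    · exact (hBan 1 i).neg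
    · exact hBan 0 i
  have hk0 : k z₀ ≠ 0 := by
    intro h
    have h0 := congrFun h 0
    have h1 := congrFun h 1
    simp [hk] at h0 h1
    fin_cases j
    · exact hji h1
    · exact hji h0
  have hev : ∀ᶠ z in 𝓝 z₀, (z ∈ e.target ∧ e.symm z ∈ V.trivDomain x₀) ∧
      columns ψ x₀ (e.symm z) = (z - z₀) ^ n • B z ∧ AnalyticAt ℂ k z ∧ k z ≠ 0 ∧
      (z ≠ z₀ → ψ (e.symm z) ≠ 0) :=
    hdom.and (hAB.and (hkan.eventually_analyticAt.and
      ((hkan.continuousAt.eventually_ne hk0).and (eventually_nhdsWithin_iff.1 hne'))))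
  obtain ⟨N, hN, hNo, hzN⟩ := eventually_nhds_iff.1 hev
  have hU : ∀ y ∈ e.source ∩ e ⁻¹' N, y ∈ V.trivDomain x₀ := by
    rintro y ⟨hy, hyN⟩
    have := (hN _ hyN).1.2
    rwa [e.left_inv hy] at this
  refine ⟨e.source ∩ e ⁻¹' N, e.isOpen_inter_preimage hNo, ⟨mem_chart_source ℂ x₀, hzN⟩,
    fun y => V.ofCoord x₀ y (k (e y)), ?_, ?_⟩
  · refine isHolomorphicSection_ofCoord hU fun y ⟨hy, hyN⟩ => ?_
    rw [← analyticAt_comp_chartAt_symm_iff hy]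
    refine (hN _ hyN).2.2.1.congr ?_
    filter_upwards [e.open_target.mem_nhds (e.map_source hy)] with z hz
    rw [Function.comp_apply, ← he, e.right_inv hz]
  · intro y hyU
    have hyd := hU y hyU
    obtain ⟨hy, hyN⟩ := hyU
    obtain ⟨-, h1, -, h2, h3⟩ := hN _ hyN
    rw [e.left_inv hy] at h1 h3
    refine ⟨ofCoord_ne_zero hyd h2, coord_injective hyd ?_, fun hne => h3 fun h => hne ?_⟩
    · rw [coord_apply_ofCoord, map_zero, h1]
      have h4 := hdet y
      rw [det_eq_planeDet_columns hyd, h1] at h4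
      simp only [Pi.smul_apply, planeDet_smul_right, planeDet_smul_left] at h4
      have h5 : (e y - z₀) ^ n * planeDet (B (e y) 0) (B (e y) 1) = 0 := by
        rcases mul_eq_zero.1 h4 with h | h
        · rw [h, zero_mul]
        · exact h
      unfold planeDet at h5
      ext l
      simp only [hk, Pi.smul_apply, smul_eq_mul, Pi.add_apply, Pi.zero_apply,
        Matrix.cons_val_zero, Matrix.cons_val_one]
      fin_cases i <;> fin_cases l <;> simp <;>
        first | ring1 | linear_combination h5 | linear_combination -h5
    · exact e.injOn hy (mem_chart_source ℂ x₀) h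

theorem eq_smul_of_apply_eq_zero {f : Module.End ℂ (V.fiber y)} (hf : f ≠ 0) {a b : V.fiber y}
    (ha : a ≠ 0) (hfa : f a = 0) (hfb : f b = 0) : ∃ t : ℂ, b = t • a := by
  by_contra! h
  have hli : LinearIndependent ℂ ![a, b] := (LinearIndependent.pair_iff' ha).2 fun t => (h t).symm
  let B := basisOfLinearIndependentOfCardEqFinrank hli (by rw [finrank_fiber]; rfl)
  refine hf (B.ext fun i => ?_)
  rw [coe_basisOfLinearIndependentOfCardEqFinrank]
  fin_cases i
  · simpa using hfa
  · simpa using hfb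

/-- The kernel of a generically nonzero singular endomorphism extends to a line subbundle. -/
theorem exists_kernel_lineSubbundle [IsManifold 𝓘(ℂ, ℂ) ω X] (hψ : V.IsHolomorphicMap V ψ)
    (hdet : ∀ y, LinearMap.det (ψ y) = 0) (hne : ∀ x, ∀ᶠ y in 𝓝[≠] x, ψ y ≠ 0) :
    ∃ L : ∀ x, Submodule ℂ (V.fiber x), V.IsLineSubbundle L ∧
      (∀ y, Module.finrank ℂ (L y) = 1) ∧ (∀ y, L y ≤ LinearMap.ker (ψ y)) ∧
      ∀ y, ψ y ≠ 0 → L y = LinearMap.ker (ψ y) := by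
  choose U hU hxU s hs hsU using fun x => exists_kernel_frame hψ hdet (hne x)
  have hspan : ∀ y a, ψ y ≠ 0 → a ≠ 0 → ψ y a = 0 → Submodule.span ℂ {a} = LinearMap.ker (ψ y) := by
    intro y a hy ha hya
    refine le_antisymm ((Submodule.span_singleton_le_iff_mem _ _).2 hya) fun b hb => ?_
    obtain ⟨t, rfl⟩ := eq_smul_of_apply_eq_zero hy ha hya hb
    exact Submodule.mem_span_singleton.2 ⟨t, rfl⟩
  -- Each point uses the frame centred at itself. Away from its centre a frame spans the whole
  -- kernel, so frames with different centres give the same line.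
  refine ⟨fun y => Submodule.span ℂ {s y y}, fun x => ⟨U x, hU x, hxU x, s x, hs x, fun y hy => ?_⟩,
    fun y => finrank_span_singleton (hsU y y (hxU y)).1, fun y => ?_, fun y hy => ?_⟩
  · refine ⟨(hsU x y hy).1, ?_⟩
    by_cases hyx : y = x
    · rw [hyx]
    · obtain ⟨h1, h2, h3⟩ := hsU x y hy
      rw [hspan y _ (h3 hyx) h1 h2]
      exact hspan y _ (h3 hyx) (hsU y y (hxU y)).1 (hsU y y (hxU y)).2.1
  · exact (Submodule.span_singleton_le_iff_mem _ _).2 (hsU y y (hxU y)).2.1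
  · exact hspan y _ hy (hsU y y (hxU y)).1 (hsU y y (hxU y)).2.1

end HolomorphicBundle

/-! ## Stable Higgs bundles are simple -/

variable [IsManifold 𝓘(ℂ, ℂ) ω X]

open HolomorphicBundle

/-- Invariance under `Φ` concerns single tangent vectors, while holomorphy of `Φ` is tested on
vector fields; constant coordinates in a trivialization provide the extension. -/
theorem exists_isHolomorphicVectorField_apply_eq (x : X) (w : TangentSpace 𝓘(ℂ, ℂ) x) :
    ∃ (W : ∀ y : X, TangentSpace 𝓘(ℂ, ℂ) y) (U : Set X), IsOpen U ∧ x ∈ U ∧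
      IsHolomorphicVectorField W U ∧ W x = w := by
  let e := trivializationAt ℂ (TangentSpace 𝓘(ℂ, ℂ) : X → Type) x
  have : ContMDiffVectorBundle ω ℂ (TangentSpace 𝓘(ℂ, ℂ) : X → Type) 𝓘(ℂ, ℂ) :=
    TangentBundle.contMDiffVectorBundle
  have hx : x ∈ e.baseSet := FiberBundle.mem_baseSet_trivializationAt' x
  refine ⟨fun y => e.symmₗ ℂ y (e.linearMapAt ℂ x w), e.baseSet, e.open_baseSet, hx, ?_,
    e.symmₗ_linearMapAt hx w⟩
  refine (e.contMDiffOn_section_baseSet_iff).2 (contMDiffOn_const (c := e.linearMapAt ℂ x w)|>.congr ?_)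
  intro y hy
  rw [← congrFun (e.coe_linearMapAt_of_mem (R := ℂ) hy) _, e.linearMapAt_symmₗ hy]

namespace HiggsBundle

/-- A line subbundle that is `Φ`-invariant outside a discrete set is `Φ`-invariant. -/
theorem invariant_of_eventually (E : HiggsBundle.{u, v} X)
    {L : ∀ x, Submodule ℂ (E.fiber x)} (hL : E.IsLineSubbundle L)
    (h : ∀ x, ∀ᶠ y in 𝓝[≠] x, ∀ w, ∀ e ∈ L y, E.Φ y w e ∈ L y) (x : X)
    (w : TangentSpace 𝓘(ℂ, ℂ) x) (e : E.fiber x) (he : e ∈ L x) : E.Φ x w e ∈ L x := by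
  obtain ⟨U, hU, hxU, s, hs, hsL⟩ := hL x
  obtain ⟨W, U', hU', hxU', hW, rfl⟩ := exists_isHolomorphicVectorField_apply_eq x w
  have hUU := hU.inter hU'
  have hs' : E.IsHolomorphicSection s (U ∩ U') := hs.mono inter_subset_left
  have ht := E.Φ_holomorphic _ hUU W (hW.mono inter_subset_right) s hs'
  have hd := mem_trivDomain_self (V := E.toHolomorphicBundle) (x₀ := x)
  -- Invariance means that `s` and `Φ(W) s` are proportional, which is the vanishing of a
  -- determinant that is continuous at `x`.
  have hc := (contMDiffAt_planeDet (hs'.contMDiffAt_coord hUU ⟨hxU, hxU'⟩ hd)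
    (ht.contMDiffAt_coord hUU ⟨hxU, hxU'⟩ hd)).continuousAt
  have h0 := tendsto_nhds_unique_of_eventuallyEq
    (hc.tendsto.mono_left (nhdsWithin_le_nhds (s := {x}ᶜ))) (tendsto_const_nhds (x := (0 : ℂ))) (by
      filter_upwards [h x, nhdsWithin_le_nhds (hU.mem_nhds hxU)] with y hy hyU
      have h1 := hy (W y) (s y) (by rw [(hsL y hyU).2]; exact Submodule.mem_span_singleton_self _)
      rw [(hsL y hyU).2] at h1
      obtain ⟨t, ht⟩ := Submodule.mem_span_singleton.1 h1
      rw [← ht, map_smul, planeDet_smul_right, planeDet_self, mul_zero])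
  obtain ⟨t, ht⟩ := mem_span_of_planeDet_eq_zero (coord_ne_zero hd (hsL x hxU).1) h0
  rw [(hsL x hxU).2] at he ⊢
  obtain ⟨c, rfl⟩ := Submodule.mem_span_singleton.1 he
  have h1 : E.Φ x (W x) (s x) = t • s x := coord_injective hd (by rw [ht, map_smul])
  rw [map_smul, h1]
  exact Submodule.smul_mem _ _ (Submodule.smul_mem _ _ (Submodule.mem_span_singleton_self _))

/-- Every endomorphism of a stable Higgs bundle is a scalar. -/
theorem IsStable.exists_eq_smul [T2Space X] [CompactSpace X] [ConnectedSpace X]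
    {E : HiggsBundle.{u, v} X} (hE : E.IsStable) {φ : ∀ x, Module.End ℂ (E.fiber x)}
    (hφ : E.IsHolomorphicMap E.toHolomorphicBundle φ)
    (hcomm : ∀ x w e, φ x (E.Φ x w e) = E.Φ x w (φ x e)) : ∃ c : ℂ, ∀ x e, φ x e = c • e := by
  obtain ⟨t, ht⟩ := hφ.exists_trace_eq_const
  obtain ⟨d, hd⟩ := hφ.exists_det_eq_const
  obtain ⟨a, b, hab, hab'⟩ := exists_add_eq_mul_eq t d
  by_contra hscalar
  -- Formulated for any ordering of the two roots, so that it yields both kernel subbundles.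
  have key : ∀ a b : ℂ, a + b = t → a * b = d →
      (∀ x, (φ x - a • (1 : Module.End ℂ (E.fiber x))) * (φ x - b • 1) = 0) ∧
      (∀ x, ∀ᶠ y in 𝓝[≠] x, φ y - a • (1 : Module.End ℂ (E.fiber y)) ≠ 0) ∧
      ∃ L : ∀ x, Submodule ℂ (E.fiber x), (∀ y, Module.finrank ℂ (L y) = 1) ∧
        (∀ y, L y ≤ LinearMap.ker (φ y - a • 1)) ∧
        (∀ y, φ y - a • (1 : Module.End ℂ (E.fiber y)) ≠ 0 →
          L y = LinearMap.ker (φ y - a • 1)) ∧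
        ∃ d₁ d : ℤ, E.HasLineSubbundleDegree L d₁ ∧ E.HasDegree d ∧ 2 * d₁ < d := by
    intro a b hab hab'
    have hmat := fun x => Module.End.sub_smul_mul_sub_smul_eq_zero (finrank_fiber x) (φ x)
      (hab.trans (ht x).symm) (hab'.trans (hd x).symm)
    have hhol := hφ.sub_const_smul a
    have hne := hhol.eventually_ne_zero (by
      by_contra! h
      exact hscalar ⟨a, fun x e => sub_eq_zero.1 (LinearMap.congr_fun (h x) e)⟩)
    obtain ⟨L, hL, hL1, hLker, hLker'⟩ :=
      exists_kernel_lineSubbundle hhol (fun y => (hmat y).2) hne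
    refine ⟨fun x => (hmat x).1, hne, L, hL1, hLker, hLker', hE L hL ?_⟩
    refine E.invariant_of_eventually hL fun x => ?_
    filter_upwards [hne x] with y hy w e he
    rw [hLker' y hy] at he ⊢
    have he' : φ y e = a • e := sub_eq_zero.1 he
    refine sub_eq_zero.2 ?_
    rw [hcomm, he', map_smul]
    rfl
  obtain ⟨hm, hne, L, hL1, hLker, hLker', d₁, d₂, hd₁, hd₂, hlt⟩ := key a b hab hab'
  obtain ⟨hm', hne', L', hL1', hLker1, hLker1', d₁', d₂', hd₁', hd₂', hlt'⟩ :=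
    key b a (by rw [add_comm, hab]) (by rw [mul_comm, hab'])
  -- From `(φ - b)(φ - a) = 0`, the image of `φ - a` lies in the kernel of `φ - b`, which is `L'`
  -- off a discrete set.
  have h1 := degree_le_of_rankOne (hφ.sub_const_smul a) (L₁ := L) (L₂ := L') (fun x => by
    filter_upwards [hne x, hne' x] with y hy hy'
    refine ⟨hy, hLker y, ?_⟩
    rw [hLker1' y hy']
    rintro _ ⟨e, rfl⟩
    exact LinearMap.congr_fun (hm' y) e) hL1' hd₁ hd₁' hd₂
  have h2 := degree_le_of_rankOne (hφ.sub_const_smul b) (L₁ := L') (L₂ := L) (fun x => by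
    filter_upwards [hne x, hne' x] with y hy hy'
    refine ⟨hy', hLker1 y, ?_⟩
    rw [hLker' y hy]
    rintro _ ⟨e, rfl⟩
    exact LinearMap.congr_fun (hm y) e) hL1 hd₁' hd₁ hd₂'
  -- The degrees `d₂` and `d₂'` of `E` come from two applications of stability and need not be
  -- identified: adding both inequalities gives `d₂ + d₂' ≤ 2 d₁ + 2 d₁' < d₂ + d₂'`.
  omega

end HiggsBundle

end

noncomputable section
variable {X : Type u} [TopologicalSpace X] [ChartedSpace ℂ X]

open Filter Set

/-! ## Lifts of an automorphism -/

namespace HolomorphicBundle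

variable {r r₂ : ℕ} {f : Automorphism X}

section Transport

variable {V : HolomorphicBundle.{u, v} X r} {W : HolomorphicBundle.{u, v} X r₂} {U : Set X}

/-- A holomorphic section of `f^* V` comes from a holomorphic section of `V`. -/
theorem IsHolomorphicSection.exists_of_pullback {t : ∀ x, V.fiber (f x)}
    (ht : (V.pullback f).IsHolomorphicSection t U) :
    ∃ s : ∀ x, V.fiber x, V.IsHolomorphicSection s (f.symm ⁻¹' U) ∧ ∀ x, s (f x) = t x := by
  have hsymm : ContMDiffOn 𝓘(ℂ, ℂ) 𝓘(ℂ, ℂ) ω f.symm (f.symm ⁻¹' U) :=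
    f.symm.contMDiff.contMDiffOn
  refine ⟨fun y => fiberCast V.fiber (f.apply_symm_apply y) (t (f.symm y)), ?_,
    fun x => fiberCast_comp_apply V.fiber f t (f.symm_apply_apply x) _⟩
  have h := (V.isHolomorphicSection_pullback_iff f t U).1 ht
  exact (h.comp hsymm fun y hy => hy).congr fun y _ => mk_fiberCast _ V.fiber _ _

theorem IsHolomorphicSection.comp_automorphism {s : ∀ x, V.fiber x}
    (hs : V.IsHolomorphicSection s U) :
    (V.pullback f).IsHolomorphicSection (fun x => s (f x)) (f ⁻¹' U) :=
  (V.isHolomorphicSection_pullback_iff f _ _).2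
    (ContMDiffOn.comp hs f.contMDiff.contMDiffOn fun _ hx => hx)

theorem preimage_preimage_symm (f : Automorphism X) (U : Set X) : f ⁻¹' (f.symm ⁻¹' U) = U := by
  ext x
  simp

theorem isOpen_preimage_symm (hU : IsOpen U) : IsOpen (f.symm ⁻¹' U) :=
  hU.preimage f.symm.continuous

theorem IsHolomorphicMap.pullback {φ : ∀ x, V.fiber x →ₗ[ℂ] W.fiber x}
    (hφ : V.IsHolomorphicMap W φ) :
    (V.pullback f).IsHolomorphicMap (W.pullback f) fun x => φ (f x) := by
  intro U hU t ht
  obtain ⟨s, hs, hst⟩ := IsHolomorphicSection.exists_of_pullback ht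
  have h := (hφ _ (isOpen_preimage_symm hU) s hs).comp_automorphism (f := f)
  rw [preimage_preimage_symm] at h
  have key : (fun x => φ (f x) (s (f x))) = fun x => φ (f x) (t x) := funext fun x => by rw [hst]
  exact key ▸ h

theorem IsHolomorphicSection.const_smul (hU : IsOpen U) {s : ∀ x, V.fiber x}
    (hs : V.IsHolomorphicSection s U) (c : ℂ) :
    V.IsHolomorphicSection (fun x => c • s x) U := by
  have h := hs.smul_add_smul hU hs (a := fun _ => c) (b := fun _ => 0)
    (fun _ _ => contMDiffAt_const) fun _ _ => contMDiffAt_const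
  simpa using h

end Transport

section Lifts

variable {V W : HolomorphicBundle.{u, v} X r}

/-- The multiple of an isomorphism of bundles by a nonzero constant. -/
def Iso.smul (φ : V.Iso W) (c : ℂ) (hc : c ≠ 0) : V.Iso W where
  toEquiv x := (φ.toEquiv x).trans (LinearEquiv.smulOfNeZero ℂ (W.fiber x) c hc)
  holomorphic U hU s hs := (φ.holomorphic U hU s hs).const_smul hU c
  holomorphic_symm U hU _ hs := φ.holomorphic_symm U hU _ (hs.const_smul hU c⁻¹)

/-- The linear maps between the fibres of `V` that belong to a map `V → f^* V`. -/
def liftMap (φ : V.Iso (V.pullback f)) (x : X) : V.fiber x →ₗ[ℂ] V.fiber (f x) :=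
  (φ.toEquiv x).toLinearMap

theorem liftMap_injective (φ : V.Iso (V.pullback f)) (x : X) :
    Function.Injective (liftMap φ x) :=
  (φ.toEquiv x).injective

theorem liftMap_smul (φ : V.Iso (V.pullback f)) (c : ℂ) (hc : c ≠ 0) (x : X) (e : V.fiber x) :
    liftMap (φ.smul c hc) x e = c • liftMap φ x e := rfl

/-- The iterates of a lift of `f`, as linear maps between fibres. -/
def iterateLift (φ : V.Iso (V.pullback f)) : ∀ (n : ℕ) (x : X), V.fiber x →ₗ[ℂ] V.fiber (f^[n] x)
  | 0, _ => LinearMap.id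
  | n + 1, x => iterateLift φ n (f x) ∘ₗ liftMap φ x

theorem iterateLift_succ (φ : V.Iso (V.pullback f)) (n : ℕ) (x : X) (e : V.fiber x) :
    iterateLift φ (n + 1) x e = iterateLift φ n (f x) (liftMap φ x e) := rfl

theorem totalMap_iterate (φ : V.Iso (V.pullback f)) (n : ℕ) (x : X) (e : V.fiber x) :
    (V.totalMap f φ)^[n] (TotalSpace.mk' (Fin r → ℂ) x e) =
      TotalSpace.mk' (Fin r → ℂ) (f^[n] x) (iterateLift φ n x e) := by
  induction n generalizing x with
  | zero => rfl
  | succ n ih => exact ih (f x) (liftMap φ x e)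

theorem iterateLift_injective (φ : V.Iso (V.pullback f)) (n : ℕ) (x : X) :
    Function.Injective (iterateLift φ n x) := by
  induction n generalizing x with
  | zero => exact fun _ _ h => h
  | succ n ih => exact fun _ _ h => liftMap_injective φ x (ih (f x) h)

theorem iterateLift_eq_smul {φ ψ : V.Iso (V.pullback f)} {c : ℂ}
    (h : ∀ x e, liftMap ψ x e = c • liftMap φ x e) (n : ℕ) (x : X) (e : V.fiber x) :
    iterateLift ψ n x e = c ^ n • iterateLift φ n x e := by
  induction n generalizing x with
  | zero => exact (by rw [pow_zero, one_smul] : e = c ^ 0 • e)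
  | succ n ih =>
    rw [iterateLift_succ, ih, h, map_smul, smul_smul, ← pow_succ]
    rfl

/-- One application of the lift moves `s` to a holomorphic section `t` over the image of `U`, to
which the induction hypothesis applies. Maps into the total space express this without a pullback
along `f^[n]`. -/
theorem contMDiffOn_iterateLift (φ : V.Iso (V.pullback f)) (n : ℕ) {U : Set X} (hU : IsOpen U)
    {s : ∀ x, V.fiber x} (hs : V.IsHolomorphicSection s U) :
    ContMDiffOn 𝓘(ℂ, ℂ) (𝓘(ℂ, ℂ).prod 𝓘(ℂ, Fin r → ℂ)) ω
      (fun x => TotalSpace.mk' (Fin r → ℂ) (E := V.fiber) (f^[n] x) (iterateLift φ n x (s x))) U := by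
  induction n generalizing U s with
  | zero => exact hs
  | succ n ih =>
    obtain ⟨t, ht, hts⟩ := IsHolomorphicSection.exists_of_pullback (φ.holomorphic U hU s hs)
    have h := (ih (isOpen_preimage_symm hU) ht).comp (f.contMDiff.contMDiffOn (s := U))
      fun x hx => by simpa using hx
    refine h.congr fun x _ => ?_
    have hts' : t (f x) = liftMap φ x (s x) := hts x
    change _ = TotalSpace.mk' _ (f^[n] (f x)) (iterateLift φ n (f x) (t (f x)))
    rw [hts']
    rfl

/-- The `n`-th iterate of a lift of `f`, as an endomorphism of `V`, if `f^n` is the identity. -/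
def iterateEnd (φ : V.Iso (V.pullback f)) {n : ℕ} (hn : (f : X → X)^[n] = id) (x : X) :
    Module.End ℂ (V.fiber x) :=
  (fiberCast V.fiber (congrFun hn x)).toLinearMap ∘ₗ iterateLift φ n x

theorem isHolomorphicMap_iterateEnd (φ : V.Iso (V.pullback f)) {n : ℕ}
    (hn : (f : X → X)^[n] = id) : V.IsHolomorphicMap V (iterateEnd φ hn) :=
  fun _ hU _ hs => (contMDiffOn_iterateLift φ n hU hs).congr fun _ _ =>
    mk_fiberCast _ V.fiber _ _

theorem totalMap_iterate_eq (φ : V.Iso (V.pullback f)) {n : ℕ} (hn : (f : X → X)^[n] = id) (x : X)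
    (e : V.fiber x) : (V.totalMap f φ)^[n] (TotalSpace.mk' (Fin r → ℂ) x e) =
      TotalSpace.mk' (Fin r → ℂ) x (iterateEnd φ hn x e) := by
  rw [totalMap_iterate]
  exact (mk_fiberCast _ V.fiber (congrFun hn x) _).symm

theorem iterateEnd_injective (φ : V.Iso (V.pullback f)) {n : ℕ} (hn : (f : X → X)^[n] = id)
    (x : X) : Function.Injective (iterateEnd φ hn x) :=
  (fiberCast V.fiber (congrFun hn x)).injective.comp (iterateLift_injective φ n x)

theorem iterateEnd_eq_smul {φ ψ : V.Iso (V.pullback f)} {c : ℂ}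
    (h : ∀ x e, liftMap ψ x e = c • liftMap φ x e) {n : ℕ} (hn : (f : X → X)^[n] = id) (x : X)
    (e : V.fiber x) : iterateEnd ψ hn x e = c ^ n • iterateEnd φ hn x e := by
  have h := congrArg (fiberCast V.fiber (congrFun hn x)) (iterateLift_eq_smul h n x e)
  rw [map_smul] at h
  exact h

theorem EquivariantStructure.iterateEnd_eq {p : ℕ} (a : EquivariantStructure f p V)
    (hp : (f : X → X)^[p] = id) (x : X) (e : V.fiber x) : iterateEnd a.toIso hp x e = e := by
  have h := totalMap_iterate_eq a.toIso hp x e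
  rw [a.iterate_eq] at h
  exact (TotalSpace.mk_inj.1 h).symm

theorem totalMap_iterate_eq_id (φ : V.Iso (V.pullback f)) {n : ℕ} (hn : (f : X → X)^[n] = id)
    (h : ∀ x e, iterateEnd φ hn x e = e) : (V.totalMap f φ)^[n] = id := by
  funext ⟨x, e⟩
  exact (totalMap_iterate_eq φ hn x e).trans (congrArg _ (h x e))

theorem EquivariantStructure.ext_toEquiv {p : ℕ} {a b : EquivariantStructure f p V}
    (h : ∀ x e, liftMap a.toIso x e = liftMap b.toIso x e) : a = b := by
  obtain ⟨⟨a, ha, ha'⟩, ha''⟩ := a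
  obtain ⟨⟨b, hb, hb'⟩, hb''⟩ := b
  have : a = b := funext fun x => LinearEquiv.ext (h x)
  subst this
  rfl

end Lifts

/-! ## Maps from the determinant line bundle to a line bundle -/

/-- A fibrewise linear map from `⋀² V` to a line bundle that is holomorphic. -/
def IsHolomorphicDetMap (V : HolomorphicBundle.{u, v} X 2) (L : HolomorphicBundle.{u, v} X 1)
    (P : ∀ x, ⋀[ℂ]^2 (V.fiber x) →ₗ[ℂ] L.fiber x) : Prop :=
  ∀ U : Set X, IsOpen U → ∀ s t : ∀ x, V.fiber x, V.IsHolomorphicSection s U →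
    V.IsHolomorphicSection t U →
    L.IsHolomorphicSection (fun x => P x (exteriorPower.ιMulti ℂ 2 ![s x, t x])) U

section DetMaps

variable {V : HolomorphicBundle.{u, v} X 2} {L : HolomorphicBundle.{u, v} X 1}

theorem map_comp_vecTwo {M N : Type*} [AddCommGroup M] [Module ℂ M] [AddCommGroup N] [Module ℂ N]
    (g : M →ₗ[ℂ] N) (a b : M) : ⇑g ∘ ![a, b] = ![g a, g b] := by
  funext i
  fin_cases i <;> rfl

theorem finrank_wedge (y : X) : Module.finrank ℂ (⋀[ℂ]^2 (V.fiber y)) = 1 := by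
  rw [exteriorPower.finrank_eq, finrank_fiber]
  rfl

/-- Two holomorphic maps from the determinant line bundle of a bundle on a compact connected Riemann
surface to a line bundle, the second of them injective, are proportional. -/
theorem IsHolomorphicDetMap.exists_eq_smul [IsManifold 𝓘(ℂ, ℂ) ω X] [CompactSpace X]
    [ConnectedSpace X] {P Q : ∀ x, ⋀[ℂ]^2 (V.fiber x) →ₗ[ℂ] L.fiber x}
    (hP : IsHolomorphicDetMap V L P) (hQ : IsHolomorphicDetMap V L Q)
    (hQi : ∀ x, Function.Injective (Q x)) : ∃ k : ℂ, ∀ x e, P x e = k • Q x e := by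
  have hex : ∀ x, ∃ k : ℂ, ∀ e, P x e = k • Q x e := by
    intro x
    obtain ⟨e₀, he₀, hspan⟩ := finrank_eq_one_iff'.1 (finrank_wedge (V := V) x)
    obtain ⟨k, hk⟩ := (finrank_eq_one_iff_of_nonzero' (Q x e₀)
      ((map_ne_zero_iff _ (hQi x)).2 he₀)).1 (finrank_fiber (V := L) x) (P x e₀)
    refine ⟨k, fun e => ?_⟩
    obtain ⟨c, rfl⟩ := hspan e
    rw [map_smul, map_smul, ← hk, smul_comm]
  choose k hk using hex
  -- Locally `k` is the quotient of the coordinates of `P (a ∧ b)` and `Q (a ∧ b)` for a frame `a`,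
  -- `b`, and the denominator has no zeros because `Q` is injective.
  have hc : ContMDiff 𝓘(ℂ, ℂ) 𝓘(ℂ, ℂ) ω k := by
    intro x
    let a : ∀ y, V.fiber y := fun y => V.ofCoord x y ![1, 0]
    let b : ∀ y, V.fiber y := fun y => V.ofCoord x y ![0, 1]
    have ha : V.IsHolomorphicSection a _ := isHolomorphicSection_ofCoord_const x ![1, 0]
    have hb : V.IsHolomorphicSection b _ := isHolomorphicSection_ofCoord_const x ![0, 1]
    have h1 := contMDiffAt_pi_space.1 ((hP _ isOpen_trivDomain a b ha hb).contMDiffAt_coord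
      isOpen_trivDomain mem_trivDomain_self (mem_trivDomain_self (x₀ := x))) 0
    have h2 := contMDiffAt_pi_space.1 ((hQ _ isOpen_trivDomain a b ha hb).contMDiffAt_coord
      isOpen_trivDomain mem_trivDomain_self (mem_trivDomain_self (x₀ := x))) 0
    have hne : ∀ y, y ∈ V.trivDomain x → y ∈ L.trivDomain x →
        L.coord x y (Q y (exteriorPower.ιMulti ℂ 2 ![a y, b y])) 0 ≠ 0 := by
      intro y hyV hyL h0
      have h3 : exteriorPower.ιMulti ℂ 2 ![a y, b y] = 0 := by
        refine hQi y (coord_injective hyL (funext fun i => ?_))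
        rw [map_zero, map_zero, Subsingleton.elim i 0]
        exact h0
      have h4 := congrArg (V.wedgeCoord x y) h3
      rw [wedgeCoord_ιMulti, coord_ofCoord hyV, coord_ofCoord hyV, map_zero] at h4
      simp [planeDet] at h4
    refine (h1.div₀ h2 (hne x mem_trivDomain_self mem_trivDomain_self)).congr_of_eventuallyEq ?_
    filter_upwards [trivDomain_mem_nhds (V := V), trivDomain_mem_nhds (V := L)] with y hyV hyL
    rw [Pi.div_apply, eq_div_iff (hne y hyV hyL), hk, map_smul]
    rfl
  have : IsManifold 𝓘(ℂ, ℂ) 1 X := IsManifold.of_le (n := ω) le_top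
  obtain ⟨d, hd⟩ := (hc.mdifferentiable (by simp)).exists_eq_const_of_compactSpace
  exact ⟨d, fun x e => by rw [hk, hd]; rfl⟩

/-- The map induced on determinant line bundles by a lift of `f`, followed by a holomorphic map to a
line bundle. -/
theorem DetIso.isHolomorphicDetMap_comp (h : DetIso V L) (φ : V.Iso (V.pullback f)) :
    IsHolomorphicDetMap V (L.pullback f) fun x =>
      (h.toEquiv (f x)).toLinearMap ∘ₗ exteriorPower.map 2 (liftMap φ x) := by
  intro U hU s t hs ht
  obtain ⟨s', hs', hss'⟩ := IsHolomorphicSection.exists_of_pullback (φ.holomorphic U hU s hs)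
  obtain ⟨t', ht', htt'⟩ := IsHolomorphicSection.exists_of_pullback (φ.holomorphic U hU t ht)
  have h1 := (h.holomorphic _ (isOpen_preimage_symm hU) s' t' hs' ht').comp_automorphism (f := f)
  rw [preimage_preimage_symm] at h1
  have key : (fun x => (h.toEquiv (f x)) (exteriorPower.ιMulti ℂ 2 ![s' (f x), t' (f x)])) =
      fun x => ((h.toEquiv (f x)).toLinearMap ∘ₗ exteriorPower.map 2 (liftMap φ x))
        (exteriorPower.ιMulti ℂ 2 ![s x, t x]) := by
    funext x
    have hs1 : s' (f x) = liftMap φ x (s x) := hss' x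
    have ht1 : t' (f x) = liftMap φ x (t x) := htt' x
    rw [hs1, ht1, LinearMap.comp_apply, exteriorPower.map_apply_ιMulti, map_comp_vecTwo]
    rfl
  exact key ▸ h1

theorem DetIso.isHolomorphicDetMap_lift (h : DetIso V L) (β : L.Iso (L.pullback f)) :
    IsHolomorphicDetMap V (L.pullback f) fun x => liftMap β x ∘ₗ (h.toEquiv x).toLinearMap :=
  fun U hU s t hs ht => β.holomorphic U hU _ (h.holomorphic U hU s t hs ht)

/-- The source of the square in the comparison of lifts: rescaling a lift by `c` rescales its
determinant by `c ^ 2`. -/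
theorem exteriorPower_map_two_smul {M N : Type*} [AddCommGroup M] [Module ℂ M] [AddCommGroup N]
    [Module ℂ N] (g : M →ₗ[ℂ] N) (c : ℂ) :
    exteriorPower.map 2 (c • g) = c ^ 2 • exteriorPower.map 2 g := by
  refine exteriorPower.linearMap_ext (AlternatingMap.ext fun m => ?_)
  simp only [LinearMap.compAlternatingMap_apply, exteriorPower.map_apply_ιMulti,
    LinearMap.smul_apply]
  have : (⇑(c • g) ∘ m) = fun i => c • (g ∘ m) i := rfl
  rw [this, AlternatingMap.map_smul_univ]
  simp

end DetMaps

end HolomorphicBundle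

end

noncomputable section
variable {X : Type u} [TopologicalSpace X] [ChartedSpace ℂ X]

open Filter Set

/-! ## Lifts of an automorphism to a Higgs bundle -/

namespace HolomorphicBundle

variable {r : ℕ} {f : Automorphism X}

section Conjugation

variable {V W : HolomorphicBundle.{u, v} X r}

theorem exists_fiber_ne_zero (V : HolomorphicBundle.{u, v} X (r + 1)) (x : X) :
    ∃ e : V.fiber x, e ≠ 0 := by
  have : Nontrivial (V.fiber x) := Module.nontrivial_of_finrank_pos (R := ℂ) <| by
    rw [finrank_fiber]
    exact r.succ_pos
  exact exists_ne 0

/-- The lift of `f` to `V` that corresponds to a lift to `W` under an isomorphism `V → W`. -/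
def Iso.conj (φ : V.Iso W) (ψ : W.Iso (W.pullback f)) : V.Iso (V.pullback f) where
  toEquiv x := ((φ.toEquiv x).trans (ψ.toEquiv x)).trans (φ.toEquiv (f x)).symm
  holomorphic U hU s hs := IsHolomorphicMap.pullback φ.holomorphic_symm U hU _
    (ψ.holomorphic U hU _ (φ.holomorphic U hU s hs))
  holomorphic_symm U hU s hs := φ.holomorphic_symm U hU _
    (ψ.holomorphic_symm U hU _ (IsHolomorphicMap.pullback φ.holomorphic U hU s hs))

theorem Iso.apply_conj (φ : V.Iso W) (ψ : W.Iso (W.pullback f)) (x : X) (e : V.fiber x) :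
    φ.toEquiv (f x) (liftMap (φ.conj ψ) x e) = liftMap ψ x (φ.toEquiv x e) :=
  (φ.toEquiv (f x)).apply_symm_apply _

theorem Iso.apply_iterateLift_conj (φ : V.Iso W) (ψ : W.Iso (W.pullback f)) (n : ℕ) (x : X)
    (e : V.fiber x) :
    φ.toEquiv (f^[n] x) (iterateLift (φ.conj ψ) n x e) = iterateLift ψ n x (φ.toEquiv x e) := by
  induction n generalizing x with
  | zero => rfl
  | succ n ih => exact (ih (f x) _).trans (congrArg _ (φ.apply_conj ψ x e))

theorem Iso.apply_fiberCast (φ : V.Iso W) {y x : X} (h : y = x) (e : V.fiber y) :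
    φ.toEquiv x (fiberCast V.fiber h e) = fiberCast W.fiber h (φ.toEquiv y e) := by
  subst h
  rfl

theorem Iso.apply_iterateEnd_conj (φ : V.Iso W) (ψ : W.Iso (W.pullback f)) {n : ℕ}
    (hn : (f : X → X)^[n] = id) (x : X) (e : V.fiber x) :
    φ.toEquiv x (iterateEnd (φ.conj ψ) hn x e) = iterateEnd ψ hn x (φ.toEquiv x e) :=
  (φ.apply_fiberCast _ _).trans (congrArg _ (φ.apply_iterateLift_conj ψ n x e))

/-- The equivariant structure on `V` that corresponds to one on `W` under an isomorphism. -/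
def EquivariantStructure.conj {p : ℕ} (a : EquivariantStructure f p W) (φ : V.Iso W)
    (hp : (f : X → X)^[p] = id) : EquivariantStructure f p V where
  toIso := φ.conj a.toIso
  iterate_eq := totalMap_iterate_eq_id _ hp fun x e => (φ.toEquiv x).injective <| by
    rw [φ.apply_iterateEnd_conj, a.iterateEnd_eq]

end Conjugation

section Det

variable {V W : HolomorphicBundle.{u, v} X 2} {L : HolomorphicBundle.{u, v} X 1}

/-- The isomorphism `det V → det W → L`. -/
def DetIso.comp (h : DetIso W L) (φ : V.Iso W) : DetIso V L where
  toEquiv x :=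
    let g : ⋀[ℂ]^2 (V.fiber x) ≃ₗ[ℂ] ⋀[ℂ]^2 (W.fiber x) :=
      LinearEquiv.ofLinearMap (exteriorPower.map 2 (φ.toEquiv x).toLinearMap)
        (exteriorPower.map 2 (φ.toEquiv x).symm.toLinearMap)
        (by rw [← exteriorPower.map_comp]; simp) (by rw [← exteriorPower.map_comp]; simp)
    g.trans (h.toEquiv x)
  holomorphic U hU s t hs ht := by
    have h1 := h.holomorphic U hU _ _ (φ.holomorphic U hU s hs) (φ.holomorphic U hU t ht)
    have key : (fun x => h.toEquiv x (exteriorPower.ιMulti ℂ 2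
        ![φ.toEquiv x (s x), φ.toEquiv x (t x)])) = fun x => h.toEquiv x
          (exteriorPower.map 2 (φ.toEquiv x).toLinearMap
            (exteriorPower.ιMulti ℂ 2 ![s x, t x])) := by
      funext x
      rw [exteriorPower.map_apply_ιMulti, map_comp_vecTwo]
      rfl
    exact key ▸ h1

theorem DetEquivariantlyIso.conj {p : ℕ} {a : EquivariantStructure f p W}
    {b : EquivariantStructure f p L} (h : DetEquivariantlyIso a b) (φ : V.Iso W)
    (hp : (f : X → X)^[p] = id) : DetEquivariantlyIso (a.conj φ hp) b := by
  obtain ⟨h, hh⟩ := h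
  refine ⟨h.comp φ, fun x e => ?_⟩
  have : (φ.toEquiv (f x)).toLinearMap ∘ₗ liftMap (φ.conj a.toIso) x =
      liftMap a.toIso x ∘ₗ (φ.toEquiv x).toLinearMap := LinearMap.ext fun e => φ.apply_conj _ x e
  have h2 := LinearMap.congr_fun (congrArg (exteriorPower.map 2) this) e
  rw [exteriorPower.map_comp, exteriorPower.map_comp] at h2
  exact (congrArg (h.toEquiv (f x)) h2).trans (hh x _)

theorem DetIso.isHolomorphicDetMap (h : DetIso V L) :
    IsHolomorphicDetMap V L fun x => (h.toEquiv x).toLinearMap := h.holomorphic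

theorem DetIso.apply_iterateLift {φ : V.Iso (V.pullback f)} {β : L.Iso (L.pullback f)}
    (h : DetIso V L) {k : ℂ} (hk : ∀ x e, h.toEquiv (f x) (exteriorPower.map 2 (liftMap φ x) e) =
      k • liftMap β x (h.toEquiv x e)) (n : ℕ) (x : X) (e : ⋀[ℂ]^2 (V.fiber x)) :
    h.toEquiv (f^[n] x) (exteriorPower.map 2 (iterateLift φ n x) e) =
      k ^ n • iterateLift β n x (h.toEquiv x e) := by
  induction n generalizing x with
  | zero =>
    have h1 : exteriorPower.map 2 (LinearMap.id : V.fiber x →ₗ[ℂ] V.fiber x) e = e := by simp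
    exact (congrArg _ h1).trans
      (by rw [pow_zero, one_smul] : h.toEquiv x e = k ^ 0 • h.toEquiv x e)
  | succ n ih =>
    have h1 : exteriorPower.map 2 (iterateLift φ (n + 1) x) e =
        exteriorPower.map 2 (iterateLift φ n (f x)) (exteriorPower.map 2 (liftMap φ x) e) :=
      LinearMap.congr_fun (exteriorPower.map_comp (liftMap φ x) (iterateLift φ n (f x))) e
    rw [h1]
    refine (ih (f x) _).trans ?_
    rw [hk, map_smul, smul_smul, ← pow_succ]
    rfl

theorem DetIso.fiberCast_apply (h : DetIso V L) {y x : X} (hy : y = x)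
    (T : V.fiber x →ₗ[ℂ] V.fiber y) (e : ⋀[ℂ]^2 (V.fiber x)) :
    fiberCast L.fiber hy (h.toEquiv y (exteriorPower.map 2 T e)) =
      h.toEquiv x (exteriorPower.map 2 ((fiberCast V.fiber hy).toLinearMap ∘ₗ T) e) := by
  subst hy
  rfl

/-- For `n = p` and equivariant structures both iterates are the identity, which forces `k ^ p = 1`.
-/
theorem DetIso.apply_iterateEnd {φ : V.Iso (V.pullback f)} {β : L.Iso (L.pullback f)}
    (h : DetIso V L) {k : ℂ} (hk : ∀ x e, h.toEquiv (f x) (exteriorPower.map 2 (liftMap φ x) e) =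
      k • liftMap β x (h.toEquiv x e)) {n : ℕ} (hn : (f : X → X)^[n] = id) (x : X)
    (e : ⋀[ℂ]^2 (V.fiber x)) :
    h.toEquiv x (exteriorPower.map 2 (iterateEnd φ hn x) e) =
      k ^ n • iterateEnd β hn x (h.toEquiv x e) := by
  have h1 := congrArg (fiberCast L.fiber (congrFun hn x)) (h.apply_iterateLift hk n x e)
  rw [map_smul] at h1
  exact (h.fiberCast_apply _ _ e).symm.trans h1

theorem exists_wedge_ne_zero (x : X) : ∃ e : ⋀[ℂ]^2 (V.fiber x), e ≠ 0 := by
  have : Nontrivial (⋀[ℂ]^2 (V.fiber x)) := Module.nontrivial_of_finrank_pos (R := ℂ) <| by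
    rw [finrank_wedge]
    exact one_pos
  exact exists_ne 0

/-- Up to a `p`-th root of unity, an isomorphism from `det V` to `L` is equivariant. -/
theorem EquivariantStructure.exists_det_eq_smul [IsManifold 𝓘(ℂ, ℂ) ω X] [CompactSpace X]
    [ConnectedSpace X] {p : ℕ} (hp : (f : X → X)^[p] = id) (a : EquivariantStructure f p V)
    (b : EquivariantStructure f p L) (h : DetIso V L) :
    ∃ k : ℂ, k ^ p = 1 ∧ ∀ x e, h.toEquiv (f x) (exteriorPower.map 2 (liftMap a.toIso x) e) =
      k • liftMap b.toIso x (h.toEquiv x e) := by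
  obtain ⟨k, hk⟩ := (h.isHolomorphicDetMap_comp a.toIso).exists_eq_smul
    (h.isHolomorphicDetMap_lift b.toIso)
    fun x => (liftMap_injective b.toIso x).comp (h.toEquiv x).injective
  refine ⟨k, ?_, hk⟩
  obtain ⟨x⟩ := (inferInstance : Nonempty X)
  obtain ⟨e, he⟩ := exists_wedge_ne_zero (V := V) x
  have h1 := h.apply_iterateEnd hk hp x e
  have h2 : iterateEnd a.toIso hp x = LinearMap.id := LinearMap.ext (a.iterateEnd_eq hp x)
  rw [h2, b.iterateEnd_eq, exteriorPower.map_id, LinearMap.id_apply] at h1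
  have h3 : (k ^ p - 1) • h.toEquiv x e = 0 := by rw [sub_smul, one_smul, ← h1, sub_self]
  exact sub_eq_zero.1 ((smul_eq_zero.1 h3).resolve_right
    ((LinearEquiv.map_ne_zero_iff _).2 he))

/-- The multiple of an equivariant structure by a root of unity. -/
def EquivariantStructure.smul {p : ℕ} (hp : (f : X → X)^[p] = id) {r : ℕ}
    {V : HolomorphicBundle.{u, v} X r} (a : EquivariantStructure f p V) (c : ℂ) (hc : c ≠ 0)
    (hcp : c ^ p = 1) : EquivariantStructure f p V where
  toIso := a.toIso.smul c hc
  iterate_eq := totalMap_iterate_eq_id _ hp fun x e => by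
    rw [iterateEnd_eq_smul (liftMap_smul a.toIso c hc), hcp, one_smul, a.iterateEnd_eq]

/-- The two identifications of `det V` with `L` may differ, but only by a constant `k`, the same at
`x` and `f x`. It cancels, and the determinant of the scalar `c` remains. -/
theorem DetEquivariantlyIso.sq_eq_one [IsManifold 𝓘(ℂ, ℂ) ω X] [CompactSpace X]
    [ConnectedSpace X] {p : ℕ} {a a' : EquivariantStructure f p V}
    {b : EquivariantStructure f p L} (ha : DetEquivariantlyIso a b)
    (ha' : DetEquivariantlyIso a' b) {c : ℂ}
    (hc : ∀ x e, liftMap a'.toIso x e = c • liftMap a.toIso x e) : c ^ 2 = 1 := by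
  obtain ⟨h, hh⟩ := ha
  obtain ⟨h', hh'⟩ := ha'
  obtain ⟨k, hk⟩ := h'.isHolomorphicDetMap.exists_eq_smul h.isHolomorphicDetMap
    fun x => (h.toEquiv x).injective
  replace hk : ∀ x e, h'.toEquiv x e = k • h.toEquiv x e := hk
  obtain ⟨x⟩ := (inferInstance : Nonempty X)
  obtain ⟨e, he⟩ := exists_wedge_ne_zero (V := V) x
  have hc' : liftMap a'.toIso x = c • liftMap a.toIso x := LinearMap.ext (hc x)
  have h0 : h'.toEquiv x e ≠ 0 := (LinearEquiv.map_ne_zero_iff _).2 he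
  have h1 : h'.toEquiv (f x) (exteriorPower.map 2 (liftMap a'.toIso x) e) =
      liftMap b.toIso x (h'.toEquiv x e) := hh' x e
  have h2 : h.toEquiv (f x) (exteriorPower.map 2 (liftMap a.toIso x) e) =
      liftMap b.toIso x (h.toEquiv x e) := hh x e
  rw [hc', exteriorPower_map_two_smul, LinearMap.smul_apply, map_smul, hk, h2, ← map_smul, ← hk]
    at h1
  have h3 : (c ^ 2 - 1) • liftMap b.toIso x (h'.toEquiv x e) = 0 := by
    rw [sub_smul, one_smul, h1, sub_self]
  exact sub_eq_zero.1 ((smul_eq_zero.1 h3).resolve_right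
    ((map_ne_zero_iff _ (liftMap_injective b.toIso x)).2 h0))

end Det

end HolomorphicBundle

namespace HiggsBundle

open HolomorphicBundle

variable [IsManifold 𝓘(ℂ, ℂ) ω X] {f : Automorphism X} {E E' : HiggsBundle.{u, v} X}

theorem IsHiggsIso.liftMap_apply {φ : E.toHolomorphicBundle.Iso (E.toHolomorphicBundle.pullback f)}
    (hφ : E.IsHiggsIso (E.pullback f) φ) (x : X) (w : TangentSpace 𝓘(ℂ, ℂ) x) (e : E.fiber x) :
    liftMap φ x (E.Φ x w e) =
      E.Φ (f x) (mfderiv 𝓘(ℂ, ℂ) 𝓘(ℂ, ℂ) f x w) (liftMap φ x e) := hφ x w e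

theorem IsHiggsIso.conj {φ : E.toHolomorphicBundle.Iso E'.toHolomorphicBundle}
    (hφ : E.IsHiggsIso E' φ) {ψ : E'.toHolomorphicBundle.Iso (E'.toHolomorphicBundle.pullback f)}
    (hψ : E'.IsHiggsIso (E'.pullback f) ψ) : E.IsHiggsIso (E.pullback f) (φ.conj ψ) := by
  intro x w e
  refine (φ.toEquiv (f x)).injective ((φ.apply_conj ψ x _).trans ?_)
  rw [hφ x w e, hψ.liftMap_apply]
  refine Eq.trans ?_ (hφ (f x) (mfderiv 𝓘(ℂ, ℂ) 𝓘(ℂ, ℂ) f x w) (liftMap (φ.conj ψ) x e)).symm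
  rw [φ.apply_conj]

theorem IsHiggsIso.smul {φ : E.toHolomorphicBundle.Iso E'.toHolomorphicBundle}
    (hφ : E.IsHiggsIso E' φ) (c : ℂ) (hc : c ≠ 0) : E.IsHiggsIso E' (φ.smul c hc) := by
  intro x w e
  exact (congrArg (c • ·) (hφ x w e)).trans (map_smul (E'.Φ x w) c (φ.toEquiv x e)).symm

theorem IsHiggsIso.iterateLift_apply
    {φ : E.toHolomorphicBundle.Iso (E.toHolomorphicBundle.pullback f)}
    (hφ : E.IsHiggsIso (E.pullback f) φ) (n : ℕ) (x : X) (w : TangentSpace 𝓘(ℂ, ℂ) x)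
    (e : E.fiber x) : iterateLift φ n x (E.Φ x w e) =
      E.Φ (f^[n] x) (mfderiv 𝓘(ℂ, ℂ) 𝓘(ℂ, ℂ) f^[n] x w) (iterateLift φ n x e) := by
  induction n generalizing x with
  | zero =>
    have h : mfderiv 𝓘(ℂ, ℂ) 𝓘(ℂ, ℂ) (id : X → X) x w = w := by rw [mfderiv_id]; rfl
    exact congrArg (fun w' => E.Φ x w' e) h.symm
  | succ n ih =>
    have hd : MDifferentiable 𝓘(ℂ, ℂ) 𝓘(ℂ, ℂ) f := f.contMDiff.mdifferentiable (by simp)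
    have hdn : MDifferentiable 𝓘(ℂ, ℂ) 𝓘(ℂ, ℂ) f^[n] := by
      clear ih e w x
      induction n with
      | zero => exact mdifferentiable_id
      | succ n ih => exact ih.comp hd
    have hcomp : mfderiv 𝓘(ℂ, ℂ) 𝓘(ℂ, ℂ) (f^[n] ∘ f) x w =
        mfderiv 𝓘(ℂ, ℂ) 𝓘(ℂ, ℂ) f^[n] (f x) (mfderiv 𝓘(ℂ, ℂ) 𝓘(ℂ, ℂ) f x w) := by
      rw [mfderiv_comp x (hdn _) (hd x)]
      rfl
    rw [iterateLift_succ, hφ.liftMap_apply]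
    refine (ih (f x) _ _).trans ?_
    rw [← hcomp]
    rfl

/-- A variable `g` in place of the iterate of `f` allows the substitution `g = id`, which removes
the cast. -/
theorem fiberCast_apply_Φ {g : X → X} (hg : g = id) (x : X) (w : TangentSpace 𝓘(ℂ, ℂ) x)
    (e : E.fiber (g x)) :
    fiberCast E.fiber (congrFun hg x) (E.Φ (g x) (mfderiv 𝓘(ℂ, ℂ) 𝓘(ℂ, ℂ) g x w) e) =
      E.Φ x w (fiberCast E.fiber (congrFun hg x) e) := by
  subst hg
  have h : mfderiv 𝓘(ℂ, ℂ) 𝓘(ℂ, ℂ) (id : X → X) x w = w := by rw [mfderiv_id]; rfl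
  exact congrArg (fun w' => E.Φ x w' e) h

/-- By the chain rule the derivatives of `f` accumulate to that of the identity, so the iterate is
an endomorphism of the Higgs bundle and simplicity applies to it. -/
theorem IsHiggsIso.iterateEnd_apply
    {φ : E.toHolomorphicBundle.Iso (E.toHolomorphicBundle.pullback f)}
    (hφ : E.IsHiggsIso (E.pullback f) φ) {n : ℕ} (hn : (f : X → X)^[n] = id) (x : X)
    (w : TangentSpace 𝓘(ℂ, ℂ) x) (e : E.fiber x) :
    iterateEnd φ hn x (E.Φ x w e) = E.Φ x w (iterateEnd φ hn x e) :=
  (congrArg _ (hφ.iterateLift_apply n x w e)).trans (fiberCast_apply_Φ hn x w _)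

variable [CompactSpace X] [ConnectedSpace X] [T2Space X]

/-- Two lifts of `f` to a stable Higgs bundle are proportional. -/
theorem IsStable.exists_liftMap_eq_smul (hE : E.IsStable)
    {φ ψ : E.toHolomorphicBundle.Iso (E.toHolomorphicBundle.pullback f)}
    (hφ : E.IsHiggsIso (E.pullback f) φ) (hψ : E.IsHiggsIso (E.pullback f) ψ) :
    ∃ c : ℂ, ∀ x e, liftMap ψ x e = c • liftMap φ x e := by
  -- The composite of `ψ` with the inverse of `φ` is an endomorphism of `E` commuting with the Higgs
  -- field.
  obtain ⟨c, hc⟩ := hE.exists_eq_smul (φ := fun x =>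
      (φ.toEquiv x).symm.toLinearMap ∘ₗ (ψ.toEquiv x).toLinearMap)
    (fun U hU s hs => φ.holomorphic_symm U hU _ (ψ.holomorphic U hU s hs)) fun x w e =>
      (φ.toEquiv x).injective <| by
        refine ((φ.toEquiv x).apply_symm_apply _).trans ((hψ x w e).trans ?_)
        refine Eq.trans ?_ (hφ x w _).symm
        exact congrArg _ ((φ.toEquiv x).apply_symm_apply _).symm
  refine ⟨c, fun x e => ?_⟩
  have h := congrArg (φ.toEquiv x) (hc x e)
  rw [map_smul] at h
  exact ((φ.toEquiv x).apply_symm_apply _).symm.trans h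

/-- A Higgs bundle isomorphism `E → f^* E` of a stable Higgs bundle can be rescaled to have order
dividing `p`. -/
theorem IsStable.exists_equivariantStructure (hE : E.IsStable) (hEf : E.IsFixedBy f) {p : ℕ}
    (hp0 : p ≠ 0) (hp : (f : X → X)^[p] = id) :
    ∃ a : EquivariantStructure f p E.toHolomorphicBundle, E.IsHiggsIso (E.pullback f) a.toIso := by
  obtain ⟨(φ : E.toHolomorphicBundle.Iso (E.toHolomorphicBundle.pullback f)), hφ⟩ := hEf
  obtain ⟨c, hc⟩ := hE.exists_eq_smul (isHolomorphicMap_iterateEnd φ hp)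
    (hφ.iterateEnd_apply hp)
  have hc0 : c ≠ 0 := by
    rintro rfl
    obtain ⟨x⟩ := (inferInstance : Nonempty X)
    obtain ⟨e, he⟩ := exists_fiber_ne_zero E.toHolomorphicBundle x
    exact he (iterateEnd_injective φ hp x (by rw [hc, zero_smul, map_zero]))
  -- Scaling the lift by `l` scales its `p`-th iterate, the scalar `c`, by `l ^ p`.
  obtain ⟨l, hl⟩ := IsAlgClosed.exists_pow_nat_eq c⁻¹ (Nat.pos_of_ne_zero hp0)
  have hl0 : l ≠ 0 := by
    rintro rfl
    rw [zero_pow hp0] at hl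
    exact inv_ne_zero hc0 hl.symm
  refine ⟨⟨φ.smul l hl0, totalMap_iterate_eq_id _ hp fun x e => ?_⟩, hφ.smul l hl0⟩
  rw [iterateEnd_eq_smul (liftMap_smul φ l hl0), hc, hl, smul_smul, inv_mul_cancel₀ hc0, one_smul]

/-- A stable Higgs bundle has at most one equivariant structure of odd order that induces a given
equivariant structure on the determinant. -/
theorem IsStable.equivariantStructure_unique (hE : E.IsStable) {p : ℕ} (hp0 : Odd p)
    (hp : (f : X → X)^[p] = id) {L : HolomorphicBundle.{u, v} X 1} {b : EquivariantStructure f p L}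
    {a a' : EquivariantStructure f p E.toHolomorphicBundle}
    (ha : E.IsHiggsIso (E.pullback f) a.toIso) (ha' : E.IsHiggsIso (E.pullback f) a'.toIso)
    (hb : DetEquivariantlyIso a b) (hb' : DetEquivariantlyIso a' b) : a = a' := by
  obtain ⟨m, rfl⟩ := hp0
  obtain ⟨c, hc⟩ := hE.exists_liftMap_eq_smul ha' ha
  have hc2 : c ^ 2 = 1 := hb'.sq_eq_one hb hc
  obtain ⟨x⟩ := (inferInstance : Nonempty X)
  obtain ⟨e, he⟩ := exists_fiber_ne_zero E.toHolomorphicBundle x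
  -- The `p`-th iterates are both the identity, so `c ^ (2m + 1) = 1`; with `c ^ 2 = 1` this leaves
  -- `c = 1`.
  have h1 := iterateEnd_eq_smul hc hp x e
  rw [a.iterateEnd_eq, a'.iterateEnd_eq, pow_succ, pow_mul, hc2, one_pow, one_mul] at h1
  have h2 : (c - 1) • e = 0 := by rw [sub_smul, one_smul, ← h1, sub_self]
  have hc1 : c = 1 := sub_eq_zero.1 ((smul_eq_zero.1 h2).resolve_right he)
  exact EquivariantStructure.ext_toEquiv fun x e => by rw [hc, hc1, one_smul]

theorem IsStable.existsUnique_equivariantStructure (hE : E.IsStable) (hEf : E.IsFixedBy f) {p : ℕ}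
    (hp0 : Odd p) (hp : (f : X → X)^[p] = id) {L : HolomorphicBundle.{u, v} X 1}
    (b : EquivariantStructure f p L) (hL : Nonempty (DetIso E.toHolomorphicBundle L)) :
    ∃! a : EquivariantStructure f p E.toHolomorphicBundle,
      E.IsHiggsIso (E.pullback f) a.toIso ∧ DetEquivariantlyIso a b := by
  obtain ⟨m, rfl⟩ := hp0
  obtain ⟨h⟩ := hL
  obtain ⟨a, ha⟩ := hE.exists_equivariantStructure hEf (2 * m).succ_ne_zero hp
  obtain ⟨k, hk, hka⟩ := a.exists_det_eq_smul hp b h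
  -- The correction factor `k ^ m` contributes `k ^ (2m)` to the determinant, and `k ^ (2m) * k = k
  -- ^ p = 1`. It is itself a `p`-th root of unity, so the order of the lift is kept.
  have hk0 : k ^ m ≠ 0 := pow_ne_zero _ (by rintro rfl; simp at hk)
  have hkp : (k ^ m) ^ (2 * m + 1) = 1 := by rw [pow_right_comm, hk, one_pow]
  have hdet : DetEquivariantlyIso (a.smul hp _ hk0 hkp) b := by
    refine ⟨h, fun x e => ?_⟩
    have h1 : liftMap (a.smul hp _ hk0 hkp).toIso x = k ^ m • liftMap a.toIso x :=
      LinearMap.ext (liftMap_smul a.toIso _ hk0 x)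
    change h.toEquiv (f x) (exteriorPower.map 2 (liftMap (a.smul hp _ hk0 hkp).toIso x) e) = _
    rw [h1, exteriorPower_map_two_smul, LinearMap.smul_apply, map_smul, hka, smul_smul, ← pow_mul,
      ← pow_succ, mul_comm m, hk, one_smul]
    rfl
  exact ⟨a.smul hp _ hk0 hkp, ⟨ha.smul _ hk0, hdet⟩, fun a' ⟨ha', hb'⟩ =>
    hE.equivariantStructure_unique ⟨m, rfl⟩ hp ha' (ha.smul _ hk0) hb' hdet⟩

end HiggsBundle

end

noncomputable section
variable {X : Type u} [TopologicalSpace X] [ChartedSpace ℂ X]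

open Filter Set

/-! ## Fixed points -/

/-- In a chart at a fixed point the fixed points are the zeros of an analytic function, so they are
isolated or fill a neighbourhood. By connectedness the second alternative would spread everywhere
and make `f` the identity. -/
theorem finite_fixedPoints_of_automorphism [IsManifold 𝓘(ℂ, ℂ) ω X] [CompactSpace X]
    [ConnectedSpace X] [T2Space X] {f : Automorphism X} (hf : (f : X → X) ≠ id) :
    {x | f x = x}.Finite := by
  have hloc : ∀ x : X, (∀ᶠ y in 𝓝[≠] x, f y = y) ∨ ∀ᶠ y in 𝓝[≠] x, ¬ f y = y := by
    intro x
    by_cases hx : f x = x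
    · let c := chartAt ℂ x
      have hc : ContMDiffAt 𝓘(ℂ, ℂ) 𝓘(ℂ, ℂ) ω c x :=
        contMDiffAt_of_mem_maximalAtlas (IsManifold.chart_mem_maximalAtlas x)
          (mem_chart_source ℂ x)
      have hg : ContMDiffAt 𝓘(ℂ, ℂ) 𝓘(ℂ, ℂ) ω (fun y => c (f y) - c y) x :=
        (ContMDiffAt.comp x (by rwa [hx]) f.contMDiff.contMDiffAt).sub hc
      have hmem : ∀ᶠ y in 𝓝[≠] x, y ∈ c.source ∧ f y ∈ c.source := by
        refine nhdsWithin_le_nhds (Filter.Eventually.and (chart_source_mem_nhds ℂ x) ?_)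
        refine f.continuous.continuousAt.eventually_mem ?_
        rw [hx]
        exact chart_source_mem_nhds ℂ x
      rcases ((analyticAt_comp_chartAt_symm_iff (mem_chart_source ℂ x)).2
        hg).eventually_eq_zero_or_eventually_ne_zero with h | h
      · left
        filter_upwards [eventually_nhdsNE_chartAt_iff (P := fun y => c (f y) - c y = 0) |>.2
          (h.filter_mono nhdsWithin_le_nhds), hmem] with y hy ⟨hy1, hy2⟩
        exact c.injOn hy2 hy1 (sub_eq_zero.1 hy)
      · right
        filter_upwards [eventually_nhdsNE_chartAt_iff (P := fun y => c (f y) - c y ≠ 0) |>.2 h]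
          with y hy hfy
        exact hy (by rw [hfy, sub_self])
    · right
      exact nhdsWithin_le_nhds
        ((isOpen_ne_fun f.continuous continuous_id).mem_nhds (show f x ≠ id x from hx))
  rcases forall_eventually_or_forall_eventually_not hloc with h | h
  · exact absurd (funext fun x => tendsto_nhds_unique_of_eventuallyEq
      (f.continuous.continuousAt.tendsto.mono_left nhdsWithin_le_nhds)
      (tendsto_id.mono_left (nhdsWithin_le_nhds (s := {x}ᶜ))) (h x)) hf
  · exact Set.Finite.of_eventually_notMem h

/-! ## The action on the fibre over a fixed point -/

namespace HolomorphicBundle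

namespace EquivariantStructure

variable {r p : ℕ} {f : Automorphism X} {x : X}

theorem atFixed_injective {V : HolomorphicBundle.{u, v} X r} (a : EquivariantStructure f p V)
    (hx : f x = x) : Function.Injective (a.atFixed hx) :=
  (fiberCast V.fiber hx).injective.comp (a.toEquiv x).injective

theorem totalMap_iterate_atFixed {V : HolomorphicBundle.{u, v} X r}
    (a : EquivariantStructure f p V) (hx : f x = x) (n : ℕ) (e : V.fiber x) :
    (V.totalMap f a.toIso)^[n] (TotalSpace.mk' (Fin r → ℂ) x e) =
      TotalSpace.mk' (Fin r → ℂ) x ((a.atFixed hx ^ n) e) := by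
  induction n generalizing e with
  | zero => rfl
  | succ n ih =>
    have h : V.totalMap f a.toIso (TotalSpace.mk' (Fin r → ℂ) x e) =
        TotalSpace.mk' (Fin r → ℂ) x (a.atFixed hx e) :=
      (mk_fiberCast _ V.fiber hx _).symm
    rw [Function.iterate_succ_apply, h, ih, pow_succ]
    rfl

theorem atFixed_pow {V : HolomorphicBundle.{u, v} X r} (a : EquivariantStructure f p V)
    (hx : f x = x) : a.atFixed hx ^ p = 1 := by
  ext e
  have h := a.totalMap_iterate_atFixed hx p e
  rw [a.iterate_eq] at h
  exact (TotalSpace.mk_inj.1 h).symm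

theorem eigenvalue_pow {V : HolomorphicBundle.{u, v} X r} (a : EquivariantStructure f p V)
    (hx : f x = x) {μ : ℂ} (hμ : (a.atFixed hx).HasEigenvalue μ) : μ ^ p = 1 := by
  obtain ⟨v, hv⟩ := hμ.exists_hasEigenvector
  have h := hv.pow_apply p
  rw [a.atFixed_pow hx, Module.End.one_apply] at h
  have h2 : (μ ^ p - 1) • v = 0 := by rw [sub_smul, one_smul, ← h, sub_self]
  exact sub_eq_zero.1 ((smul_eq_zero.1 h2).resolve_right hv.2)

variable {L : HolomorphicBundle.{u, v} X 1}

theorem atFixed_apply_eq_scalarAt_smul (b : EquivariantStructure f p L) (hx : f x = x)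
    (e : L.fiber x) : b.atFixed hx e = b.scalarAt hx • e := by
  obtain ⟨e₀, -, hspan⟩ := finrank_eq_one_iff'.1 (finrank_fiber (V := L) x)
  obtain ⟨c, hc₀⟩ := hspan (b.atFixed hx e₀)
  have hc : b.atFixed hx = c • LinearMap.id := by
    refine LinearMap.ext fun e => ?_
    obtain ⟨t, rfl⟩ := hspan e
    rw [map_smul, ← hc₀, smul_comm]
    rfl
  rw [scalarAt, hc, LinearMap.det_smul, finrank_fiber, LinearMap.det_id]
  simp

theorem scalarAt_pow (b : EquivariantStructure f p L) (hx : f x = x) : b.scalarAt hx ^ p = 1 := by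
  obtain ⟨e, he⟩ := exists_fiber_ne_zero L x
  exact b.eigenvalue_pow hx (Module.End.hasEigenvalue_of_hasEigenvector
    ⟨Module.End.mem_eigenspace_iff.2 (b.atFixed_apply_eq_scalarAt_smul hx e), he⟩)

variable {V W : HolomorphicBundle.{u, v} X 2}

theorem map_atFixed_eq_smul {a : EquivariantStructure f p V} {b : EquivariantStructure f p L}
    (hab : DetEquivariantlyIso a b) (hx : f x = x) (e : ⋀[ℂ]^2 (V.fiber x)) :
    exteriorPower.map 2 (a.atFixed hx) e = b.scalarAt hx • e := by
  obtain ⟨h, hh⟩ := hab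
  refine (h.toEquiv x).injective ?_
  rw [map_smul, ← b.atFixed_apply_eq_scalarAt_smul]
  exact (h.fiberCast_apply hx (liftMap a.toIso x) e).symm.trans
    (congrArg (fiberCast L.fiber hx) (hh x e))

/-- The nonzero bivector `v ∧ w` is multiplied by `μ ν` and by `α_x`. The case `μ = ν` is included,
to bound the dimension of an eigenspace. -/
theorem mul_eigenvalue_eq_scalarAt {a : EquivariantStructure f p V}
    {b : EquivariantStructure f p L} (hab : DetEquivariantlyIso a b) (hx : f x = x) {μ ν : ℂ}
    {v w : V.fiber x} (hv : a.atFixed hx v = μ • v) (hw : a.atFixed hx w = ν • w) (hv0 : v ≠ 0)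
    (hvw : ¬ ∃ t : ℂ, w = t • v) : μ * ν = b.scalarAt hx := by
  have h := map_atFixed_eq_smul hab hx (exteriorPower.ιMulti ℂ 2 ![v, w])
  rw [exteriorPower.map_apply_ιMulti, map_comp_vecTwo, hv, hw] at h
  have h1 : (![μ • v, ν • w] : Fin 2 → V.fiber x) = fun i => ![μ, ν] i • ![v, w] i := by
    funext i
    fin_cases i <;> rfl
  rw [h1, AlternatingMap.map_smul_univ, Fin.prod_univ_two] at h
  have h2 := congrArg (V.wedgeCoord x x) h
  rw [map_smul, map_smul] at h2
  refine mul_right_cancel₀ (fun h0 => hvw (exists_smul_eq_of_wedge_eq_zero hv0 ?_)) h2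
  exact wedgeCoord_injective mem_trivDomain_self (h0.trans (map_zero _).symm)

theorem mul_eigenvalue_eq_scalarAt_of_ne {a : EquivariantStructure f p V}
    {b : EquivariantStructure f p L} (hab : DetEquivariantlyIso a b) (hx : f x = x) {μ ν : ℂ}
    (hμ : (a.atFixed hx).HasEigenvalue μ) (hν : (a.atFixed hx).HasEigenvalue ν) (hne : μ ≠ ν) :
    μ * ν = b.scalarAt hx := by
  obtain ⟨v, hv⟩ := hμ.exists_hasEigenvector
  obtain ⟨w, hw⟩ := hν.exists_hasEigenvector
  refine mul_eigenvalue_eq_scalarAt hab hx hv.apply_eq_smul hw.apply_eq_smul hv.2 ?_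
  rintro ⟨t, rfl⟩
  have h1 := hw.apply_eq_smul
  rw [map_smul, hv.apply_eq_smul, smul_comm] at h1
  have h2 : (μ - ν) • t • v = 0 := by rw [sub_smul, h1, sub_self]
  exact hne (sub_eq_zero.1 ((smul_eq_zero.1 h2).resolve_right hw.2))

/-- The eigenspaces of two distinct eigenvalues are lines. -/
theorem finrank_eigenspace {a : EquivariantStructure f p V} {b : EquivariantStructure f p L}
    (hab : DetEquivariantlyIso a b) (hx : f x = x) {μ ν : ℂ}
    (hμ : (a.atFixed hx).HasEigenvalue μ) (hν : (a.atFixed hx).HasEigenvalue ν) (hne : μ ≠ ν) :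
    Module.finrank ℂ ((a.atFixed hx).eigenspace μ) = 1 := by
  obtain ⟨v, hv⟩ := hμ.exists_hasEigenvector
  have hμ0 : μ ≠ 0 := by
    rintro rfl
    refine hv.2 (a.atFixed_injective hx ?_)
    rw [hv.apply_eq_smul, zero_smul, map_zero]
  refine finrank_eq_one (⟨v, hv.1⟩ : (a.atFixed hx).eigenspace μ)
    (fun h => hv.2 (congrArg Subtype.val h)) fun ⟨w, hw⟩ => ?_
  -- A second independent vector in the eigenspace would give `μ * μ = α_x = μ * ν`, against `μ ≠
  -- ν`.
  by_contra hcon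
  have h1 := mul_eigenvalue_eq_scalarAt hab hx hv.apply_eq_smul
    (Module.End.mem_eigenspace_iff.1 hw) hv.2
    fun ⟨t, ht⟩ => hcon ⟨t, Subtype.ext ht.symm⟩
  rw [← mul_eigenvalue_eq_scalarAt_of_ne hab hx hμ hν hne] at h1
  exact hne (mul_left_cancel₀ hμ0 h1)

end EquivariantStructure

end HolomorphicBundle

open HolomorphicBundle EquivariantStructure

/-! ## Exponents -/

section Exponents

variable {p : ℕ} {f : Automorphism X} {x : X} {V W : HolomorphicBundle.{u, v} X 2}
  {L : HolomorphicBundle.{u, v} X 1} {ζ : ℂ} {a : EquivariantStructure f p V}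
  {b : EquivariantStructure f p L}

theorem sqrtRootOfUnity_sq (hp : Odd p) {α : ℂ} (hα : α ^ p = 1) : sqrtRootOfUnity p α ^ 2 = α := by
  obtain ⟨m, rfl⟩ := hp
  rw [sqrtRootOfUnity, ← pow_mul, show (2 * m + 1 + 1) / 2 * 2 = 2 * m + 1 + 1 by omega, pow_succ,
    hα, one_mul]

theorem sqrtRootOfUnity_pow {α : ℂ} (hα : α ^ p = 1) : sqrtRootOfUnity p α ^ p = 1 := by
  rw [sqrtRootOfUnity, pow_right_comm, hα, one_pow]

/-- Two `p`-th roots of unity with product `β ^ 2` are `β ζ ^ i` and `β ζ ^ (-i)`. -/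
theorem IsPrimitiveRoot.exists_eq_mul_pow (hp : Odd p) (hζ : IsPrimitiveRoot ζ p) {β μ ν : ℂ}
    (hβ : β ^ p = 1) (hμ : μ ^ p = 1) (hμν : μ * ν = β ^ 2) (hne : μ ≠ ν) :
    ∃ i ∈ Finset.Icc 1 ((p - 1) / 2), (μ = β * ζ ^ i ∧ ν = β * (ζ ^ i)⁻¹) ∨
      (ν = β * ζ ^ i ∧ μ = β * (ζ ^ i)⁻¹) := by
  obtain ⟨m, rfl⟩ := hp
  have hβ0 : β ≠ 0 := by rintro rfl; simp at hβ
  have hζ0 : ζ ≠ 0 := hζ.ne_zero (2 * m).succ_ne_zero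
  have hμβ : (μ / β) ^ (2 * m + 1) = 1 := by rw [div_pow, hμ, hβ, div_one]
  obtain ⟨j, hj, hj2⟩ := hζ.eq_pow_of_pow_eq_one hμβ
  have hμj : μ = β * ζ ^ j := by rw [hj2, mul_div_cancel₀ _ hβ0]
  have hνj : ν = β * (ζ ^ j)⁻¹ := by
    rw [hμj] at hμν
    have := pow_ne_zero j hζ0
    field_simp
    refine mul_left_cancel₀ hβ0 ?_
    linear_combination hμν
  have hj0 : j ≠ 0 := by
    rintro rfl
    exact hne (by rw [hμj, hνj, pow_zero, inv_one])
  -- If `j` is too large, `p - j` is in range, and replacing `j` by it exchanges the roles of `μ`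
  -- and `ν`.
  by_cases hjm : j ≤ m
  · exact ⟨j, Finset.mem_Icc.2 ⟨by omega, by omega⟩, Or.inl ⟨hμj, hνj⟩⟩
  · refine ⟨2 * m + 1 - j, Finset.mem_Icc.2 ⟨by omega, by omega⟩, Or.inr ?_⟩
    have h1 : ζ ^ (2 * m + 1 - j) = (ζ ^ j)⁻¹ := by
      rw [pow_sub₀ _ hζ0 hj.le, hζ.pow_eq_one, one_mul]
    rw [h1, inv_inv]
    exact ⟨hνj, hμj⟩

/-- The sum `i + j` lies strictly between `0` and `p`. The case `i = j` separates the two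
eigenvalues; the general case makes the exponent unique. -/
theorem IsPrimitiveRoot.pow_ne_inv_pow (hζ : IsPrimitiveRoot ζ p) {i j : ℕ}
    (hi : i ∈ Finset.Icc 1 ((p - 1) / 2)) (hj : j ∈ Finset.Icc 1 ((p - 1) / 2)) :
    ζ ^ i ≠ (ζ ^ j)⁻¹ := by
  rw [Finset.mem_Icc] at hi hj
  intro h
  have hp0 : p ≠ 0 := by omega
  have h1 : ζ ^ (i + j) = 1 := by
    rw [pow_add, h, inv_mul_cancel₀ (pow_ne_zero _ (hζ.ne_zero hp0))]
  exact hζ.pow_ne_one_of_pos_of_lt (by omega) (by omega) h1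

theorem sqrtRootOfUnity_scalarAt_ne_zero (hp : p ≠ 0) (b : EquivariantStructure f p L)
    (hx : f x = x) : sqrtRootOfUnity p (b.scalarAt hx) ≠ 0 := by
  intro h
  have h1 := sqrtRootOfUnity_pow (b.scalarAt_pow hx)
  rw [h, zero_pow hp] at h1
  exact zero_ne_one h1

theorem IsEigenvalueExponent.unique (hζ : IsPrimitiveRoot ζ p) {hx : f x = x} {i j : ℕ}
    (hi : IsEigenvalueExponent ζ a b hx i) (hj : IsEigenvalueExponent ζ a b hx j) : i = j := by
  have hi1 := Finset.mem_Icc.1 hi.1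
  have hj1 := Finset.mem_Icc.1 hj.1
  have h0 := sqrtRootOfUnity_scalarAt_ne_zero (by omega : p ≠ 0) b hx
  rcases (hj.2 _).1 ((hi.2 _).2 (Or.inl rfl)) with h | h
  · exact hζ.pow_inj (by omega) (by omega) (mul_left_cancel₀ h0 h)
  · exact absurd (mul_left_cancel₀ h0 h) (hζ.pow_ne_inv_pow hi.1 hj.1)

theorem exists_isEigenvalueExponent (hp : Odd p) (hζ : IsPrimitiveRoot ζ p)
    (hab : DetEquivariantlyIso a b) (hx : f x = x) (hD : x ∈ distinctEigenvalueLocus a) :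
    ∃ i, IsEigenvalueExponent ζ a b hx i := by
  obtain ⟨_, μ, ν, hne, hμ, hν⟩ := hD
  have hα := b.scalarAt_pow hx
  have h1 := mul_eigenvalue_eq_scalarAt_of_ne hab hx hμ hν hne
  -- An eigenvalue other than `μ` also has product `α_x` with `μ`, hence equals `ν`.
  have hall : ∀ l, (a.atFixed hx).HasEigenvalue l ↔ l = μ ∨ l = ν := by
    refine fun l => ⟨fun hl => ?_, ?_⟩
    · by_contra! hcon
      have h2 := mul_eigenvalue_eq_scalarAt_of_ne hab hx hμ hl hcon.1.symm
      have hμ0 : μ ≠ 0 := by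
        rintro rfl
        rw [zero_mul] at h1
        rw [← h1, zero_pow hp.pos.ne'] at hα
        exact zero_ne_one hα
      exact hcon.2 (mul_left_cancel₀ hμ0 (h2.trans h1.symm))
    · rintro (rfl | rfl)
      exacts [hμ, hν]
  rw [← sqrtRootOfUnity_sq hp hα] at h1
  obtain ⟨i, hi, h⟩ := hζ.exists_eq_mul_pow hp (sqrtRootOfUnity_pow hα) (a.eigenvalue_pow hx hμ)
    h1 hne
  refine ⟨i, hi, fun l => (hall l).trans ?_⟩
  rcases h with ⟨h2, h3⟩ | ⟨h2, h3⟩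
  · rw [← h2, ← h3]
  · rw [← h2, ← h3, or_comm]

theorem IsEigenvalueExponent.finrank_eigenspace (hζ : IsPrimitiveRoot ζ p)
    (hab : DetEquivariantlyIso a b) {hx : f x = x} {i : ℕ}
    (hi : IsEigenvalueExponent ζ a b hx i) : Module.finrank ℂ
      ((a.atFixed hx).eigenspace (sqrtRootOfUnity p (b.scalarAt hx) * (ζ ^ i)⁻¹)) = 1 := by
  have hi1 := Finset.mem_Icc.1 hi.1
  refine EquivariantStructure.finrank_eigenspace hab hx ((hi.2 _).2 (Or.inr rfl))
    ((hi.2 _).2 (Or.inl rfl)) fun h => ?_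
  exact hζ.pow_ne_inv_pow hi.1 hi.1 (mul_left_cancel₀
    (sqrtRootOfUnity_scalarAt_ne_zero (by omega : p ≠ 0) b hx) h).symm

end Exponents

/-! ## The eigenspace flags -/

section Flags

variable {p : ℕ} {f : Automorphism X} {V W : HolomorphicBundle.{u, v} X 2}
  {L : HolomorphicBundle.{u, v} X 1} {ζ : ℂ} {a : EquivariantStructure f p V}
  {b : EquivariantStructure f p L}

theorem QuasiParabolicStructure.ext_flag {P Q : QuasiParabolicStructure V}
    (h : P.marked = Q.marked) (hF : ∀ x hP hQ, P.flag x hP = Q.flag x hQ) : P = Q := by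
  obtain ⟨M, _, F, _⟩ := P
  obtain ⟨M', _, F', _⟩ := Q
  obtain rfl : M = M' := h
  obtain rfl : F = F' := funext fun x => funext fun hx => hF x hx hx
  rfl

theorem existsUnique_isEigenspaceFlag [IsManifold 𝓘(ℂ, ℂ) ω X] [CompactSpace X]
    [ConnectedSpace X] [T2Space X] (hf : (f : X → X) ≠ id) (hp : Odd p)
    (hζ : IsPrimitiveRoot ζ p) (hab : DetEquivariantlyIso a b) :
    ∃! P : QuasiParabolicStructure V, IsEigenspaceFlag ζ a b P := by
  have hex : ∀ x, x ∈ distinctEigenvalueLocus a → ∃ F : Submodule ℂ (V.fiber x),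
      Module.finrank ℂ F = 1 ∧ ∀ hx : f x = x, ∃ i, IsEigenvalueExponent ζ a b hx i ∧
        F = (a.atFixed hx).eigenspace (sqrtRootOfUnity p (b.scalarAt hx) * (ζ ^ i)⁻¹) := by
    intro x hD
    obtain ⟨i, hi⟩ := exists_isEigenvalueExponent hp hζ hab hD.1 hD
    exact ⟨_, hi.finrank_eigenspace hζ hab, fun _ => ⟨i, hi, rfl⟩⟩
  choose F hF1 hF using hex
  have hfin : (distinctEigenvalueLocus a).Finite :=
    (finite_fixedPoints_of_automorphism hf).subset fun _ hx => hx.1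
  refine ⟨⟨_, hfin, F, hF1⟩, ⟨rfl, fun x hx hm => hF x hm hx⟩, fun Q hQ => ?_⟩
  refine QuasiParabolicStructure.ext_flag hQ.1 fun x hx hx' => ?_
  obtain ⟨i, hi, hQF⟩ := hQ.2 x hx'.1 hx
  obtain ⟨j, hj, hPF⟩ := hF x hx' hx'.1
  rw [hQF, hi.unique hζ hj, ← hPF]

/-- The fibres over `f x` and `x` are different types even when `f x = x`; with a variable `y` for
`f x` the equality can be substituted. -/
theorem map_eq_flag_of_map_fiberCast_eq (P : QuasiParabolicStructure V) {x y : X} (hy : y = x)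
    (hx : x ∈ P.marked) (hy' : y ∈ P.marked) (T : V.fiber x →ₗ[ℂ] V.fiber y)
    (h : (P.flag x hx).map ((fiberCast V.fiber hy).toLinearMap ∘ₗ T) = P.flag x hx) :
    (P.flag x hx).map T = P.flag y hy' := by
  subst hy
  exact h

theorem Module.End.map_eigenspace {K M : Type*} [Field K] [AddCommGroup M] [Module K M]
    (T : Module.End K M) {μ : K} (hμ : μ ≠ 0) : (T.eigenspace μ).map T = T.eigenspace μ := by
  ext v
  rw [Submodule.mem_map]
  constructor
  · rintro ⟨w, hw, rfl⟩
    rw [Module.End.mem_eigenspace_iff.1 hw]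
    exact Submodule.smul_mem _ _ hw
  · intro hv
    refine ⟨μ⁻¹ • v, Submodule.smul_mem _ _ hv, ?_⟩
    rw [map_smul, Module.End.mem_eigenspace_iff.1 hv, inv_smul_smul₀ hμ]

/-- Marked points are fixed by `f`, and an eigenspace with nonzero eigenvalue is mapped onto itself.
-/
theorem IsEigenspaceFlag.isFlagIso {P : QuasiParabolicStructure V} (hp : p ≠ 0) (hζ : ζ ≠ 0)
    (hP : IsEigenspaceFlag ζ a b P) : P.IsFlagIso (P.pullback f) a.toIso := by
  have hfix : ∀ {x}, x ∈ P.marked → f x = x := fun hx => (hP.1 ▸ hx :).1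
  refine ⟨?_, fun x hx hx' => ?_⟩
  · ext x
    refine ⟨fun hx => show f x ∈ P.marked by rwa [hfix hx], fun hx => ?_⟩
    have hx' : f x ∈ P.marked := hx
    have h : f x = x := f.injective (hfix hx')
    rwa [h] at hx'
  · refine map_eq_flag_of_map_fiberCast_eq P (hfix hx) hx hx' (liftMap a.toIso x) ?_
    obtain ⟨i, -, hi⟩ := hP.2 x (hfix hx) hx
    rw [hi]
    exact Module.End.map_eigenspace _ (mul_ne_zero (sqrtRootOfUnity_scalarAt_ne_zero hp b _)
      (inv_ne_zero (pow_ne_zero _ hζ)))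

variable {a' : EquivariantStructure f p W} {φ : V.Iso W}

theorem apply_atFixed (hφ : ∀ x e, φ.toEquiv (f x) (liftMap a.toIso x e) =
    liftMap a'.toIso x (φ.toEquiv x e)) {x : X} (hx : f x = x) (e : V.fiber x) :
    φ.toEquiv x (a.atFixed hx e) = a'.atFixed hx (φ.toEquiv x e) :=
  (φ.apply_fiberCast hx _).trans (congrArg _ (hφ x e))

theorem map_eigenspace_atFixed (hφ : ∀ x e, φ.toEquiv (f x) (liftMap a.toIso x e) =
    liftMap a'.toIso x (φ.toEquiv x e)) {x : X} (hx : f x = x) (μ : ℂ) :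
    ((a.atFixed hx).eigenspace μ).map (φ.toEquiv x).toLinearMap =
      (a'.atFixed hx).eigenspace μ := by
  ext w
  rw [Submodule.mem_map]
  constructor
  · rintro ⟨v, hv, rfl⟩
    refine Module.End.mem_eigenspace_iff.2 ((apply_atFixed hφ hx v).symm.trans ?_)
    rw [Module.End.mem_eigenspace_iff.1 hv, map_smul]
    rfl
  · intro hw
    refine ⟨(φ.toEquiv x).symm w, Module.End.mem_eigenspace_iff.2 ((φ.toEquiv x).injective ?_),
      (φ.toEquiv x).apply_symm_apply w⟩
    rw [apply_atFixed hφ, map_smul, (φ.toEquiv x).apply_symm_apply,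
      Module.End.mem_eigenspace_iff.1 hw]

theorem hasEigenvalue_atFixed_iff (hφ : ∀ x e, φ.toEquiv (f x) (liftMap a.toIso x e) =
    liftMap a'.toIso x (φ.toEquiv x e)) {x : X} (hx : f x = x) (μ : ℂ) :
    (a.atFixed hx).HasEigenvalue μ ↔ (a'.atFixed hx).HasEigenvalue μ := by
  rw [Module.End.hasEigenvalue_iff, Module.End.hasEigenvalue_iff, ← map_eigenspace_atFixed hφ,
    Ne, Ne, Submodule.map_eq_bot_iff]

/-- An isomorphism of bundles that intertwines the lifts of `f` maps the eigenspace flags to the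
eigenspace flags. -/
theorem IsEigenspaceFlag.isFlagIso_of_intertwines (hζ : IsPrimitiveRoot ζ p)
    (hφ : ∀ x e, φ.toEquiv (f x) (liftMap a.toIso x e) = liftMap a'.toIso x (φ.toEquiv x e))
    {P : QuasiParabolicStructure V} {Q : QuasiParabolicStructure W}
    (hP : IsEigenspaceFlag ζ a b P) (hQ : IsEigenspaceFlag ζ a' b Q) : P.IsFlagIso Q φ := by
  have hD : distinctEigenvalueLocus a = distinctEigenvalueLocus a' := by
    simp only [distinctEigenvalueLocus, hasEigenvalue_atFixed_iff hφ]
  refine ⟨by rw [hP.1, hQ.1, hD], fun x hx hx' => ?_⟩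
  have hfix : f x = x := (hP.1 ▸ hx :).1
  obtain ⟨i, hi, hPF⟩ := hP.2 x hfix hx
  obtain ⟨j, hj, hQF⟩ := hQ.2 x hfix hx'
  have hi' : IsEigenvalueExponent ζ a' b hfix i :=
    ⟨hi.1, fun μ => (hasEigenvalue_atFixed_iff hφ hfix μ).symm.trans (hi.2 μ)⟩
  rw [hPF, hQF, map_eigenspace_atFixed hφ, hi'.unique hζ hj]

end Flags

/-! ## The equivariant quasi-parabolic Higgs bundle -/

/-- The isomorphism `V → W` obtained from isomorphisms of a third bundle with `V` and `W`. -/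
def HolomorphicBundle.Iso.symmTrans {r : ℕ} {U V W : HolomorphicBundle.{u, v} X r} (φ : U.Iso V)
    (ψ : U.Iso W) : V.Iso W where
  toEquiv x := (φ.toEquiv x).symm.trans (ψ.toEquiv x)
  holomorphic O hO s hs := ψ.holomorphic O hO _ (φ.holomorphic_symm O hO s hs)
  holomorphic_symm O hO s hs := φ.holomorphic O hO _ (ψ.holomorphic_symm O hO s hs)

theorem HolomorphicBundle.Iso.symmTrans_apply {r : ℕ} {U V W : HolomorphicBundle.{u, v} X r}
    (φ : U.Iso V) (ψ : U.Iso W) (x : X) (e : U.fiber x) :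
    (φ.symmTrans ψ).toEquiv x (φ.toEquiv x e) = ψ.toEquiv x e :=
  congrArg (ψ.toEquiv x) ((φ.toEquiv x).symm_apply_apply e)

/-- Pulled back to `E`, the lifts of `A` and `B` coincide by uniqueness. The composite isomorphism
therefore intertwines the lifts, and with them eigenvalues, exponents and flags. -/
theorem EquivariantQuasiParabolicHiggsBundle.isIsomorphic_of_isEigenspaceBundle
    [IsManifold 𝓘(ℂ, ℂ) ω X] [CompactSpace X] [ConnectedSpace X] [T2Space X] {f : Automorphism X}
    {p : ℕ} (hp : Odd p) (hf : (f : X → X)^[p] = id) {ζ : ℂ} (hζ : IsPrimitiveRoot ζ p)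
    {L : HolomorphicBundle.{u, v} X 1} {b : EquivariantStructure f p L} {E : HiggsBundle.{u, v} X}
    (hE : E.IsStable) {A B : EquivariantQuasiParabolicHiggsBundle.{u, v} X f p}
    (hA : A.IsEigenspaceBundle ζ b) (hB : B.IsEigenspaceBundle ζ b)
    (hEA : E.IsIsomorphic A.higgs) (hEB : E.IsIsomorphic B.higgs) : A.IsIsomorphic B := by
  obtain ⟨φ, hφ⟩ := hEA
  obtain ⟨ψ, hψ⟩ := hEB
  have hab : A.lift.conj φ hf = B.lift.conj ψ hf :=
    hE.equivariantStructure_unique hp hf (hφ.conj A.isEquivariant.isHiggsIso)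
      (hψ.conj B.isEquivariant.isHiggsIso) (hA.1.conj φ hf) (hB.1.conj ψ hf)
  have hlift : ∀ x e, (φ.symmTrans ψ).toEquiv (f x) (liftMap A.lift.toIso x e) =
      liftMap B.lift.toIso x ((φ.symmTrans ψ).toEquiv x e) := by
    intro x e
    obtain ⟨e, rfl⟩ := (φ.toEquiv x).surjective e
    have h1 : liftMap (φ.conj A.lift.toIso) x e = liftMap (ψ.conj B.lift.toIso) x e :=
      congrArg (fun c : EquivariantStructure f p E.toHolomorphicBundle => liftMap c.toIso x e) hab
    rw [← φ.apply_conj, φ.symmTrans_apply, φ.symmTrans_apply, h1, ψ.apply_conj]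
  refine ⟨φ.symmTrans ψ, fun x w e => ?_, hA.2.isFlagIso_of_intertwines hζ hlift hB.2, hlift⟩
  obtain ⟨e, rfl⟩ := (φ.toEquiv x).surjective e
  rw [← hφ x w e, φ.symmTrans_apply, φ.symmTrans_apply, hψ x w e]

end

/-! ### The main theorem -/

theorem mainTheorem8 {X : Type u} [TopologicalSpace X] [T2Space X] [CompactSpace X]
    [ConnectedSpace X] [ChartedSpace ℂ X] [IsManifold 𝓘(ℂ, ℂ) ω X]
    (f : Automorphism X) (p : ℕ) (hp : p.Prime) (hp_odd : Odd p)
    (hf : (f : X → X)^[p] = id) (hf_ne : (f : X → X) ≠ id)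
    (ζ : ℂ) (hζ : IsPrimitiveRoot ζ p)
    (Λ : HolomorphicBundle.{u, v} X 1) (hΛ : ∃ d : ℤ, Odd d ∧ Λ.HasDegree d)
    (fΛ : HolomorphicBundle.EquivariantStructure f p Λ)
    (E : HiggsBundle.{u, v} X) (hE : E.MemModuli Λ) (hE_fixed : E.IsFixedBy f) :
    (∃! fE : HolomorphicBundle.EquivariantStructure f p E.toHolomorphicBundle,
      E.IsHiggsIso (E.pullback f) fE.toIso ∧ HolomorphicBundle.DetEquivariantlyIso fE fΛ) ∧
    (∀ fE : HolomorphicBundle.EquivariantStructure f p E.toHolomorphicBundle,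
      E.IsHiggsIso (E.pullback f) fE.toIso → HolomorphicBundle.DetEquivariantlyIso fE fΛ →
      (∀ x (hx : f x = x), x ∈ distinctEigenvalueLocus fE →
        ∃! i : ℕ, IsEigenvalueExponent ζ fE fΛ hx i) ∧
      (∃! P : QuasiParabolicStructure E.toHolomorphicBundle, IsEigenspaceFlag ζ fE fΛ P) ∧
      ∀ P : QuasiParabolicStructure E.toHolomorphicBundle, IsEigenspaceFlag ζ fE fΛ P →
        IsEquivariantQuasiParabolic E P fE) ∧
    (∀ A B : EquivariantQuasiParabolicHiggsBundle.{u, v} X f p,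
      A.IsEigenspaceBundle ζ fΛ → B.IsEigenspaceBundle ζ fΛ →
      E.IsIsomorphic A.higgs → E.IsIsomorphic B.higgs → A.IsIsomorphic B) := by
  have hp0 : p ≠ 0 := hp.ne_zero
  refine ⟨hE.1.existsUnique_equivariantStructure hE_fixed hp_odd hf fΛ hE.2,
    fun fE hfE hdet => ⟨fun x hx hxD => ?_, existsUnique_isEigenspaceFlag hf_ne hp_odd hζ hdet,
      fun P hP => ⟨fun x hx => (hP.1 ▸ hx :).1, hfE, hP.isFlagIso hp0 (hζ.ne_zero hp0)⟩⟩,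
    fun A B hA hB hEA hEB => EquivariantQuasiParabolicHiggsBundle.isIsomorphic_of_isEigenspaceBundle
      hp_odd hf hζ hE.1 hA hB hEA hEB⟩
  obtain ⟨i, hi⟩ := exists_isEigenvalueExponent hp_odd hζ hdet hx hxD
  exact ⟨i, hi, fun j hj => hj.unique hζ hi⟩
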